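/- **Theorem (Complexity for Smooth Nonconvex Loss).** *Setting.* Let $\mathcal Z$ be a measurable subset of a finite-dimensional real normed space, $\hat{\mathbb P}$ a probability distribution and $\rho>0$ such that $\mathbb B_\rho(z)\subseteq\mathcal Z$ for $\hat{\mathbb P}$-almost every $z$, where $\mathbb B_\rho(z)$ is the closed norm ball, and let $\nu_z$ be the uniform distribution on $\mathbb B_\rho(z)$. Let $\Theta\subseteq\mathbb R^{d}$ be nonempty, closed and convex, $\eta>0$, and $\phi(x)=x\log x-x+1$. Consider $$\min_{\theta\in\Theta} F(\theta)=\mathbb E_{z\sim\hat{\mathbb P}}[R(\theta;z)],\qquad R(\theta;z)=\sup_{\gamma}\Big\{\mathbb E_{z'\sim\gamma}[f_\theta(z')]-\eta\,\mathbb E_{z'\sim\nu_z}\Big[\phi\Big(\tfrac{d\gamma}{d\nu_z}(z')\Big)\Big]\Big\},$$ the supremum being over probability measures $\gamma\ll\nu_z$. Assume that $f_\theta(z)$ is measurable in $z$ and that, for all $z\in\mathcal Z$ and $\theta,\theta_1,\theta_2\in\Theta$, $|f_{\theta_1}(z)-f_{\theta_2}(z)|\le L_f\|\theta_1-\theta_2\|_2$,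 $0\le f_\theta(z)\le B$, and $f_\theta(z)$ is differentiable in $\theta$ with $\|\nabla f_{\theta_1}(z)-\nabla f_{\theta_2}(z)\|_2\le S_f\|\theta_1-\theta_2\|_2$ (gradients at points of $\Theta$ are taken relative to $\Theta$). *Estimator.* For an integer $\ell\ge0$ let $\zeta^\ell=(z,(z_i')_{1\le i\le 2^\ell})$, where $z\sim\hat{\mathbb P}$ and, given $z$, the $z_i'$ are i.i.d. from $\nu_z$. Put $U_{n_1:n_2}(\theta)=\eta\log\big(\frac1{n_2-n_1+1}\sum_{j=n_1}^{n_2}e^{f_\theta(z_j')/\eta}\big)$, $G^0(\theta,\zeta^0)=\nabla_\theta U_{1:1}$ and, for $\ell\ge1$, $G^\ell(\theta,\zeta^\ell)=\nabla_\theta\big[U_{1:2^\ell}-\frac12U_{1:2^{\ell-1}}-\frac12U_{2^{\ell-1}+1:2^\ell}\big]$. Given a maximal level $L$ and a batch size $n$, let $p_\ell=2^{-\ell}/(2-2^{-L})$ for $0\le\ell\le L$, draw i.i.d. levels $\ell_1,\dots,\ell_n$ from $p$ and then independent $\zeta_i^{\ell_i}$, and put $V(\theta)=\frac1n\sum_{i=1}^n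 p_{\ell_i}^{-1}G^{\ell_i}(\theta,\zeta_i^{\ell_i})$ (the RT-MLMC estimator). *Algorithm and cost.* Projected SGD with step size $\tau>0$ starts at $\theta_1\in\Theta$ and iterates $\theta_{t+1}=\mathrm{Proj}_\Theta(\theta_t-\tau V(\theta_t))$, $t=1,\dots,T-1$, with a fresh batch in each iteration; its output $\widetilde\theta$ is drawn uniformly from $\{\theta_1,\dots,\theta_T\}$, independently of the run. The computational cost is the expected total number of samples $z\sim\hat{\mathbb P}$ and $z'\sim\nu_z$ generated in the run, and the memory cost is the expected number of such samples generated (and held) in one iteration. The output is an $\epsilon$-stationary point for the step size $\tau$ if $$\mathbb E\Big\|\tfrac1\tau\big[\widetilde\theta-\mathrm{Proj}_\Theta(\widetilde\theta-\tau\nabla F(\widetilde\theta))\big]\Big\|_2^2\le\epsilon^2 .$$ *Claim.* There are an absolute integer $k\ge0$ and a constant $C>0$ depending only on $L_f,S_f,B,\eta$ such that for every $\epsilon\in(0,\frac12]$ the following holds, with hyper-parameters $L,T,n,\tau$ that depend only on $\epsilon,L_f,S_f,B,\eta$ and satisfy $T,n\ge1$ and $\tau>0$. In both parts, $F$ is differentiable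 on $\Theta$. 1. (Smooth nonconvex optimization.) For some $L\le C\log\frac1{\epsilon^2}$, $T\le C\epsilon^{-2}(\log\frac1\epsilon)^k$, $n\le C\epsilon^{-2}(\log\frac1\epsilon)^k$ and $\tau\le C$, the output is an $\epsilon$-stationary point for the step size $\tau$, with computational cost at most $C\epsilon^{-4}(\log\frac1\epsilon)^k=\widetilde{\mathcal O}(\epsilon^{-4})$ and memory cost at most $C\epsilon^{-2}(\log\frac1\epsilon)^k=\widetilde{\mathcal O}(\epsilon^{-2})$. 2. (Unconstrained smooth nonconvex optimization.) If $\Theta=\mathbb R^{d}$, then for some $L\le C\log\frac1{\epsilon^2}$, $T\le C\epsilon^{-4}(\log\frac1\epsilon)^k$, $n\le C$ and $\tau\le C\epsilon^2(\log\frac1\epsilon)^k$, the output is an $\epsilon$-stationary point for the step size $\tau$ (that is, $\mathbb E\|\nabla F(\widetilde\theta)\|_2^2\le\epsilon^2$), with computational cost at most $C\epsilon^{-4}(\log\frac1\epsilon)^k=\widetilde{\mathcal O}(\epsilon^{-4})$ and memory cost at most $C(\log\frac1\epsilon)^k=\widetilde{\mathcal O}(1)$. -/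

import Mathlib

open MeasureTheory ProbabilityTheory Set
open scoped ENNReal

namespace EntropicSGD

noncomputable section

/-- The parameter space `ℝ^d` with its Euclidean norm. -/
abbrev Param (d : ℕ) : Type := EuclideanSpace ℝ (Fin d)

section Objective

variable {E : Type*} [NormedAddCommGroup E] [NormedSpace ℝ E] [FiniteDimensional ℝ E]
  [MeasurableSpace E] [BorelSpace E]

/-- The uniform probability measure on the closed norm ball of radius `ρ` around `z`
(the normalisation of Lebesgue measure does not matter). -/
def ballMeasure (ρ : ℝ) (z : E) : Measure E :=
  ProbabilityTheory.cond Measure.addHaar (Metric.closedBall z ρ)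

/-- The entropy function `φ(x) = x log x - x + 1`. -/
def entropyFun (x : ℝ) : ℝ := x * Real.log x - x + 1

/-- The robust loss at `z`: the supremum over probability measures `γ` of
`E_γ[g] - η E_{ν_z}[φ(dγ/dν_z)]`, where `ν_z` is uniform on the ball of radius `ρ` around `z`.
Measures `γ` of infinite divergence have the value `-∞` and are left out. -/
def robustLoss (ρ η : ℝ) (g : E → ℝ) (z : E) : ℝ :=
  sSup {v : ℝ | ∃ γ : Measure E, IsProbabilityMeasure γ ∧ γ ≪ ballMeasure ρ z ∧
    Integrable (fun w => entropyFun (γ.rnDeriv (ballMeasure ρ z) w).toReal) (ballMeasure ρ z) ∧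
    v = ∫ w, g w ∂γ -
      η * ∫ w, entropyFun (γ.rnDeriv (ballMeasure ρ z) w).toReal ∂(ballMeasure ρ z)}

/-- The objective `F(θ) = E_{z ∼ P}[R(θ; z)]`. -/
def objective {d : ℕ} (P : Measure E) (ρ η : ℝ) (f : Param d → E → ℝ) (θ : Param d) : ℝ :=
  ∫ z, robustLoss ρ η (f θ) z ∂P

end Objective

/-- The loss assumptions, imposed for parameters in `Θ` and data in `𝒵`: measurability in `z`,
`Lf`-Lipschitz continuity in `θ`, values in `[0, B]`, and an `Sf`-Lipschitz gradient in `θ`.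
At points of `Θ` the derivative is taken relative to `Θ`. -/
structure SmoothBoundedLoss {d : ℕ} {E : Type*} [MeasurableSpace E] (Θ : Set (Param d))
    (𝒵 : Set E) (f : Param d → E → ℝ) (Lf Sf B : ℝ) : Prop where
  measurable : ∀ θ ∈ Θ, Measurable (f θ)
  lipschitz : ∀ z ∈ 𝒵, ∀ θ₁ ∈ Θ, ∀ θ₂ ∈ Θ, |f θ₁ z - f θ₂ z| ≤ Lf * ‖θ₁ - θ₂‖
  bounded : ∀ z ∈ 𝒵, ∀ θ ∈ Θ, 0 ≤ f θ z ∧ f θ z ≤ B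
  smooth : ∀ z ∈ 𝒵, ∃ g : Param d → Param d,
    (∀ θ ∈ Θ, HasGradientWithinAt (fun ϑ => f ϑ z) (g θ) Θ θ) ∧
    ∀ θ₁ ∈ Θ, ∀ θ₂ ∈ Θ, ‖g θ₁ - g θ₂‖ ≤ Sf * ‖θ₁ - θ₂‖

section Projection

/-- The Euclidean projection onto `Θ`: a point of `Θ` nearest to `x`
(it exists and is unique when `Θ` is nonempty, closed and convex). -/
def proj {d : ℕ} (Θ : Set (Param d)) (x : Param d) : Param d :=
  Classical.epsilon fun y => y ∈ Θ ∧ ∀ w ∈ Θ, ‖x - y‖ ≤ ‖x - w‖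

theorem proj_spec {d : ℕ} {Θ : Set (Param d)} (hne : Θ.Nonempty) (hcl : IsClosed Θ)
    (x : Param d) : proj Θ x ∈ Θ ∧ ∀ w ∈ Θ, ‖x - proj Θ x‖ ≤ ‖x - w‖ := by
  obtain ⟨y, hy, h⟩ := hcl.exists_infDist_eq_dist hne x
  refine Classical.epsilon_spec (p := fun y => y ∈ Θ ∧ ∀ w ∈ Θ, ‖x - y‖ ≤ ‖x - w‖) ⟨y, hy, ?_⟩
  intro w hw
  rw [← dist_eq_norm, ← dist_eq_norm, ← h]
  exact Metric.infDist_le_dist_of_mem hw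

end Projection

section Stationarity

/-- A random vector `X` on the probability space `(Ω, μ)` is a `δ`-stationary point of
`min_{θ ∈ Θ} F(θ)` for the step size `τ` if
`E ‖τ⁻¹ (X - Proj_Θ(X - τ ∇F(X)))‖² ≤ δ²`. The gradient of `F` is relative to `Θ`; for convex
`Θ`, a gradient that is not unique is determined up to vectors that do not affect the projection. -/
def IsStationary {d : ℕ} {Ω : Type*} [MeasurableSpace Ω] (μ : Measure Ω) (X : Ω → Param d)
    (Θ : Set (Param d)) (F : Param d → ℝ) (τ δ : ℝ) : Prop :=
  ∫⁻ ω, ‖τ⁻¹ • (X ω - proj Θ (X ω - τ • gradientWithin F Θ (X ω)))‖ₑ ^ 2 ∂μ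
    ≤ ENNReal.ofReal (δ ^ 2)

end Stationarity

section Sampling

variable {E : Type*} [NormedAddCommGroup E] [NormedSpace ℝ E] [FiniteDimensional ℝ E]
  [MeasurableSpace E] [BorelSpace E]

/-- The law of `ζ^ℓ = (z, (z'_i)_{i ≤ 2^ℓ})`: `z` is drawn from `P` and, given `z`, the `z'_i` are
i.i.d. from the uniform distribution on the ball of radius `ρ` around `z`. -/
def zetaLaw (P : Measure E) (ρ : ℝ) (ℓ : ℕ) : Measure (E × (Fin (2 ^ ℓ) → E)) :=
  P.bind fun z => (Measure.dirac z).prod (Measure.pi fun _ : Fin (2 ^ ℓ) => ballMeasure ρ z)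

/-- The truncated geometric distribution `P(ℓ) = 2^{-ℓ} / (2 - 2^{-L})` on `{0, …, L}`. -/
def levelProb (L ℓ : ℕ) : ℝ := (1 / 2) ^ ℓ / (2 - (1 / 2) ^ L)

/-- One draw of the randomized truncation estimator: a level `ℓ ∈ {0, …, L}` together with a
value of `ζ^ℓ`. -/
abbrev Draw (L : ℕ) (E : Type*) : Type _ := Σ ℓ : Fin (L + 1), E × (Fin (2 ^ (ℓ : ℕ)) → E)

/-- The law of one draw: the level is truncated geometric, and given `ℓ` one draws `ζ^ℓ`. -/
def drawLaw (P : Measure E) (ρ : ℝ) (L : ℕ) : Measure (Draw L E) :=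
  ∑ ℓ : Fin (L + 1), ENNReal.ofReal (levelProb L ℓ) •
    (zetaLaw P ρ (ℓ : ℕ)).map
      (Sigma.mk (β := fun m : Fin (L + 1) => E × (Fin (2 ^ (m : ℕ)) → E)) ℓ)

/-- A mini-batch consists of `n` i.i.d. draws. -/
def batchLaw (P : Measure E) (ρ : ℝ) (L n : ℕ) : Measure (Fin n → Draw L E) :=
  Measure.pi fun _ : Fin n => drawLaw P ρ L

/-- A run of `T` iterates uses `T - 1` i.i.d. mini-batches. -/
def runLaw (P : Measure E) (ρ : ℝ) (L n T : ℕ) : Measure (Fin (T - 1) → Fin n → Draw L E) :=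
  Measure.pi fun _ : Fin (T - 1) => batchLaw P ρ L n

/-- The law of a run together with an independent index that is uniform on the `T` iterates. -/
def outputLaw (P : Measure E) (ρ : ℝ) (L n T : ℕ) :
    Measure (Fin T × (Fin (T - 1) → Fin n → Draw L E)) :=
  (uniformOn (Set.univ : Set (Fin T))).prod (runLaw P ρ L n T)

/-- The uniform measure on a ball of positive radius is a probability measure. -/
theorem isProbabilityMeasure_ballMeasure {ρ : ℝ} (hρ : 0 < ρ) (z : E) :
    IsProbabilityMeasure (ballMeasure ρ z) :=
  cond_isProbabilityMeasure_of_finite (Metric.measure_closedBall_pos _ z hρ).ne'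
    measure_closedBall_lt_top.ne

theorem measurable_ballMeasure (ρ : ℝ) : Measurable (ballMeasure ρ : E → Measure E) := by
  have key : ∀ s : Set E, MeasurableSet s →
      Measurable fun z : E => (Measure.addHaar : Measure E) (Metric.closedBall z ρ ∩ s) := by
    intro s hs
    have hm : MeasurableSet {p : E × E | dist p.2 p.1 ≤ ρ ∧ p.2 ∈ s} :=
      (measurableSet_le (measurable_snd.dist measurable_fst) measurable_const).inter
        (measurable_snd hs)
    exact measurable_measure_prodMk_left hm
  refine Measure.measurable_of_measurable_coe _ fun s hs => ?_
  have h1 := key Set.univ MeasurableSet.univ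
  simp only [Set.inter_univ] at h1
  simp only [ballMeasure, ProbabilityTheory.cond_apply Metric.isClosed_closedBall.measurableSet]
  exact h1.inv.mul (key s hs)

/-- The conditional law of `ζ^ℓ` given `z` depends measurably on `z`, as `zetaLaw` requires. -/
theorem measurable_zeta {ρ : ℝ} (hρ : 0 < ρ) (m : ℕ) :
    Measurable fun z : E => (Measure.dirac z).prod (Measure.pi fun _ : Fin m => ballMeasure ρ z) := by
  have := fun z : E => isProbabilityMeasure_ballMeasure hρ z
  have hpi : Measurable fun z : E => Measure.pi fun _ : Fin m => ballMeasure ρ z := by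
    refine Measurable.measure_of_isPiSystem_of_isProbabilityMeasure
      (generateFrom_pi (α := fun _ : Fin m => E)).symm isPiSystem_pi ?_
    rintro _ ⟨s, hs, rfl⟩
    simp only [Measure.pi_pi]
    exact Finset.measurable_prod _ fun i _ => (Measure.measurable_coe (hs i (mem_univ i))).comp (measurable_ballMeasure ρ)
  refine Measurable.measure_of_isPiSystem_of_isProbabilityMeasure
      generateFrom_prod.symm isPiSystem_prod ?_
  rintro _ ⟨s, hs, t, ht, rfl⟩
  simp only [Measure.prod_prod]
  exact ((Measure.measurable_coe (show MeasurableSet s from hs)).comp Measure.measurable_dirac).mul ((Measure.measurable_coe (show MeasurableSet t from ht)).comp hpi)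

end Sampling

section Algorithm

variable {d : ℕ} {E : Type*}

/-- `U_s(θ) = η log (|s|⁻¹ ∑_{j ∈ s} exp (f_θ(z'_j) / η))` for a set `s` of sample indices. -/
def softMean (η : ℝ) (f : Param d → E → ℝ) {m : ℕ} (z' : Fin m → E) (s : Finset (Fin m))
    (θ : Param d) : ℝ :=
  η * Real.log ((s.card : ℝ)⁻¹ * ∑ j ∈ s, Real.exp (f θ (z' j) / η))

/-- `U_{1:2^ℓ} - U_{1:2^{ℓ-1}} / 2 - U_{2^{ℓ-1}+1:2^ℓ} / 2`, and `U_{1:1}` at the level `ℓ = 0`. -/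
def levelDiff (η : ℝ) (f : Param d → E → ℝ) (ℓ : ℕ) (z' : Fin (2 ^ ℓ) → E) (θ : Param d) : ℝ :=
  if ℓ = 0 then softMean η f z' Finset.univ θ
  else softMean η f z' Finset.univ θ
    - (1 / 2) * softMean η f z' (Finset.univ.filter fun j => (j : ℕ) < 2 ^ (ℓ - 1)) θ
    - (1 / 2) * softMean η f z' (Finset.univ.filter fun j => 2 ^ (ℓ - 1) ≤ (j : ℕ)) θ

/-- The random vector `G^ℓ(θ, ζ^ℓ)`, the gradient of `levelDiff` in `θ`. -/
def levelGrad (Θ : Set (Param d)) (η : ℝ) (f : Param d → E → ℝ) (ℓ : ℕ) (z' : Fin (2 ^ ℓ) → E)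
    (θ : Param d) : Param d :=
  gradientWithin (levelDiff η f ℓ z') Θ θ

/-- The RT-MLMC gradient estimator
`V(θ) = n⁻¹ ∑_i P(ℓ_i)⁻¹ G^{ℓ_i}(θ, ζ_i^{ℓ_i})` from a mini-batch of `n` draws. -/
def rtmlmc (Θ : Set (Param d)) (η : ℝ) (f : Param d → E → ℝ) {L n : ℕ} (b : Fin n → Draw L E)
    (θ : Param d) : Param d :=
  (n : ℝ)⁻¹ • ∑ i, (levelProb L ((b i).1 : ℕ))⁻¹ •
    levelGrad Θ η f ((b i).1 : ℕ) (b i).2.2 θ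

/-- Projected SGD `θ_{t+1} = Proj_Θ(θ_t - τ V(θ_t))` with the RT-MLMC estimator, from `N`
mini-batches. The initial point has the index `0`; there is no step after the `N`-th. -/
def iterate (Θ : Set (Param d)) (η : ℝ) (f : Param d → E → ℝ) (τ : ℝ) (θ₁ : Param d)
    {L n N : ℕ} (ω : Fin N → Fin n → Draw L E) : ℕ → Param d
  | 0 => θ₁
  | t + 1 =>
    if h : t < N then
      proj Θ (iterate Θ η f τ θ₁ ω t - τ • rtmlmc Θ η f (ω ⟨t, h⟩) (iterate Θ η f τ θ₁ ω t))
    else iterate Θ η f τ θ₁ ω t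

/-- The output of the algorithm: the iterate with the randomly selected index. -/
def output (Θ : Set (Param d)) (η : ℝ) (f : Param d → E → ℝ) (τ : ℝ) (θ₁ : Param d)
    {L n T : ℕ} (ω : Fin T × (Fin (T - 1) → Fin n → Draw L E)) : Param d :=
  iterate Θ η f τ θ₁ ω.2 ω.1

end Algorithm

section Cost

variable {E : Type*}

/-- The number of samples (one `z` and `2^ℓ` points `z'_i` per draw) generated for a mini-batch. -/
def batchCost {L n : ℕ} (b : Fin n → Draw L E) : ℕ := ∑ i, (1 + 2 ^ ((b i).1 : ℕ))

variable [NormedAddCommGroup E] [NormedSpace ℝ E] [FiniteDimensional ℝ E]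
  [MeasurableSpace E] [BorelSpace E]

/-- The computational cost: the expected number of samples generated in a whole run. -/
def computationalCost (P : Measure E) (ρ : ℝ) (L n T : ℕ) : ℝ≥0∞ :=
  ∫⁻ ω, ((∑ t, batchCost (ω t) : ℕ) : ℝ≥0∞) ∂(runLaw P ρ L n T)

/-- The memory cost: the expected number of samples that one iteration generates and holds. -/
def memoryCost (P : Measure E) (ρ : ℝ) (L n : ℕ) : ℝ≥0∞ :=
  ∫⁻ b, (batchCost b : ℝ≥0∞) ∂(batchLaw P ρ L n)

end Cost

end

end EntropicSGD

open EntropicSGD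

/-! The entropic penalty makes the inner supremum explicit. By the Gibbs variational formula
(`robustLoss_eq`), R(θ;z) is η times the logarithm of the ν_z-mean of exp(f_θ/η). Its gradient is
the average of ∇f_θ with weights proportional to exp(f_θ/η), and the bounds on f make F smooth with
a constant that depends only on the data of the problem (`softLoss_quadApprox`,
`objective_quadApprox`).

This gradient is a ratio of expectations, so its plug-in version from m samples is biased, but its
mean square error is O(1/m) (`LossPair.integral_norm_sq_softGrad_sub_le`). The level differences
telescope in expectation, so one weighted draw has the mean of the plug-in estimator with 2^L
samples and squared bias O(2^{-L}). Level ℓ has second moment O(2^{-ℓ}), which the probability p_ℓ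
of order 2^{-ℓ} just compensates: every level contributes O(1) to the second moment of a draw, and
O(1) to its expected cost. With L of order log(1/ε) the squared bias is below a multiple of ε²,
while second moment and cost per draw are logarithmic.

The rest is a descent argument with the potential (8/τ)F. With constraints, a projected step pays
for the whole mean square error of V (`descent_step`); this calls for batches of size about ε^{-2},
and then a constant step size and about ε^{-2} iterations suffice. Without constraints V enters the
first-order term linearly (`descent_step_univ`), so the second moment appears only with a factor τ;
single draws suffice with τ about ε² and about ε^{-4} iterations.

Two technical devices run through the proof. If Θ has empty interior, gradients relative to Θ are
not unique; only their pairings with differences of points of Θ matter, and on these all choices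
agree. Moreover, the iterates are never shown to be measurable: the recursion uses only inequalities
for lower integrals that hold for arbitrary functions, and measurability is needed just for a
well-chosen substitute `batchDir` of the estimator. -/

namespace EntropicSGD
open Filter Topology
open scoped RealInnerProductSpace

set_option linter.unusedSectionVars false

/-! ### Gradients relative to a convex set, and their measurable selection -/

section Quad

variable {d : ℕ}

/-- `h` agrees on `Θ` with its linearisation at `θ` in direction `g`, up to a quadratic error. -/
def QuadApprox (Θ : Set (Param d)) (h : Param d → ℝ) (θ g : Param d) (c : ℝ) : Prop :=
  ∀ θ' ∈ Θ, |h θ' - h θ - ⟪g, θ' - θ⟫| ≤ c * ‖θ' - θ‖ ^ 2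

theorem QuadApprox.hasGradientWithinAt {Θ : Set (Param d)} {h : Param d → ℝ} {θ g : Param d}
    {c : ℝ} (H : QuadApprox Θ h θ g c) : HasGradientWithinAt h g Θ θ := by
  rw [hasGradientWithinAt_iff_isLittleO]
  have h1 : (fun θ' => h θ' - h θ - ⟪g, θ' - θ⟫) =O[𝓝[Θ] θ] fun θ' => ‖θ' - θ‖ ^ 2 := by
    refine Asymptotics.IsBigO.of_bound c ?_
    filter_upwards [self_mem_nhdsWithin] with θ' hθ'
    simpa using H θ' hθ'
  refine h1.trans_isLittleO ?_
  have h2 : (fun θ' => ‖θ' - θ‖ ^ 2) =o[𝓝 θ] fun θ' => θ' - θ :=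
    Asymptotics.isLittleO_pow_sub_sub θ one_lt_two
  exact h2.mono nhdsWithin_le_nhds

/-- The segment from `θ` to `θ'` lies in `Θ`, so its direction belongs to the tangent cone, on which
derivatives within `Θ` are unique. -/
theorem HasGradientWithinAt.inner_sub_eq {Θ : Set (Param d)} (hΘ : Convex ℝ Θ) {h : Param d → ℝ}
    {θ g g' : Param d} (hθ : θ ∈ Θ) (H : HasGradientWithinAt h g Θ θ)
    (H' : HasGradientWithinAt h g' Θ θ) {θ' : Param d} (hθ' : θ' ∈ Θ) :
    ⟪g, θ' - θ⟫ = ⟪g', θ' - θ⟫ := by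
  have := HasFDerivWithinAt.unique_on H.hasFDerivWithinAt H'.hasFDerivWithinAt
    (mem_tangentConeAt_of_segment_subset (hΘ.segment_subset hθ hθ'))
  simpa using this

/-- `gradientWithin` is an arbitrary choice among the gradients. In every pairing with a difference
of points of `Θ` it may be replaced by a convenient `g`, and the projection onto `Θ` sees nothing
else. -/
theorem QuadApprox.inner_gradientWithin {Θ : Set (Param d)} (hΘ : Convex ℝ Θ) {h : Param d → ℝ}
    {θ g : Param d} {c : ℝ} (hθ : θ ∈ Θ) (H : QuadApprox Θ h θ g c) {a b : Param d} (ha : a ∈ Θ)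
    (hb : b ∈ Θ) : ⟪gradientWithin h Θ θ, b - a⟫ = ⟪g, b - a⟫ := by
  have h1 := H.hasGradientWithinAt
  have h2 := h1.differentiableWithinAt.hasGradientWithinAt
  have ea := HasGradientWithinAt.inner_sub_eq hΘ hθ h2 h1 ha
  have eb := HasGradientWithinAt.inner_sub_eq hΘ hθ h2 h1 hb
  have e : b - a = (b - θ) - (a - θ) := by abel
  rw [e, inner_sub_right _ (b - θ), ea, eb, ← inner_sub_right]

theorem QuadApprox.lincomb {Θ : Set (Param d)} {h₁ h₂ : Param d → ℝ} {θ g₁ g₂ : Param d}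
    {c₁ c₂ : ℝ} (H₁ : QuadApprox Θ h₁ θ g₁ c₁) (r : ℝ) (H₂ : QuadApprox Θ h₂ θ g₂ c₂) :
    QuadApprox Θ (fun ϑ => h₁ ϑ - r * h₂ ϑ) θ (g₁ - r • g₂) (c₁ + |r| * c₂) := by
  intro θ' hθ'
  have e : h₁ θ' - r * h₂ θ' - (h₁ θ - r * h₂ θ) - ⟪g₁ - r • g₂, θ' - θ⟫
      = (h₁ θ' - h₁ θ - ⟪g₁, θ' - θ⟫) - r * (h₂ θ' - h₂ θ - ⟪g₂, θ' - θ⟫) := by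
    rw [inner_sub_left, real_inner_smul_left]; ring
  rw [e]
  refine (abs_sub _ _).trans ?_
  rw [abs_mul, add_mul, mul_assoc]
  exact add_le_add (H₁ θ' hθ') (mul_le_mul_of_nonneg_left (H₂ θ' hθ') (abs_nonneg _))

/-- Mean value inequality on the segment. The factor 1/2 of the usual descent lemma is given up. -/
theorem quadApprox_of_lipschitz_gradient {Θ : Set (Param d)} (hΘ : Convex ℝ Θ) {h : Param d → ℝ}
    {g : Param d → Param d} {c : ℝ} (hc : 0 ≤ c) (hg : ∀ θ ∈ Θ, HasGradientWithinAt h (g θ) Θ θ)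
    (hL : ∀ θ₁ ∈ Θ, ∀ θ₂ ∈ Θ, ‖g θ₁ - g θ₂‖ ≤ c * ‖θ₁ - θ₂‖) {θ : Param d} (hθ : θ ∈ Θ) :
    QuadApprox Θ h θ (g θ) c := by
  intro θ' hθ'
  have hseg := hΘ.segment_subset hθ hθ'
  have := Convex.norm_image_sub_le_of_norm_hasFDerivWithin_le' (𝕜 := ℝ) (f := h)
    (C := c * ‖θ' - θ‖) (s := segment ℝ θ θ') (x := θ) (y := θ')
    (f' := fun x => InnerProductSpace.toDual ℝ (Param d) (g x))
    (φ := InnerProductSpace.toDual ℝ (Param d) (g θ))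
    (fun x hx => (hg x (hseg hx)).hasFDerivWithinAt.mono hseg) ?_ (convex_segment _ _)
    (left_mem_segment _ _ _) (right_mem_segment _ _ _)
  · rw [InnerProductSpace.toDual_apply_apply, Real.norm_eq_abs] at this
    rw [sq, ← mul_assoc]; exact this
  · intro x hx
    rw [← map_sub, LinearIsometryEquiv.norm_map]
    refine (hL x (hseg hx) θ hθ).trans ?_
    refine mul_le_mul_of_nonneg_left ?_ hc
    rw [segment_eq_image'] at hx
    obtain ⟨t, ht, rfl⟩ := hx
    rw [add_sub_cancel_left, norm_smul, Real.norm_eq_abs, abs_of_nonneg ht.1]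
    exact mul_le_of_le_one_left (norm_nonneg _) ht.2

/-- The difference cone of a convex set is its direction space. -/
theorem exists_eq_smul_sub_of_mem_span {Θ : Set (Param d)} (hΘ : Convex ℝ Θ) {θ : Param d}
    (hθ : θ ∈ Θ) {v : Param d} (hv : v ∈ vectorSpan ℝ Θ) :
    ∃ r : ℝ, 0 ≤ r ∧ ∃ a ∈ Θ, ∃ b ∈ Θ, v = r • (b - a) := by
  unfold vectorSpan at hv
  induction hv using Submodule.span_induction with
  | mem x hx =>
    obtain ⟨b, hb, a, ha, rfl⟩ := hx
    exact ⟨1, zero_le_one, a, ha, b, hb, by simp⟩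
  | zero => exact ⟨0, le_rfl, θ, hθ, θ, hθ, by simp⟩
  | add x y _ _ hx hy =>
    obtain ⟨r, hr, a, ha, b, hb, rfl⟩ := hx
    obtain ⟨s, hs, a', ha', b', hb', rfl⟩ := hy
    rcases (add_nonneg hr hs).eq_or_lt with h0 | h0
    · have hr0 : r = 0 := by linarith
      have hs0 : s = 0 := by linarith
      exact ⟨0, le_rfl, θ, hθ, θ, hθ, by simp [hr0, hs0]⟩
    · have h1 : r / (r + s) + s / (r + s) = 1 := by field_simp
      refine ⟨r + s, h0.le, (r / (r + s)) • a + (s / (r + s)) • a',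
        hΘ ha ha' (by positivity) (by positivity) h1, (r / (r + s)) • b + (s / (r + s)) • b',
        hΘ hb hb' (by positivity) (by positivity) h1, ?_⟩
      have e1 : (r + s) * (r / (r + s)) = r := by field_simp
      have e2 : (r + s) * (s / (r + s)) = s := by field_simp
      rw [smul_sub (r + s), smul_add (r + s), smul_add (r + s), smul_smul, smul_smul, smul_smul,
        smul_smul, e1, e2]
      module
  | smul c x _ hx =>
    obtain ⟨r, hr, a, ha, b, hb, rfl⟩ := hx
    rcases le_total 0 c with hc | hc
    · exact ⟨c * r, mul_nonneg hc hr, a, ha, b, hb, by rw [smul_smul]⟩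
    · exact ⟨-c * r, mul_nonneg (by linarith) hr, b, hb, a, ha, by module⟩

/-- Difference quotients between two points that shrink towards `θ`. -/
theorem QuadApprox.tendsto_quotient {Θ : Set (Param d)} (hΘ : Convex ℝ Θ) {h : Param d → ℝ}
    {θ g : Param d} {c : ℝ} (hθ : θ ∈ Θ) (H : QuadApprox Θ h θ g c) {a b : Param d} (ha : a ∈ Θ)
    (hb : b ∈ Θ) :
    Tendsto (fun n : ℕ => ((n : ℝ) + 1) * (h (θ + ((n : ℝ) + 1)⁻¹ • (b - θ))
      - h (θ + ((n : ℝ) + 1)⁻¹ • (a - θ)))) atTop (𝓝 ⟪g, b - a⟫) := by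
  have key : ∀ b ∈ Θ, Tendsto (fun n : ℕ => ((n : ℝ) + 1) * (h (θ + ((n : ℝ) + 1)⁻¹ • (b - θ))
      - h θ)) atTop (𝓝 ⟪g, b - θ⟫) := by
    intro b hb
    rw [tendsto_iff_norm_sub_tendsto_zero]
    refine squeeze_zero (g := fun n : ℕ => c * ‖b - θ‖ ^ 2 * ((n : ℝ) + 1)⁻¹)
      (fun _ => norm_nonneg _) (fun n => ?_) ?_
    · have hn : (0 : ℝ) < (n : ℝ) + 1 := by positivity
      have hm : θ + ((n : ℝ) + 1)⁻¹ • (b - θ) ∈ Θ :=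
        hΘ.add_smul_sub_mem hθ hb ⟨by positivity, inv_le_one_of_one_le₀ (by linarith [n.cast_nonneg (α := ℝ)])⟩
      have := H _ hm
      rw [add_sub_cancel_left, real_inner_smul_right, norm_smul, Real.norm_eq_abs,
        abs_of_pos (inv_pos.2 hn)] at this
      have e : ((n : ℝ) + 1) * (h (θ + ((n : ℝ) + 1)⁻¹ • (b - θ)) - h θ) - ⟪g, b - θ⟫
          = ((n : ℝ) + 1) * (h (θ + ((n : ℝ) + 1)⁻¹ • (b - θ)) - h θ
            - ((n : ℝ) + 1)⁻¹ * ⟪g, b - θ⟫) := by field_simp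
      rw [e, norm_mul, Real.norm_eq_abs, Real.norm_eq_abs, abs_of_pos hn]
      refine (mul_le_mul_of_nonneg_left this hn.le).trans (le_of_eq ?_)
      field_simp
    · have := (tendsto_inv_atTop_zero.comp (tendsto_atTop_add_const_right atTop (1 : ℝ)
        (tendsto_natCast_atTop_atTop (R := ℝ)))).const_mul (c * ‖b - θ‖ ^ 2)
      simpa using this
  have := (key b hb).sub (key a ha)
  rw [← inner_sub_right, sub_sub_sub_cancel_right] at this
  refine this.congr fun n => ?_
  ring

/-- The difference quotients have both endpoints moving towards `θ`, so the Lipschitz bound is in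
terms of `b - a` and does not involve the distances to `θ`. -/
theorem QuadApprox.abs_inner_le {Θ : Set (Param d)} (hΘ : Convex ℝ Θ) {h : Param d → ℝ}
    {θ g : Param d} {c K : ℝ} (hθ : θ ∈ Θ) (H : QuadApprox Θ h θ g c)
    (hL : ∀ θ₁ ∈ Θ, ∀ θ₂ ∈ Θ, |h θ₁ - h θ₂| ≤ K * ‖θ₁ - θ₂‖) {a b : Param d} (ha : a ∈ Θ)
    (hb : b ∈ Θ) : |⟪g, b - a⟫| ≤ K * ‖b - a‖ := by
  refine le_of_tendsto (H.tendsto_quotient hΘ hθ ha hb).abs (Eventually.of_forall fun n => ?_)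
  have hn : (0 : ℝ) < (n : ℝ) + 1 := by positivity
  have hm : ∀ b ∈ Θ, θ + ((n : ℝ) + 1)⁻¹ • (b - θ) ∈ Θ := fun b hb =>
    hΘ.add_smul_sub_mem hθ hb ⟨by positivity, inv_le_one_of_one_le₀ (by linarith [n.cast_nonneg (α := ℝ)])⟩
  have := hL _ (hm b hb) _ (hm a ha)
  rw [add_sub_add_left_eq_sub, ← smul_sub, sub_sub_sub_cancel_right, norm_smul, Real.norm_eq_abs,
    abs_of_pos (inv_pos.2 hn)] at this
  rw [abs_mul, abs_of_pos hn]
  refine (mul_le_mul_of_nonneg_left this hn.le).trans (le_of_eq ?_)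
  field_simp

variable {E : Type*} [MeasurableSpace E]

/-- At each `θ ∈ Θ` there is a measurable and bounded selection of the gradients. -/
theorem SmoothBoundedLoss.exists_gradient {Θ : Set (Param d)} (hΘ : Convex ℝ Θ)
    {f : Param d → E → ℝ} {Lf Sf B : ℝ} (hLf : 0 ≤ Lf) (hSf : 0 ≤ Sf)
    (H : SmoothBoundedLoss Θ univ f Lf Sf B) {θ : Param d} (hθ : θ ∈ Θ) :
    ∃ g : E → Param d, Measurable g ∧ (∀ z, ‖g z‖ ≤ Lf) ∧
      ∀ z, QuadApprox Θ (fun ϑ => f ϑ z) θ (g z) Sf := by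
  choose g₀ hg₀ hg₁ using fun z => H.smooth z (mem_univ z)
  have hq₀ : ∀ z, QuadApprox Θ (fun ϑ => f ϑ z) θ (g₀ z θ) Sf := fun z =>
    quadApprox_of_lipschitz_gradient hΘ hSf (hg₀ z) (hg₁ z) hθ
  -- The chosen gradient need be neither measurable nor bounded in `z`. Its component along the
  -- direction space of `Θ` is determined by `f`, and turns out to be both.
  set V := vectorSpan ℝ Θ with hV
  have hin : ∀ z, ∀ v ∈ V, ⟪V.starProjection (g₀ z θ), v⟫ = ⟪g₀ z θ, v⟫ := fun z v hv => by
    rw [Submodule.inner_starProjection_left_eq_right, Submodule.starProjection_eq_self_iff.2 hv]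
  have hmeas : ∀ v ∈ V, Measurable fun z => ⟪g₀ z θ, v⟫ := by
    intro v hv
    obtain ⟨r, -, a, ha, b, hb, rfl⟩ := exists_eq_smul_sub_of_mem_span hΘ hθ hv
    simp only [real_inner_smul_right]
    refine Measurable.const_mul ?_ r
    -- The pairing is a pointwise limit of difference quotients of functions that are measurable in
    -- `z`.
    refine measurable_of_tendsto_metrizable (f := fun (n : ℕ) z => ((n : ℝ) + 1) *
      (f (θ + ((n : ℝ) + 1)⁻¹ • (b - θ)) z - f (θ + ((n : ℝ) + 1)⁻¹ • (a - θ)) z)) (fun n => ?_)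
      (tendsto_pi_nhds.2 fun z => (hq₀ z).tendsto_quotient hΘ hθ ha hb)
    have hm : ∀ b ∈ Θ, θ + ((n : ℝ) + 1)⁻¹ • (b - θ) ∈ Θ := fun b hb =>
      hΘ.add_smul_sub_mem hθ hb ⟨by positivity, inv_le_one_of_one_le₀ (by linarith [n.cast_nonneg (α := ℝ)])⟩
    exact ((H.measurable _ (hm b hb)).sub (H.measurable _ (hm a ha))).const_mul _
  refine ⟨fun z => V.starProjection (g₀ z θ), ?_, fun z => ?_, fun z θ' hθ' => ?_⟩
  · have : Measurable fun z => WithLp.ofLp (V.starProjection (g₀ z θ)) := by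
      refine measurable_pi_lambda _ fun i => ?_
      have := hmeas _ (V.starProjection_apply_mem (EuclideanSpace.single i (1 : ℝ)))
      simp only [← Submodule.inner_starProjection_left_eq_right] at this
      simpa [EuclideanSpace.inner_single_right] using this
    exact (MeasurableEquiv.toLp 2 (Fin d → ℝ)).measurable.comp this
  · set u := V.starProjection (g₀ z θ) with hu
    have huV : u ∈ V := V.starProjection_apply_mem _
    -- The vector `u` is a nonnegative multiple of a difference of points of `Θ`, so testing against
    -- `u` itself gives `‖u‖ ^ 2 ≤ Lf * ‖u‖`.
    have h1 : |⟪g₀ z θ, u⟫| ≤ Lf * ‖u‖ := by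
      obtain ⟨r, hr, a, ha, b, hb, e⟩ := exists_eq_smul_sub_of_mem_span hΘ hθ huV
      rw [e, real_inner_smul_right, abs_mul, norm_smul, Real.norm_eq_abs, ← mul_left_comm]
      exact mul_le_mul_of_nonneg_left ((hq₀ z).abs_inner_le hΘ hθ
        (fun θ₁ h₁ θ₂ h₂ => H.lipschitz z (mem_univ z) θ₁ h₁ θ₂ h₂) ha hb) (abs_nonneg r)
    rw [← hin z u huV, ← hu, real_inner_self_eq_norm_sq, abs_of_nonneg (sq_nonneg _)] at h1
    rcases (norm_nonneg u).eq_or_lt with h0 | h0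
    · rw [← h0]; exact hLf
    · nlinarith
  · have := hq₀ z θ' hθ'
    rwa [← hin z (θ' - θ) (vsub_mem_vectorSpan ℝ hθ' hθ)] at this

end Quad

/-! ### Descent in one projected step -/

section Step

variable {d : ℕ} {Θ : Set (Param d)}

theorem inner_sub_proj_le (hcl : IsClosed Θ) (hΘ : Convex ℝ Θ) (x : Param d) {w : Param d}
    (hw : w ∈ Θ) : ⟪x - proj Θ x, w - proj Θ x⟫ ≤ 0 := by
  have hs := proj_spec ⟨w, hw⟩ hcl x
  refine (norm_eq_iInf_iff_real_inner_le_zero hΘ hs.1).1 ?_ w hw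
  have : Nonempty Θ := ⟨⟨w, hw⟩⟩
  exact le_antisymm (le_ciInf fun y => hs.2 y y.2)
    (ciInf_le ⟨0, by rintro _ ⟨y, rfl⟩; exact norm_nonneg _⟩ (⟨_, hs.1⟩ : Θ))

/-- The squared norm of the gradient mapping of step size `τ`. -/
noncomputable def mapSq (Θ : Set (Param d)) (F : Param d → ℝ) (τ : ℝ) (x : Param d) : ℝ :=
  ‖τ⁻¹ • (x - proj Θ (x - τ • gradientWithin F Θ x))‖ ^ 2

theorem mapSq_nonneg (Θ : Set (Param d)) (F : Param d → ℝ) (τ : ℝ) (x : Param d) :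
    0 ≤ mapSq Θ F τ x := sq_nonneg _

/-- One step of projected descent along `u`, whose pairing with directions of `Θ` is that of `v`. -/
theorem descent_step (hcl : IsClosed Θ) (hΘ : Convex ℝ Θ) {F : Param d → ℝ} {x G u v : Param d}
    {S τ : ℝ} (hx : x ∈ Θ) (hτ : 0 < τ) (hS : S * (4 * τ) ≤ 1) (hF : QuadApprox Θ F x G S)
    (hu : ∀ a ∈ Θ, ∀ b ∈ Θ, ⟪u, b - a⟫ = ⟪v, b - a⟫) :
    8 / τ * F (proj Θ (x - τ • u)) + mapSq Θ F τ x ≤ 8 / τ * F x + 6 * ‖v - G‖ ^ 2 := by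
  set g := gradientWithin F Θ x with hg
  have hgG : ∀ a ∈ Θ, ∀ b ∈ Θ, ⟪g, b - a⟫ = ⟪G, b - a⟫ := fun a ha b hb =>
    hF.inner_gradientWithin hΘ hx ha hb
  set p := proj Θ (x - τ • u) with hp
  set q := proj Θ (x - τ • g) with hq
  have hpΘ : p ∈ Θ := (proj_spec ⟨x, hx⟩ hcl _).1
  have hqΘ : q ∈ Θ := (proj_spec ⟨x, hx⟩ hcl _).1
  have vip : ∀ w ∈ Θ, ⟪x - p, w - p⟫ ≤ τ * ⟪v, w - p⟫ := fun w hw => by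
    have := inner_sub_proj_le hcl hΘ (x - τ • u) hw
    rw [← hp, sub_right_comm, inner_sub_left, real_inner_smul_left, hu p hpΘ w hw] at this
    linarith
  have viq : ∀ w ∈ Θ, ⟪x - q, w - q⟫ ≤ τ * ⟪G, w - q⟫ := fun w hw => by
    have := inner_sub_proj_le hcl hΘ (x - τ • g) hw
    rw [← hq, sub_right_comm, inner_sub_left, real_inner_smul_left, hgG q hqΘ w hw] at this
    linarith
  have h1 := vip x hx
  rw [real_inner_self_eq_norm_sq] at h1
  -- Each of the two variational inequalities is tested at the projection point of the other, and
  -- they are added.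
  have hpq : ‖p - q‖ ≤ τ * ‖v - G‖ := by
    have a1 := vip q hqΘ
    have a2 := viq p hpΘ
    have e1 : ⟪x - p, q - p⟫ + ⟪x - q, p - q⟫ = ‖p - q‖ ^ 2 := by
      rw [← real_inner_self_eq_norm_sq]
      simp only [inner_sub_left, inner_sub_right]
      rw [real_inner_comm p q]; ring
    have e2 : τ * ⟪v, q - p⟫ + τ * ⟪G, p - q⟫ = τ * ⟪v - G, q - p⟫ := by
      simp only [inner_sub_left, inner_sub_right]; ring
    have a3 : ⟪v - G, q - p⟫ ≤ ‖v - G‖ * ‖p - q‖ := by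
      rw [norm_sub_rev p q]; exact real_inner_le_norm _ _
    have a4 : ‖p - q‖ ^ 2 ≤ τ * (‖v - G‖ * ‖p - q‖) := by
      have := mul_le_mul_of_nonneg_left a3 hτ.le
      linarith
    rcases (norm_nonneg (p - q)).eq_or_lt with h0 | h0
    · rw [← h0]; positivity
    · nlinarith
  have hFp := (abs_le.1 (hF p hpΘ)).2
  have h2 : ⟪G, p - x⟫ ≤ -⟪v, x - p⟫ + ‖v - G‖ * ‖x - p‖ := by
    have : ⟪v - G, x - p⟫ ≤ ‖v - G‖ * ‖x - p‖ := real_inner_le_norm _ _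
    simp only [inner_sub_left, inner_sub_right] at this ⊢
    linarith
  have h3 : ‖x - q‖ ≤ ‖x - p‖ + ‖p - q‖ := norm_sub_le_norm_sub_add_norm_sub _ _ _
  have hm : mapSq Θ F τ x = ‖x - q‖ ^ 2 / τ ^ 2 := by
    rw [mapSq, ← hg, ← hq, norm_smul, mul_pow, Real.norm_eq_abs, sq_abs]; field_simp
  rw [hm]
  rw [norm_sub_rev p x] at hFp
  set D := ‖x - p‖
  set e := ‖v - G‖
  set m := ‖p - q‖
  set Q := ‖x - q‖
  have hD : 0 ≤ D := norm_nonneg _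
  have he : 0 ≤ e := norm_nonneg _
  have hm0 : 0 ≤ m := norm_nonneg _
  have hQ0 : 0 ≤ Q := norm_nonneg _
  have hQ : Q ^ 2 ≤ 2 * D ^ 2 + 2 * (τ * e) ^ 2 := by nlinarith [sq_nonneg (D - m)]
  have hm2 : 8 / τ * F p + Q ^ 2 / τ ^ 2 = (8 * τ * F p + Q ^ 2) / τ ^ 2 := by field_simp
  have hr2 : 8 / τ * F x + 6 * e ^ 2 = (8 * τ * F x + 6 * e ^ 2 * τ ^ 2) / τ ^ 2 := by field_simp
  rw [hm2, hr2]
  refine div_le_div_of_nonneg_right ?_ (by positivity)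
  -- Balance after multiplication by 8: the gain is `8 D²`; curvature takes `2 D²`, the error term
  -- `4 D² + 4 (τ e)²`, and `Q²` takes `2 D² + 2 (τ e)²`. What remains is `6 (τ e)²`.
  have k1 : τ * F p ≤ τ * F x + τ * (S * D ^ 2) - D ^ 2 + τ * (e * D) := by nlinarith
  have k2 : 4 * (τ * (S * D ^ 2)) ≤ D ^ 2 := by nlinarith [sq_nonneg D]
  have k3 : 2 * (τ * (e * D)) ≤ D ^ 2 + (τ * e) ^ 2 := by nlinarith [sq_nonneg (D - τ * e)]
  nlinarith

/-- A step along the exact gradient lowers the potential by `mapSq`, and the potential stays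
nonnegative. This serves the last iterate, which is followed by no step. -/
theorem mapSq_le (hcl : IsClosed Θ) (hΘ : Convex ℝ Θ) {F : Param d → ℝ} {x G : Param d}
    {S τ : ℝ} (hx : x ∈ Θ) (hτ : 0 < τ) (hS : S * (4 * τ) ≤ 1) (hF : QuadApprox Θ F x G S)
    (hF0 : ∀ θ ∈ Θ, 0 ≤ F θ) : mapSq Θ F τ x ≤ 8 / τ * F x := by
  have := descent_step hcl hΘ hx hτ hS hF (u := G) (v := G) fun _ _ _ _ => rfl
  have h0 := hF0 _ (proj_spec ⟨x, hx⟩ hcl (x - τ • G)).1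
  have : 0 ≤ 8 / τ * F (proj Θ (x - τ • G)) := by positivity
  simp at *
  linarith

theorem proj_univ (x : Param d) : proj Set.univ x = x := by
  have := (proj_spec (Θ := (Set.univ : Set (Param d))) ⟨x, trivial⟩ isClosed_univ x).2 x trivial
  rw [sub_self, norm_zero] at this
  exact (sub_eq_zero.1 (norm_le_zero_iff.1 this)).symm

theorem eq_of_inner_sub_eq {u v : Param d}
    (h : ∀ a ∈ (univ : Set (Param d)), ∀ b ∈ (univ : Set (Param d)), ⟪u, b - a⟫ = ⟪v, b - a⟫) :
    u = v := by
  refine ext_inner_right ℝ fun w => ?_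
  simpa using h 0 trivial w trivial

theorem mapSq_univ {F : Param d → ℝ} {x G : Param d} {S τ : ℝ} (hτ : 0 < τ)
    (hF : QuadApprox univ F x G S) : mapSq univ F τ x = ‖G‖ ^ 2 := by
  have : gradientWithin F univ x = G :=
    eq_of_inner_sub_eq fun a ha b hb => hF.inner_gradientWithin convex_univ trivial ha hb
  rw [mapSq, proj_univ, this, sub_sub_cancel, smul_smul, inv_mul_cancel₀ hτ.ne', one_smul]

/-- Since no projection intervenes, `v` stays linear in the first-order term. In expectation that
term sees only the mean of `v`, and the second moment carries the factor `τ ^ 2`. -/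
theorem descent_step_univ {F : Param d → ℝ} {x G u v : Param d}
    {S τ : ℝ} (hF : QuadApprox univ F x G S)
    (hu : ∀ a ∈ (univ : Set (Param d)), ∀ b ∈ (univ : Set (Param d)), ⟪u, b - a⟫ = ⟪v, b - a⟫) :
    F (proj univ (x - τ • u)) ≤ F x - τ * ⟪G, v⟫ + S * τ ^ 2 * ‖v‖ ^ 2 := by
  rw [proj_univ, eq_of_inner_sub_eq hu]
  have := (abs_le.1 (hF (x - τ • v) trivial)).2
  rw [sub_sub_cancel_left, inner_neg_right, real_inner_smul_right, norm_neg, norm_smul, mul_pow,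
    Real.norm_eq_abs, sq_abs] at this
  linarith

end Step

/-! ### Scalar inequalities for exp, log and the entropy function -/

section Scalar

theorem exp_sub_one_le_mul_exp (x : ℝ) : Real.exp x - 1 ≤ x * Real.exp x := by
  have h := Real.add_one_le_exp (-x)
  have h2 := mul_le_mul_of_nonneg_right h (Real.exp_pos x).le
  rw [← Real.exp_add, neg_add_cancel, Real.exp_zero] at h2
  linarith

theorem abs_exp_sub_one_le {x b : ℝ} (hb : |x| ≤ b) : |Real.exp x - 1| ≤ |x| * Real.exp b := by
  have hb0 : 0 ≤ b := (abs_nonneg x).trans hb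
  have h1 : 1 ≤ Real.exp b := Real.one_le_exp hb0
  rcases le_total 0 x with hx | hx
  · have h2 : Real.exp x ≤ Real.exp b := Real.exp_le_exp.2 ((le_abs_self x).trans hb)
    rw [abs_of_nonneg hx, abs_of_nonneg (by linarith [Real.one_le_exp hx])]
    exact (exp_sub_one_le_mul_exp x).trans (mul_le_mul_of_nonneg_left h2 hx)
  · rw [abs_of_nonpos hx, abs_of_nonpos (by linarith [Real.exp_le_one_iff.2 hx])]
    have := Real.add_one_le_exp x
    nlinarith

theorem abs_exp_sub_one_sub_le {x b : ℝ} (hb : |x| ≤ b) :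
    |Real.exp x - 1 - x| ≤ x ^ 2 * Real.exp b := by
  rw [abs_of_nonneg (by linarith [Real.add_one_le_exp x])]
  have h1 := exp_sub_one_le_mul_exp x
  have h2 := abs_exp_sub_one_le hb
  have h3 : x * (Real.exp x - 1) ≤ |x| * (|x| * Real.exp b) :=
    (le_abs_self _).trans (by rw [abs_mul]; exact mul_le_mul_of_nonneg_left h2 (abs_nonneg x))
  rw [← mul_assoc, abs_mul_abs_self] at h3
  nlinarith

/-- The bound `1 - 1/t ≤ log t` leaves exactly `(t - 1)²/t` as the error. -/
theorem abs_log_sub_le {t M : ℝ} (hM : 0 < M) (ht : M⁻¹ ≤ t) :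
    |Real.log t - (t - 1)| ≤ M * (t - 1) ^ 2 := by
  have ht0 : 0 < t := (inv_pos.2 hM).trans_le ht
  have h1 := Real.log_le_sub_one_of_pos ht0
  have h2 := Real.one_sub_inv_le_log_of_pos ht0
  rw [abs_of_nonpos (by linarith)]
  have h3 : t⁻¹ ≤ M := inv_le_of_inv_le₀ hM ht
  have h4 : t - 1 - (1 - t⁻¹) = t⁻¹ * (t - 1) ^ 2 := by field_simp
  have h5 := mul_le_mul_of_nonneg_right h3 (sq_nonneg (t - 1))
  linarith

/-- Young's inequality for the entropy function. -/
theorem mul_le_entropyFun_add {p : ℝ} (hp : 0 ≤ p) (a : ℝ) :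
    p * a ≤ entropyFun p + Real.exp a - 1 := by
  unfold entropyFun
  rcases hp.eq_or_lt with rfl | hp
  · simpa using (Real.exp_pos a).le
  · have h := Real.add_one_le_exp (a - Real.log p)
    rw [Real.exp_sub, Real.exp_log hp, le_div_iff₀ hp] at h
    linarith

end Scalar

/-! ### Stability of quadratic approximation under exp, log and averaging -/

section QuadComp

variable {d : ℕ} {Θ : Set (Param d)} {θ : Param d}

/-- After the factor `exp (h θ / η)` is taken out, the remainder is that of `exp` at the increment
`x`, quadratic by the Lipschitz bound, plus the remainder of `h` divided by `η`. -/
theorem QuadApprox.exp {h : Param d → ℝ} {g : Param d} {Lf Sf B η : ℝ} (hη : 0 < η)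
    (hθ : θ ∈ Θ) (hB : ∀ ϑ ∈ Θ, 0 ≤ h ϑ ∧ h ϑ ≤ B)
    (hL : ∀ θ₁ ∈ Θ, ∀ θ₂ ∈ Θ, |h θ₁ - h θ₂| ≤ Lf * ‖θ₁ - θ₂‖) (H : QuadApprox Θ h θ g Sf) :
    QuadApprox Θ (fun ϑ => Real.exp (h ϑ / η)) θ ((Real.exp (h θ / η) / η) • g)
      (Real.exp (B / η) * (Lf ^ 2 / η ^ 2 * Real.exp (B / η) + Sf / η)) := by
  intro θ' hθ'
  set x := (h θ' - h θ) / η with hx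
  have hw : Real.exp (h θ / η) ≤ Real.exp (B / η) := by
    have := (hB θ hθ).2
    gcongr
  have hxB : |x| ≤ B / η := by
    rw [hx, abs_div, abs_of_pos hη]
    gcongr
    rw [abs_le]; constructor <;> linarith [(hB θ hθ).1, (hB θ hθ).2, (hB θ' hθ').1, (hB θ' hθ').2]
  have hxL : |x| ≤ Lf / η * ‖θ' - θ‖ := by
    rw [hx, abs_div, abs_of_pos hη, div_mul_eq_mul_div]
    exact div_le_div_of_nonneg_right (hL _ hθ' _ hθ) hη.le
  have hx2 : x ^ 2 ≤ Lf ^ 2 / η ^ 2 * ‖θ' - θ‖ ^ 2 := by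
    rw [← div_pow, ← mul_pow, ← sq_abs]
    exact pow_le_pow_left₀ (abs_nonneg x) hxL 2
  have e : Real.exp (h θ' / η) = Real.exp (h θ / η) * Real.exp x := by
    rw [← Real.exp_add, hx]; congr 1; ring
  have e2 : Real.exp (h θ' / η) - Real.exp (h θ / η) - ⟪(Real.exp (h θ / η) / η) • g, θ' - θ⟫
      = Real.exp (h θ / η) * ((Real.exp x - 1 - x) + (h θ' - h θ - ⟪g, θ' - θ⟫) / η) := by
    rw [e, real_inner_smul_left, hx]; field_simp; ring
  have h1 : |(Real.exp x - 1 - x) + (h θ' - h θ - ⟪g, θ' - θ⟫) / η|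
      ≤ (Lf ^ 2 / η ^ 2 * Real.exp (B / η) + Sf / η) * ‖θ' - θ‖ ^ 2 := by
    refine (abs_add_le _ _).trans ?_
    rw [add_mul]
    refine add_le_add ?_ ?_
    · refine (abs_exp_sub_one_sub_le hxB).trans ?_
      rw [mul_right_comm]
      exact mul_le_mul_of_nonneg_right hx2 (Real.exp_pos _).le
    · rw [abs_div, abs_of_pos hη, div_mul_eq_mul_div]
      exact div_le_div_of_nonneg_right (H θ' hθ') hη.le
  show |Real.exp (h θ' / η) - Real.exp (h θ / η) - _| ≤ _
  rw [e2, abs_mul, Real.abs_exp, mul_assoc (Real.exp (B / η))]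
  exact mul_le_mul hw h1 (abs_nonneg _) (Real.exp_pos _).le

theorem abs_exp_sub_exp_le {h h' B η Δ : ℝ} (hη : 0 < η) (hh : 0 ≤ h ∧ h ≤ B)
    (hh' : 0 ≤ h' ∧ h' ≤ B) (hΔ : |h' - h| ≤ Δ) :
    |Real.exp (h' / η) - Real.exp (h / η)| ≤ Real.exp (B / η) ^ 2 / η * Δ := by
  set x := (h' - h) / η with hx
  have hxB : |x| ≤ B / η := by
    rw [hx, abs_div, abs_of_pos hη]
    gcongr
    rw [abs_le]; constructor <;> linarith
  have e : Real.exp (h' / η) - Real.exp (h / η) = Real.exp (h / η) * (Real.exp x - 1) := by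
    rw [mul_sub, ← Real.exp_add, hx]; congr 2 <;> ring
  have hw : Real.exp (h / η) ≤ Real.exp (B / η) := by
    have := hh.2
    gcongr
  rw [e, abs_mul, Real.abs_exp]
  refine (mul_le_mul hw (abs_exp_sub_one_le hxB) (abs_nonneg _) (Real.exp_pos _).le).trans ?_
  have : |x| ≤ Δ / η := by
    rw [hx, abs_div, abs_of_pos hη]; exact div_le_div_of_nonneg_right hΔ hη.le
  calc Real.exp (B / η) * (|x| * Real.exp (B / η)) ≤
      Real.exp (B / η) * (Δ / η * Real.exp (B / η)) := by gcongr
    _ = _ := by ring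

/-- With `t` the ratio of the values of `a`, the remainder is that of `a`, which division by `a θ ≥
1` does not enlarge, plus that of `log` at `t ≥ 1/M`. -/
theorem QuadApprox.log {a : Param d → ℝ} {A : Param d} {c₁ c₂ M η : ℝ} (hη : 0 < η)
    (hθ : θ ∈ Θ) (hM : ∀ ϑ ∈ Θ, 1 ≤ a ϑ ∧ a ϑ ≤ M)
    (hL : ∀ ϑ ∈ Θ, |a ϑ - a θ| ≤ c₂ * ‖ϑ - θ‖) (H : QuadApprox Θ a θ A c₁) :
    QuadApprox Θ (fun ϑ => η * Real.log (a ϑ)) θ ((η * (a θ)⁻¹) • A) (η * c₁ + η * (M * c₂ ^ 2)) := by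
  intro θ' hθ'
  have ha := hM θ hθ
  have ha' := hM θ' hθ'
  have ha0 : 0 < a θ := by linarith
  have ha0' : 0 < a θ' := by linarith
  have hMp : 0 < M := by linarith
  have hinv : (a θ)⁻¹ ≤ 1 := inv_le_one_of_one_le₀ ha.1
  set t := a θ' / a θ with ht
  have htM : M⁻¹ ≤ t := by
    rw [ht, le_div_iff₀ ha0, inv_mul_le_iff₀ hMp]; nlinarith
  have ht1 : t - 1 = (a θ)⁻¹ * (a θ' - a θ) := by rw [ht]; field_simp
  have ht2 : (t - 1) ^ 2 ≤ c₂ ^ 2 * ‖θ' - θ‖ ^ 2 := by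
    rw [← mul_pow, ← sq_abs]
    refine pow_le_pow_left₀ (abs_nonneg _) ?_ 2
    rw [ht1, abs_mul, abs_of_pos (inv_pos.2 ha0)]
    exact (mul_le_of_le_one_left (abs_nonneg _) hinv).trans (hL _ hθ')
  have e : η * Real.log (a θ') - η * Real.log (a θ) - ⟪(η * (a θ)⁻¹) • A, θ' - θ⟫
      = η * ((a θ)⁻¹ * (a θ' - a θ - ⟪A, θ' - θ⟫)) + η * (Real.log t - (t - 1)) := by
    rw [real_inner_smul_left, ht1, ht, Real.log_div ha0'.ne' ha0.ne']; ring
  show |η * Real.log (a θ') - η * Real.log (a θ) - _| ≤ _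
  rw [e]
  refine (abs_add_le _ _).trans ?_
  rw [abs_mul, abs_mul, abs_mul, abs_of_pos hη, abs_of_pos (inv_pos.2 ha0), add_mul, mul_assoc,
    mul_assoc]
  refine add_le_add (mul_le_mul_of_nonneg_left ?_ hη.le) (mul_le_mul_of_nonneg_left ?_ hη.le)
  · exact (mul_le_of_le_one_left (abs_nonneg _) hinv).trans (H _ hθ')
  · refine (abs_log_sub_le hMp htM).trans ?_
    rw [mul_assoc]
    exact mul_le_mul_of_nonneg_left ht2 hMp.le

theorem QuadApprox.integral {α : Type*} [MeasurableSpace α] {Q : Measure α}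
    [IsProbabilityMeasure Q] {h : Param d → α → ℝ} {g : α → Param d} {c : ℝ} (hθ : θ ∈ Θ)
    (hi : ∀ ϑ ∈ Θ, Integrable (h ϑ) Q) (hg : Integrable g Q)
    (H : ∀ z, QuadApprox Θ (fun ϑ => h ϑ z) θ (g z) c) :
    QuadApprox Θ (fun ϑ => ∫ z, h ϑ z ∂Q) θ (∫ z, g z ∂Q) c := by
  intro θ' hθ'
  have e : ∫ z, h θ' z ∂Q - ∫ z, h θ z ∂Q - ⟪∫ z, g z ∂Q, θ' - θ⟫
      = ∫ z, (h θ' z - h θ z - ⟪g z, θ' - θ⟫) ∂Q := by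
    have hd : Integrable (fun z => h θ' z - h θ z) Q := (hi _ hθ').sub (hi _ hθ)
    rw [integral_sub hd (hg.inner_const _), integral_sub (hi _ hθ') (hi _ hθ)]
    congr 1
    rw [real_inner_comm, ← integral_inner hg]
    exact integral_congr_ae (Eventually.of_forall fun z => real_inner_comm _ _)
  show |∫ z, h θ' z ∂Q - ∫ z, h θ z ∂Q - _| ≤ _
  rw [e, ← Real.norm_eq_abs]
  refine (norm_integral_le_of_norm_le_const (C := c * ‖θ' - θ‖ ^ 2)
    (Eventually.of_forall fun z => H z θ' hθ')).trans (by simp)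

end QuadComp

/-! ### The soft maximum with respect to a probability measure -/

section Soft

variable {d : ℕ} {E : Type*} [MeasurableSpace E]

/-- A measurable and bounded selection `g` of gradients at `θ`. -/
structure GradSelection (Θ : Set (Param d)) (f : Param d → E → ℝ) (Lf Sf : ℝ) (θ : Param d)
    (g : E → Param d) : Prop where
  measurable : Measurable g
  norm_le : ∀ z, ‖g z‖ ≤ Lf
  quad : ∀ z, QuadApprox Θ (fun ϑ => f ϑ z) θ (g z) Sf

/-- The soft maximum `η log E_Q exp(f_θ / η)`. -/
noncomputable def softLoss (η : ℝ) (f : Param d → E → ℝ) (Q : Measure E) (θ : Param d) : ℝ :=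
  η * Real.log (∫ w, Real.exp (f θ w / η) ∂Q)

/-- The gradient of `softLoss`, for the loss `h` with the gradient `g`. -/
noncomputable def softGrad (η : ℝ) (h : E → ℝ) (g : E → Param d) (Q : Measure E) : Param d :=
  (∫ w, Real.exp (h w / η) ∂Q)⁻¹ • ∫ w, Real.exp (h w / η) • g w ∂Q

/-- A smoothness constant of `softLoss`. -/
noncomputable def smoothConst (Lf Sf B η : ℝ) : ℝ :=
  η * (Real.exp (B / η) * (Lf ^ 2 / η ^ 2 * Real.exp (B / η) + Sf / η))
    + η * (Real.exp (B / η) * (Real.exp (B / η) ^ 2 / η * Lf) ^ 2)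

theorem exp_div_mem {h B η : ℝ} (hη : 0 < η) (hh : 0 ≤ h ∧ h ≤ B) :
    1 ≤ Real.exp (h / η) ∧ Real.exp (h / η) ≤ Real.exp (B / η) :=
  ⟨Real.one_le_exp (div_nonneg hh.1 hη.le),
    Real.exp_le_exp.2 (div_le_div_of_nonneg_right hh.2 hη.le)⟩

theorem integrable_exp_div {Q : Measure E} [IsFiniteMeasure Q] {h : E → ℝ} {B η : ℝ} (hη : 0 < η)
    (hm : Measurable h) (hh : ∀ w, 0 ≤ h w ∧ h w ≤ B) :
    Integrable (fun w => Real.exp (h w / η)) Q :=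
  Integrable.of_bound (by fun_prop) (Real.exp (B / η)) (Eventually.of_forall fun w => by
    rw [Real.norm_eq_abs, Real.abs_exp]; exact (exp_div_mem hη (hh w)).2)

theorem integrable_exp_smul {Q : Measure E} [IsFiniteMeasure Q] {h : E → ℝ} {g : E → Param d}
    {B Lf η : ℝ} (hη : 0 < η) (hm : Measurable h) (hh : ∀ w, 0 ≤ h w ∧ h w ≤ B) (hg : Measurable g)
    (hgL : ∀ w, ‖g w‖ ≤ Lf) : Integrable (fun w => Real.exp (h w / η) • g w) Q :=
  Integrable.of_bound (by fun_prop) (Real.exp (B / η) * Lf) (Eventually.of_forall fun w => by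
    rw [norm_smul, Real.norm_eq_abs, Real.abs_exp]
    exact mul_le_mul (exp_div_mem hη (hh w)).2 (hgL w) (norm_nonneg _) (Real.exp_pos _).le)

theorem integral_exp_div_mem {Q : Measure E} [IsProbabilityMeasure Q] {h : E → ℝ} {B η : ℝ}
    (hη : 0 < η) (hm : Measurable h) (hh : ∀ w, 0 ≤ h w ∧ h w ≤ B) :
    1 ≤ ∫ w, Real.exp (h w / η) ∂Q ∧ ∫ w, Real.exp (h w / η) ∂Q ≤ Real.exp (B / η) := by
  have hi := integrable_exp_div (Q := Q) hη hm hh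
  constructor
  · have := integral_mono (integrable_const (1 : ℝ)) hi fun w => (exp_div_mem hη (hh w)).1
    simpa using this
  · have := integral_mono hi (integrable_const _) fun w => (exp_div_mem hη (hh w)).2
    simpa using this

theorem softLoss_mem {Q : Measure E} [IsProbabilityMeasure Q] {f : Param d → E → ℝ} {θ : Param d}
    {B η : ℝ} (hη : 0 < η) (hm : Measurable (f θ)) (hh : ∀ w, 0 ≤ f θ w ∧ f θ w ≤ B) :
    0 ≤ softLoss η f Q θ ∧ softLoss η f Q θ ≤ B := by
  have h := integral_exp_div_mem (Q := Q) hη hm hh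
  refine ⟨mul_nonneg hη.le (Real.log_nonneg h.1), ?_⟩
  have := Real.log_le_log (by linarith) h.2
  rw [Real.log_exp, le_div_iff₀ hη, mul_comm] at this
  exact this

/-- `softGrad` is a weighted average of `g` with positive weights of total mass one. -/
theorem norm_softGrad_le {Q : Measure E} [IsProbabilityMeasure Q] {h : E → ℝ} {g : E → Param d}
    {B Lf η : ℝ} (hη : 0 < η) (hm : Measurable h) (hh : ∀ w, 0 ≤ h w ∧ h w ≤ B)
    (hgL : ∀ w, ‖g w‖ ≤ Lf) : ‖softGrad η h g Q‖ ≤ Lf := by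
  have h1 := integral_exp_div_mem (Q := Q) hη hm hh
  have h0 : 0 < ∫ w, Real.exp (h w / η) ∂Q := by linarith
  rw [softGrad, norm_smul, norm_inv, Real.norm_eq_abs, abs_of_pos h0, inv_mul_le_iff₀ h0,
    ← integral_mul_const]
  refine norm_integral_le_of_norm_le ((integrable_exp_div hη hm hh).mul_const _)
    (Eventually.of_forall fun w => ?_)
  rw [norm_smul, Real.norm_eq_abs, Real.abs_exp]
  exact mul_le_mul_of_nonneg_left (hgL w) (Real.exp_pos _).le

/-- The rules for `exp`, averages and `log` in succession. The constant does not depend on `Q`, so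
the lemma covers both the uniform measures on balls and the empirical measures of the estimator. -/
theorem softLoss_quadApprox {Q : Measure E} [IsProbabilityMeasure Q] {Θ : Set (Param d)}
    {f : Param d → E → ℝ} {Lf Sf B η : ℝ} (hη : 0 < η) (H : SmoothBoundedLoss Θ univ f Lf Sf B)
    {θ : Param d} (hθ : θ ∈ Θ) {g : E → Param d} (hg : GradSelection Θ f Lf Sf θ g) :
    QuadApprox Θ (softLoss η f Q) θ (softGrad η (f θ) g Q) (smoothConst Lf Sf B η) := by
  have hb : ∀ ϑ ∈ Θ, ∀ w, 0 ≤ f ϑ w ∧ f ϑ w ≤ B := fun ϑ h w => H.bounded w trivial ϑ h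
  have hi : ∀ ϑ ∈ Θ, Integrable (fun w => Real.exp (f ϑ w / η)) Q := fun ϑ h =>
    integrable_exp_div hη (H.measurable ϑ h) (hb ϑ h)
  have hgi : Integrable (fun w => (Real.exp (f θ w / η) / η) • g w) Q := by
    have := (integrable_exp_smul (Q := Q) hη (H.measurable θ hθ) (hb θ hθ) hg.measurable
      hg.norm_le).smul η⁻¹
    refine this.congr (Eventually.of_forall fun w => ?_)
    show η⁻¹ • Real.exp (f θ w / η) • g w = _
    simp only [smul_smul, div_eq_inv_mul]
  have q1 := QuadApprox.integral hθ hi hgi fun z => (hg.quad z).exp hη hθ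
    (fun ϑ h => hb ϑ h z) (H.lipschitz z trivial)
  have q2 := q1.log hη hθ (M := Real.exp (B / η)) (c₂ := Real.exp (B / η) ^ 2 / η * Lf)
    (fun ϑ h => integral_exp_div_mem hη (H.measurable ϑ h) (hb ϑ h)) fun ϑ h => by
      rw [← integral_sub (hi ϑ h) (hi θ hθ), ← Real.norm_eq_abs]
      refine (norm_integral_le_of_norm_le_const
        (C := Real.exp (B / η) ^ 2 / η * (Lf * ‖ϑ - θ‖)) (Eventually.of_forall fun z => ?_)).trans
        (by simp [mul_assoc])
      exact abs_exp_sub_exp_le hη (hb θ hθ z) (hb ϑ h z) (H.lipschitz z trivial ϑ h θ hθ)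
  have e : (η * (∫ w, Real.exp (f θ w / η) ∂Q)⁻¹) • ∫ w, (Real.exp (f θ w / η) / η) • g w ∂Q
      = softGrad η (f θ) g Q := by
    have : ∀ w, (Real.exp (f θ w / η) / η) • g w = η⁻¹ • Real.exp (f θ w / η) • g w := fun w => by
      rw [smul_smul, div_eq_inv_mul]
    simp only [this]
    rw [integral_smul, smul_smul, softGrad]
    congr 1
    field_simp
  rw [e] at q2
  exact q2

end Soft

/-! ### The robust loss as a soft maximum -/

section Robust

variable {E : Type*} [NormedAddCommGroup E] [NormedSpace ℝ E] [FiniteDimensional ℝ E]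
  [MeasurableSpace E] [BorelSpace E]

/-- The Gibbs variational formula for the robust loss. -/
theorem robustLoss_eq {ρ η B : ℝ} (hρ : 0 < ρ) (hη : 0 < η) {h : E → ℝ} (hm : Measurable h)
    (hh : ∀ w, 0 ≤ h w ∧ h w ≤ B) (z : E) :
    robustLoss ρ η h z = η * Real.log (∫ w, Real.exp (h w / η) ∂(ballMeasure ρ z)) := by
  have := isProbabilityMeasure_ballMeasure hρ z
  set ν := ballMeasure ρ z with hν
  have hi := integrable_exp_div (Q := ν) hη hm hh
  have hZ := integral_exp_div_mem (Q := ν) hη hm hh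
  set Z := ∫ w, Real.exp (h w / η) ∂ν with hZd
  have hZ0 : 0 < Z := by linarith
  have hexp : ∀ w, Real.exp ((h w - η * Real.log Z) / η) = Real.exp (h w / η) / Z := fun w => by
    rw [sub_div, mul_div_cancel_left₀ _ hη.ne', Real.exp_sub, Real.exp_log hZ0]
  have hbd : ∀ w, ‖h w‖ ≤ B := fun w => by
    rw [Real.norm_eq_abs, abs_of_nonneg (hh w).1]; exact (hh w).2
  refine IsGreatest.csSup_eq ⟨?_, ?_⟩
  -- The supremum is attained at the Gibbs measure, whose density `exp (h / η) / Z` turns the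
  -- logarithm in the entropy into `(h - η log Z) / η`.
  · refine ⟨ν.tilted fun w => h w / η, isProbabilityMeasure_tilted hi,
      tilted_absolutelyContinuous _ _, ?_⟩
    have hr : (fun w => entropyFun (((ν.tilted fun w => h w / η).rnDeriv ν) w).toReal) =ᵐ[ν]
        fun w => (Real.exp (h w / η) / Z) * ((h w - η * Real.log Z) / η)
          - Real.exp (h w / η) / Z + 1 := by
      filter_upwards [rnDeriv_tilted_left_self (μ := ν) (f := fun w => h w / η)
        (by fun_prop)] with w hw
      rw [hw, ENNReal.toReal_ofReal (by positivity), entropyFun, ← hexp, Real.log_exp]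
    have hi1 : Integrable (fun w => (Real.exp (h w / η) / Z) * ((h w - η * Real.log Z) / η)) ν := by
      refine Integrable.mul_bdd (c := (B + |η * Real.log Z|) / η) (hi.div_const Z) (by fun_prop)
        (Eventually.of_forall fun w => ?_)
      rw [norm_div, Real.norm_eq_abs η, abs_of_pos hη]
      gcongr
      refine (norm_sub_le _ _).trans (add_le_add (hbd w) le_rfl)
    have hi2 : Integrable (fun w => Real.exp (h w / η) / Z) ν := hi.div_const Z
    refine ⟨(((hi1.sub hi2).add (integrable_const 1)).congr hr.symm), ?_⟩
    have hi4 : Integrable (fun w => (Real.exp (h w / η) / Z) * ((h w - η * Real.log Z) / η)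
        - Real.exp (h w / η) / Z) ν := hi1.sub hi2
    rw [integral_congr_ae hr, integral_add hi4 (integrable_const 1),
      integral_sub hi1 hi2, integral_tilted, integral_div, ← hZd, div_self hZ0.ne']
    have hi3 : Integrable (fun w => (Real.exp (h w / η) / Z) * h w) ν :=
      Integrable.mul_bdd (c := B) hi2 (by fun_prop) (Eventually.of_forall hbd)
    have e : ∀ w, (Real.exp (h w / η) / Z) * ((h w - η * Real.log Z) / η)
        = η⁻¹ * ((Real.exp (h w / η) / Z) * h w) - Real.log Z * (Real.exp (h w / η) / Z) :=
      fun w => by field_simp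
    simp only [e]
    rw [integral_sub (hi3.const_mul _) (hi2.const_mul _), integral_const_mul, integral_const_mul,
      integral_div, ← hZd, div_self hZ0.ne']
    simp only [smul_eq_mul, integral_const, probReal_univ]
    field_simp
    ring
  · rintro v ⟨γ, hγ, hac, hint, rfl⟩
    set p := fun w => (γ.rnDeriv ν w).toReal with hp
    have hpi : Integrable p ν := Measure.integrable_toReal_rnDeriv
    have hp1 : ∫ w, p w ∂ν = 1 := by
      rw [hp, Measure.integral_toReal_rnDeriv hac]; simp
    have e1 : ∫ w, h w ∂γ = ∫ w, p w * h w ∂ν := by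
      rw [← integral_rnDeriv_smul hac]; rfl
    have hph : Integrable (fun w => p w * h w) ν :=
      Integrable.mul_bdd (c := B) hpi (by fun_prop) (Eventually.of_forall hbd)
    have e2 : ∀ w, p w * ((h w - η * Real.log Z) / η)
        = η⁻¹ * (p w * h w) - Real.log Z * p w := fun w => by field_simp
    have hl : Integrable (fun w => p w * ((h w - η * Real.log Z) / η)) ν := by
      simp only [e2]; exact (hph.const_mul _).sub (hpi.const_mul _)
    have hint' : Integrable (fun w => entropyFun (p w)) ν := hint
    have hs : Integrable (fun w => entropyFun (p w) + Real.exp (h w / η) / Z) ν :=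
      hint.add (hi.div_const Z)
    have hr : Integrable (fun w => entropyFun (p w) + Real.exp (h w / η) / Z - 1) ν :=
      hs.sub (integrable_const 1)
    -- Young's inequality at `(h - η log Z) / η`. The shift by `η log Z` makes the exponential
    -- integrate to one, which cancels the constant `-1`.
    have key := integral_mono hl hr fun w => by
      have := mul_le_entropyFun_add (p := p w) ENNReal.toReal_nonneg ((h w - η * Real.log Z) / η)
      rwa [hexp] at this
    simp only [e2] at key
    rw [integral_sub (hph.const_mul _) (hpi.const_mul _), integral_const_mul, integral_const_mul,
      hp1, integral_sub hs (integrable_const 1), integral_add hint' (hi.div_const Z), integral_div, ← hZd, div_self hZ0.ne'] at key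
    simp only [integral_const, probReal_univ, smul_eq_mul, mul_one, add_sub_cancel_right] at key
    rw [e1]
    have k2 := mul_le_mul_of_nonneg_left key hη.le
    rw [mul_sub, mul_inv_cancel_left₀ hη.ne'] at k2
    linarith

theorem ae_ballMeasure_mem (ρ : ℝ) (z : E) : ∀ᵐ w ∂(ballMeasure ρ z), w ∈ Metric.closedBall z ρ :=
  ae_cond_mem Metric.isClosed_closedBall.measurableSet

/-- Every admissible `γ` is absolutely continuous with respect to `ballMeasure ρ z`, so it charges
only the ball. -/
theorem robustLoss_congr {ρ η : ℝ} {h h' : E → ℝ} {z : E}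
    (hh : ∀ w ∈ Metric.closedBall z ρ, h w = h' w) : robustLoss ρ η h z = robustLoss ρ η h' z := by
  unfold robustLoss
  congr 1
  ext v
  refine exists_congr fun γ => and_congr_right fun _ => and_congr_right fun hac =>
    and_congr_right fun _ => ?_
  have : ∫ w, h w ∂γ = ∫ w, h' w ∂γ := by
    refine integral_congr_ae (hac.ae_le ?_)
    filter_upwards [ae_ballMeasure_mem ρ z] with w hw using hh w hw
  rw [this]

end Robust

/-! ### Moments of averages of independent samples -/

section Moments

variable {α : Type*} [MeasurableSpace α] {μ : Measure α} [IsProbabilityMeasure μ]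

theorem sq_integral_le {y : α → ℝ} {R : ℝ} (hy : Measurable y) (hR : ∀ x, |y x| ≤ R) :
    (∫ x, y x ∂μ) ^ 2 ≤ ∫ x, y x ^ 2 ∂μ := by
  have hm : MemLp y 2 μ := MemLp.of_bound hy.aestronglyMeasurable R (Eventually.of_forall hR)
  have := variance_nonneg y μ
  rw [variance_eq_sub hm] at this
  simpa using this

theorem sq_norm_integral_le {F : Type*} [NormedAddCommGroup F] [NormedSpace ℝ F]
    [MeasurableSpace F] [BorelSpace F]
    {Y : α → F} {R : ℝ} (hY : Measurable Y) (hR : ∀ x, ‖Y x‖ ≤ R) :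
    ‖∫ x, Y x ∂μ‖ ^ 2 ≤ ∫ x, ‖Y x‖ ^ 2 ∂μ :=
  (pow_le_pow_left₀ (norm_nonneg _) (norm_integral_le_integral_norm Y) 2).trans
    (sq_integral_le (R := R) hY.norm fun x => by rw [abs_norm]; exact hR x)

variable {ι : Type*} [Fintype ι] {d : ℕ}

theorem integral_pi_eval {F : Type*} [NormedAddCommGroup F] [NormedSpace ℝ F] {y : α → F}
    (hy : AEStronglyMeasurable y μ) (i : ι) :
    ∫ x, y (x i) ∂(Measure.pi fun _ : ι => μ) = ∫ x, y x ∂μ := by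
  have h := (measurePreserving_eval (fun _ : ι => μ) i)
  conv_rhs => rw [← h.map_eq]
  rw [integral_map h.measurable.aemeasurable (by rw [h.map_eq]; exact hy)]

theorem integral_sq_mean_sub_le {y : α → ℝ} {R : ℝ} (hy : Measurable y) (hR : ∀ x, |y x| ≤ R)
    {s : Finset ι} (hs : s.Nonempty) (c : ℝ) :
    ∫ x, ((s.card : ℝ)⁻¹ * ∑ j ∈ s, y (x j) - c) ^ 2 ∂(Measure.pi fun _ : ι => μ)
      ≤ (∫ x, y x ∂μ - c) ^ 2 + (s.card : ℝ)⁻¹ * ∫ x, y x ^ 2 ∂μ := by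
  classical
  have hcard : (0 : ℝ) < s.card := by exact_mod_cast hs.card_pos
  have hm : MemLp y 2 μ := MemLp.of_bound hy.aestronglyMeasurable R (Eventually.of_forall hR)
  set ν := Measure.pi fun _ : ι => μ with hν
  -- Padding by zero outside `s` writes the average as a sum over all coordinates, for which
  -- `variance_sum_pi` is available.
  set X : ι → α → ℝ := fun i x => if i ∈ s then (s.card : ℝ)⁻¹ * y x else 0 with hX
  have hXm : ∀ i, MemLp (X i) 2 μ := fun i => by
    by_cases hi : i ∈ s
    · simpa [hX, hi] using hm.const_mul _
    · simp [hX, hi]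
  set W : (ι → α) → ℝ := fun x => (s.card : ℝ)⁻¹ * ∑ j ∈ s, y (x j) with hW
  have hWX : W = ∑ i, fun x : ι → α => X i (x i) := by
    funext x
    simp [hW, hX, Finset.sum_apply, Finset.mul_sum, Finset.sum_ite_mem]
  have hyj : ∀ j, MemLp (fun x : ι → α => y (x j)) 2 ν := fun j =>
    hm.comp_measurePreserving (measurePreserving_eval (fun _ : ι => μ) j)
  have hWm : MemLp W 2 ν := (memLp_finsetSum s fun j _ => hyj j).const_mul _
  have hEW : ∫ x, W x ∂ν = ∫ x, y x ∂μ := by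
    simp only [hW]
    rw [integral_const_mul, integral_finsetSum s fun j _ => (hyj j).integrable (by norm_num)]
    simp only [hν, integral_pi_eval hy.aestronglyMeasurable, Finset.sum_const, nsmul_eq_mul]
    rw [inv_mul_cancel_left₀ hcard.ne']
  have hVW : Var[W; ν] ≤ (s.card : ℝ)⁻¹ * ∫ x, y x ^ 2 ∂μ := by
    rw [hWX, variance_sum_pi hXm]
    have : ∀ i, Var[X i; μ] = if i ∈ s then (s.card : ℝ)⁻¹ ^ 2 * Var[y; μ] else 0 := fun i => by
      by_cases hi : i ∈ s
      · simp only [hX, hi, if_true]; exact variance_const_mul _ _ _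
      · simp only [hX, hi, if_false]; exact variance_zero μ
    simp only [this, Finset.sum_ite_mem, Finset.univ_inter, Finset.sum_const, nsmul_eq_mul]
    have e : (s.card : ℝ) * ((s.card : ℝ)⁻¹ ^ 2 * Var[y; μ]) = (s.card : ℝ)⁻¹ * Var[y; μ] := by
      field_simp
    rw [e]
    refine mul_le_mul_of_nonneg_left ?_ (by positivity)
    exact variance_le_expectation_sq hy.aestronglyMeasurable
  have h1 := variance_eq_sub (hWm.sub (memLp_const c))
  have h2 : Var[W - fun _ : ι → α => c; ν] = Var[W; ν] := variance_sub_const hWm.aestronglyMeasurable c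
  have h3 : ∫ x, (W - fun _ : ι → α => c) x ∂ν = ∫ x, y x ∂μ - c := by
    simp only [Pi.sub_apply]
    rw [integral_sub (hWm.integrable (by norm_num)) (integrable_const c), hEW]; simp
  rw [h2, h3] at h1
  have h4 : ∫ x, (W x - c) ^ 2 ∂ν = ∫ x, ((W - fun _ : ι → α => c) ^ 2) x ∂ν := rfl
  rw [h4]
  linarith

/-- Bias-variance bound for the mean of i.i.d. random vectors. -/
theorem integral_norm_sq_mean_sub_le {Y : α → Param d} {R : ℝ} (hY : Measurable Y)
    (hR : ∀ x, ‖Y x‖ ≤ R) {s : Finset ι} (hs : s.Nonempty) (c : Param d) :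
    ∫ x, ‖(s.card : ℝ)⁻¹ • ∑ j ∈ s, Y (x j) - c‖ ^ 2 ∂(Measure.pi fun _ : ι => μ)
      ≤ ‖∫ x, Y x ∂μ - c‖ ^ 2 + (s.card : ℝ)⁻¹ * ∫ x, ‖Y x‖ ^ 2 ∂μ := by
  have hk : ∀ k x, |Y x k| ≤ R := fun k x => (PiLp.norm_apply_le (Y x) k).trans (hR x)
  have hYk : ∀ k, Measurable fun x => Y x k := fun k => by fun_prop
  have hYi : Integrable Y μ := Integrable.of_bound hY.aestronglyMeasurable R (Eventually.of_forall hR)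
  have hint : ∀ k, (∫ x, Y x ∂μ) k = ∫ x, Y x k ∂μ := fun k =>
    ((EuclideanSpace.proj (𝕜 := ℝ) k).integral_comp_comm hYi).symm
  have hsq : ∀ k, Integrable (fun x => Y x k ^ 2) μ := fun k =>
    Integrable.of_bound (by fun_prop) (R ^ 2) (Eventually.of_forall fun x => by
      rw [norm_pow, Real.norm_eq_abs]; exact pow_le_pow_left₀ (abs_nonneg _) (hk k x) 2)
  have hpi : ∀ k, Integrable (fun x : ι → α => ((s.card : ℝ)⁻¹ * ∑ j ∈ s, Y (x j) k - c k) ^ 2)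
      (Measure.pi fun _ : ι => μ) := fun k => by
    have : MemLp (fun x : ι → α => (s.card : ℝ)⁻¹ * ∑ j ∈ s, Y (x j) k - c k) 2
        (Measure.pi fun _ : ι => μ) := by
      have hmk : MemLp (fun x => Y x k) 2 μ :=
        MemLp.of_bound (hYk k).aestronglyMeasurable R (Eventually.of_forall (hk k))
      have hj : ∀ j, MemLp (fun x : ι → α => Y (x j) k) 2 (Measure.pi fun _ : ι => μ) := fun j =>
        hmk.comp_measurePreserving (measurePreserving_eval (fun _ : ι => μ) j)
      exact ((memLp_finsetSum s fun j _ => hj j).const_mul _).sub (memLp_const _)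
    exact this.integrable_sq
  have e1 : ∀ v : Param d, ‖v‖ ^ 2 = ∑ k, v k ^ 2 := fun v => by
    simp [EuclideanSpace.norm_sq_eq]
  have e2 : ∀ (x : ι → α) (k : Fin d), ((s.card : ℝ)⁻¹ • ∑ j ∈ s, Y (x j) - c) k
      = (s.card : ℝ)⁻¹ * ∑ j ∈ s, Y (x j) k - c k := fun x k => by simp
  simp only [e1, e2]
  rw [integral_finsetSum _ fun k _ => hpi k, integral_finsetSum _ fun k _ => hsq k,
    Finset.mul_sum, ← Finset.sum_add_distrib]
  refine Finset.sum_le_sum fun k _ => ?_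
  rw [PiLp.sub_apply, hint]
  exact integral_sq_mean_sub_le (hYk k) (hk k) hs (c k)

/-- A product measure is preserved by an injective selection of coordinates. -/
theorem map_pi_comp_injective {κ : Type*} [Fintype κ] {σ : κ → ι} (hσ : Function.Injective σ) :
    (Measure.pi fun _ : ι => μ).map (fun x k => x (σ k)) = Measure.pi fun _ : κ => μ := by
  have h1 : iIndepFun (fun (i : ι) (x : ι → α) => x i) (Measure.pi fun _ : ι => μ) :=
    iIndepFun_pi (X := fun _ x => x) fun _ => aemeasurable_id
  have h2 := h1.precomp hσ
  rw [iIndepFun_iff_map_fun_eq_pi_map fun k => (measurable_pi_apply _).aemeasurable] at h2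
  rw [h2]
  congr 1
  funext k
  exact (measurePreserving_eval (fun _ : ι => μ) (σ k)).map_eq

end Moments

/-! ### The plug-in gradient and its multilevel differences -/

section Empirical

variable {E : Type*} [MeasurableSpace E] {d : ℕ}

/-- The empirical measure of the points `z j`, `j ∈ s`. -/
noncomputable def empirical {ι : Type*} (s : Finset ι) (z : ι → E) : Measure E :=
  (s.card : ℝ≥0∞)⁻¹ • ∑ j ∈ s, Measure.dirac (z j)

theorem isProbabilityMeasure_empirical {ι : Type*} {s : Finset ι} (hs : s.Nonempty) (z : ι → E) :
    IsProbabilityMeasure (empirical s z) := by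
  constructor
  have h0 : (s.card : ℝ≥0∞) ≠ 0 := by exact_mod_cast hs.card_pos.ne'
  simp [empirical, ENNReal.inv_mul_cancel h0 (ENNReal.natCast_ne_top _)]

theorem integral_empirical [MeasurableSingletonClass E] {ι : Type*} {F : Type*}
    [NormedAddCommGroup F] [NormedSpace ℝ F] [CompleteSpace F] (s : Finset ι) (z : ι → E)
    (h : E → F) : ∫ w, h w ∂(empirical s z) = (s.card : ℝ)⁻¹ • ∑ j ∈ s, h (z j) := by
  rw [empirical, integral_smul_measure, integral_finsetSum_measure fun j _ =>
    integrable_dirac (by simp)]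
  simp

theorem softMean_eq_softLoss [MeasurableSingletonClass E] {η : ℝ} {f : Param d → E → ℝ} {m : ℕ} {z' : Fin m → E}
    {s : Finset (Fin m)} : softMean η f z' s = softLoss η f (empirical s z') := by
  funext θ
  rw [softMean, softLoss, integral_empirical, smul_eq_mul]

/-- Measurable data: a loss with values in `[0, B]` and a vector field of norm at most `Lf`. -/
structure LossPair (h : E → ℝ) (g : E → Param d) (B Lf : ℝ) : Prop where
  measurable_loss : Measurable h
  mem : ∀ w, 0 ≤ h w ∧ h w ≤ B
  measurable_grad : Measurable g
  norm_le : ∀ w, ‖g w‖ ≤ Lf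

/-- The variance constant of the estimator from one sample. -/
noncomputable def varConst (Lf B η : ℝ) : ℝ := 4 * Real.exp (B / η) ^ 2 * Lf ^ 2

theorem varConst_nonneg (Lf B η : ℝ) : 0 ≤ varConst Lf B η := by unfold varConst; positivity

variable {h : E → ℝ} {g : E → Param d} {B Lf η : ℝ}

theorem LossPair.norm_softGrad_le (H : LossPair h g B Lf) (hη : 0 < η) (Q : Measure E)
    [IsProbabilityMeasure Q] : ‖softGrad η h g Q‖ ≤ Lf :=
  EntropicSGD.norm_softGrad_le hη H.measurable_loss H.mem H.norm_le

variable [MeasurableSingletonClass E]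

theorem LossPair.measurable_softGrad_empirical (H : LossPair h g B Lf) {ι : Type*}
    (s : Finset ι) : Measurable fun z : ι → E => softGrad η h g (empirical s z) := by
  have h1 := H.measurable_loss
  have h2 := H.measurable_grad
  simp only [softGrad, integral_empirical]
  fun_prop

/-- The error of this ratio estimator is a ratio as well: with `r` the true value, it is the
empirical mean of `Y = exp (h / η) (g - r)` over that of `exp (h / η)`. The field `Y` has mean zero
under `ν` and the denominator is at least 1, so the variance bound for the mean of `Y` suffices. -/
theorem LossPair.integral_norm_sq_softGrad_sub_le (H : LossPair h g B Lf) (hη : 0 < η)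
    (ν : Measure E) [IsProbabilityMeasure ν] {ι : Type*} [Fintype ι] {s : Finset ι}
    (hs : s.Nonempty) :
    ∫ z, ‖softGrad η h g (empirical s z) - softGrad η h g ν‖ ^ 2 ∂(Measure.pi fun _ : ι => ν)
      ≤ varConst Lf B η * (s.card : ℝ)⁻¹ := by
  have m1 := H.measurable_loss
  have m2 := H.measurable_grad
  set r := softGrad η h g ν with hr
  have hrL : ‖r‖ ≤ Lf := H.norm_softGrad_le hη ν
  set Y : E → Param d := fun w => Real.exp (h w / η) • (g w - r) with hY
  have hYm : Measurable Y := by fun_prop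
  have hYb : ∀ w, ‖Y w‖ ≤ Real.exp (B / η) * (2 * Lf) := fun w => by
    rw [hY, norm_smul, Real.norm_eq_abs, Real.abs_exp]
    refine mul_le_mul (exp_div_mem hη (H.mem w)).2 ?_ (norm_nonneg _) (Real.exp_pos _).le
    linarith [norm_sub_le (g w) r, H.norm_le w]
  have hi1 := integrable_exp_smul (Q := ν) hη m1 H.mem m2 H.norm_le
  have hi2 := integrable_exp_div (Q := ν) hη m1 H.mem
  have hY0 : ∫ w, Y w ∂ν = 0 := by
    simp only [hY, smul_sub]
    have ha := (integral_exp_div_mem (Q := ν) hη m1 H.mem).1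
    rw [integral_sub hi1 (hi2.smul_const r), integral_smul_const, hr, softGrad, smul_smul,
      mul_inv_cancel₀ (by linarith), one_smul, sub_self]
  have key := integral_norm_sq_mean_sub_le (μ := ν) hYm hYb hs 0
  rw [hY0, sub_zero, norm_zero, zero_pow two_ne_zero, zero_add] at key
  have hsec : ∫ w, ‖Y w‖ ^ 2 ∂ν ≤ varConst Lf B η := by
    have : ∀ w, ‖Y w‖ ^ 2 ≤ varConst Lf B η := fun w => by
      refine (pow_le_pow_left₀ (norm_nonneg _) (hYb w) 2).trans (le_of_eq ?_)
      unfold varConst; ring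
    have := integral_mono_of_nonneg (μ := ν) (Eventually.of_forall fun w => sq_nonneg ‖Y w‖)
      (integrable_const (varConst Lf B η)) (Eventually.of_forall this)
    simpa using this
  have hpt : ∀ z : ι → E, ‖softGrad η h g (empirical s z) - r‖ ^ 2
      ≤ ‖(s.card : ℝ)⁻¹ • ∑ j ∈ s, Y (z j) - 0‖ ^ 2 := fun z => by
    have := isProbabilityMeasure_empirical hs z
    have ha := (integral_exp_div_mem (Q := empirical s z) hη m1 H.mem).1
    have j1 := integrable_exp_smul (Q := empirical s z) hη m1 H.mem m2 H.norm_le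
    have j2 := integrable_exp_div (Q := empirical s z) hη m1 H.mem
    have e : softGrad η h g (empirical s z) - r
        = (∫ w, Real.exp (h w / η) ∂(empirical s z))⁻¹ • ∫ w, Y w ∂(empirical s z) := by
      simp only [hY, smul_sub]
      rw [integral_sub j1 (j2.smul_const r), integral_smul_const, smul_sub, smul_smul,
        inv_mul_cancel₀ (by linarith), one_smul, softGrad]
    rw [e, sub_zero, integral_empirical s z Y, norm_smul, norm_inv, Real.norm_eq_abs]
    refine pow_le_pow_left₀ (by positivity) (mul_le_of_le_one_left (norm_nonneg _) ?_) 2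
    exact inv_le_one_of_one_le₀ (ha.trans (le_abs_self _))
  have hint : Integrable (fun z : ι → E => ‖(s.card : ℝ)⁻¹ • ∑ j ∈ s, Y (z j) - 0‖ ^ 2)
      (Measure.pi fun _ : ι => ν) := by
    refine Integrable.of_bound (C := (Real.exp (B / η) * (2 * Lf)) ^ 2) ?_
      (Eventually.of_forall fun z => ?_)
    · refine Measurable.aestronglyMeasurable (Measurable.pow_const (Measurable.norm ?_) 2)
      fun_prop
    · rw [norm_pow, norm_norm, sub_zero, norm_smul, norm_inv, Real.norm_natCast]
      refine pow_le_pow_left₀ (by positivity) ?_ 2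
      have hc : (0 : ℝ) < s.card := by exact_mod_cast hs.card_pos
      rw [inv_mul_le_iff₀ hc]
      refine (norm_sum_le _ _).trans ((Finset.sum_le_card_nsmul _ _ _ fun j _ => hYb (z j)).trans ?_)
      rw [nsmul_eq_mul]
  refine (integral_mono_of_nonneg (Eventually.of_forall fun z => sq_nonneg _) hint
    (Eventually.of_forall hpt)).trans (key.trans ?_)
  rw [mul_comm]
  exact mul_le_mul_of_nonneg_right hsec (by positivity)

/-- Only the number of samples matters: the increasing enumeration of `s` selects coordinates
injectively, and this preserves the product measure. -/
theorem LossPair.integral_softGrad_of_card (H : LossPair h g B Lf) (ν : Measure E)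
    [IsProbabilityMeasure ν] {m k : ℕ} {s : Finset (Fin m)} (hs : s.card = k) :
    ∫ z, softGrad η h g (empirical s z) ∂(Measure.pi fun _ : Fin m => ν)
      = ∫ z, softGrad η h g (empirical Finset.univ z) ∂(Measure.pi fun _ : Fin k => ν) := by
  set σ := s.orderEmbOfFin hs with hσ
  rw [← map_pi_comp_injective (μ := ν) σ.injective, integral_map
    (measurable_pi_lambda _ fun k => measurable_pi_apply (σ k)).aemeasurable
    (H.measurable_softGrad_empirical _).aestronglyMeasurable]
  refine integral_congr_ae (Eventually.of_forall fun z => ?_)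
  have : empirical s z = empirical Finset.univ fun k => z (σ k) := by
    have hmap : s = Finset.univ.map σ.toEmbedding := (Finset.map_orderEmbOfFin_univ s hs).symm
    rw [empirical, empirical]
    conv_lhs => rw [hmap]
    simp
  simp only [this]

/-- The gradient of `levelDiff` at level `ℓ`. -/
noncomputable def levelDir (η : ℝ) (h : E → ℝ) (g : E → Param d) (ℓ : ℕ) (z' : Fin (2 ^ ℓ) → E) :
    Param d :=
  if ℓ = 0 then softGrad η h g (empirical Finset.univ z')
  else softGrad η h g (empirical Finset.univ z')
    - (1 / 2 : ℝ) • softGrad η h g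
      (empirical (Finset.univ.filter fun j : Fin (2 ^ ℓ) => (j : ℕ) < 2 ^ (ℓ - 1)) z')
    - (1 / 2 : ℝ) • softGrad η h g
      (empirical (Finset.univ.filter fun j : Fin (2 ^ ℓ) => 2 ^ (ℓ - 1) ≤ (j : ℕ)) z')

theorem card_lower_half (ℓ : ℕ) :
    (Finset.univ.filter fun j : Fin (2 ^ (ℓ + 1)) => (j : ℕ) < 2 ^ ℓ).card = 2 ^ ℓ := by
  rw [Fin.card_filter_val_lt]
  exact min_eq_right (Nat.pow_le_pow_right two_pos (Nat.le_succ ℓ))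

theorem card_upper_half (ℓ : ℕ) :
    (Finset.univ.filter fun j : Fin (2 ^ (ℓ + 1)) => 2 ^ ℓ ≤ (j : ℕ)).card = 2 ^ ℓ := by
  have h := Finset.card_filter_add_card_filter_not (s := (Finset.univ : Finset (Fin (2 ^ (ℓ + 1)))))
    (fun j : Fin (2 ^ (ℓ + 1)) => (j : ℕ) < 2 ^ ℓ)
  rw [card_lower_half] at h
  simp only [not_lt, Finset.card_univ, Fintype.card_fin] at h
  rw [pow_succ] at h ⊢
  omega

theorem nonempty_of_card_eq_two_pow {ι : Type*} {s : Finset ι} {ℓ : ℕ} (hs : s.card = 2 ^ ℓ) :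
    s.Nonempty := Finset.card_pos.1 (by rw [hs]; positivity)

theorem LossPair.measurable_levelDir (H : LossPair h g B Lf) (ℓ : ℕ) :
    Measurable (levelDir η h g ℓ) := by
  have hs := fun s : Finset (Fin (2 ^ ℓ)) => H.measurable_softGrad_empirical (η := η) s
  by_cases hℓ : ℓ = 0
  · have e : levelDir η h g ℓ = fun z' => softGrad η h g (empirical Finset.univ z') := by
      funext z'; rw [levelDir, if_pos hℓ]
    rw [e]
    exact hs _
  · have e := funext fun z' => if_neg hℓ ▸ levelDir.eq_1 η h g ℓ z'
    rw [e]
    have h1 := hs Finset.univ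
    have h2 := hs (Finset.univ.filter fun j : Fin (2 ^ ℓ) => (j : ℕ) < 2 ^ (ℓ - 1))
    have h3 := hs (Finset.univ.filter fun j : Fin (2 ^ ℓ) => 2 ^ (ℓ - 1) ≤ (j : ℕ))
    fun_prop

theorem LossPair.norm_levelDir_le (H : LossPair h g B Lf) (hη : 0 < η) (hLf : 0 ≤ Lf) (ℓ : ℕ)
    (z' : Fin (2 ^ ℓ) → E) : ‖levelDir η h g ℓ z'‖ ≤ 2 * Lf := by
  have hb : ∀ s : Finset (Fin (2 ^ ℓ)), s.Nonempty → ‖softGrad η h g (empirical s z')‖ ≤ Lf :=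
    fun s hs => by
      have := isProbabilityMeasure_empirical hs z'
      exact H.norm_softGrad_le hη _
  rcases ℓ with _ | ℓ
  · rw [levelDir, if_pos rfl]
    linarith [hb _ (Finset.univ_nonempty)]
  · rw [levelDir, if_neg (Nat.succ_ne_zero ℓ), Nat.add_sub_cancel]
    have h1 := hb _ (Finset.univ_nonempty)
    have h2 := hb _ (nonempty_of_card_eq_two_pow (card_lower_half ℓ))
    have h3 := hb _ (nonempty_of_card_eq_two_pow (card_upper_half ℓ))
    refine (norm_sub_le _ _).trans ((add_le_add (norm_sub_le _ _) le_rfl).trans ?_)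
    rw [norm_smul, norm_smul, Real.norm_eq_abs, abs_of_pos (by norm_num : (0 : ℝ) < 1 / 2)]
    linarith

theorem integrable_of_measurable_bound {α F : Type*} [MeasurableSpace α] {μ : Measure α}
    [IsFiniteMeasure μ] [NormedAddCommGroup F] [MeasurableSpace F] [BorelSpace F]
    [SecondCountableTopology F] {Y : α → F} (hY : Measurable Y) {R : ℝ} (hR : ∀ x, ‖Y x‖ ≤ R) :
    Integrable Y μ :=
  Integrable.of_bound hY.aestronglyMeasurable R (Eventually.of_forall hR)

/-- The coefficients 1, -1/2, -1/2 sum to zero, so all three vectors may be measured from any common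
`r`. -/
theorem norm_sq_sub_half_le {V : Type*} [NormedAddCommGroup V] [InnerProductSpace ℝ V]
    (a b c r : V) : ‖a - (1 / 2 : ℝ) • b - (1 / 2 : ℝ) • c‖ ^ 2
      ≤ 2 * ‖a - r‖ ^ 2 + ‖b - r‖ ^ 2 + ‖c - r‖ ^ 2 := by
  have e : a - (1 / 2 : ℝ) • b - (1 / 2 : ℝ) • c
      = (a - r) - (1 / 2 : ℝ) • ((b - r) + (c - r)) := by module
  have h1 : ‖a - (1 / 2 : ℝ) • b - (1 / 2 : ℝ) • c‖
      ≤ ‖a - r‖ + 1 / 2 * (‖b - r‖ + ‖c - r‖) := by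
    rw [e]
    refine (norm_sub_le _ _).trans (add_le_add le_rfl ?_)
    rw [norm_smul, Real.norm_eq_abs, abs_of_pos (by norm_num : (0 : ℝ) < 1 / 2)]
    exact mul_le_mul_of_nonneg_left (norm_add_le _ _) (by norm_num)
  have h2 := pow_le_pow_left₀ (norm_nonneg _) h1 2
  nlinarith [sq_nonneg (‖a - r‖ - 1 / 2 * (‖b - r‖ + ‖c - r‖)), sq_nonneg (‖b - r‖ - ‖c - r‖)]

/-- All three plug-in gradients are compared with the exact one. From level 1 on, each has mean
square error of order `2^{-ℓ}`, and no finer cancellation between the full sample and its halves is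
needed. -/
theorem LossPair.integral_norm_sq_levelDir_le (H : LossPair h g B Lf) (hη : 0 < η) (hLf : 0 ≤ Lf)
    (hB : 0 ≤ B) (ν : Measure E) [IsProbabilityMeasure ν] (ℓ : ℕ) :
    ∫ z, ‖levelDir η h g ℓ z‖ ^ 2 ∂(Measure.pi fun _ : Fin (2 ^ ℓ) => ν)
      ≤ 6 * varConst Lf B η * (1 / 2) ^ ℓ := by
  have hK := varConst_nonneg Lf B η
  rcases ℓ with _ | ℓ
  · have hb : ∀ z : Fin (2 ^ 0) → E, ‖levelDir η h g 0 z‖ ^ 2 ≤ 6 * varConst Lf B η := fun z => by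
      have h1 := H.norm_levelDir_le hη hLf 0 z
      have h2 := pow_le_pow_left₀ (norm_nonneg _) h1 2
      have h3 : 1 ≤ Real.exp (B / η) ^ 2 := one_le_pow₀ (Real.one_le_exp (by positivity))
      unfold varConst
      nlinarith [sq_nonneg Lf]
    have := integral_mono_of_nonneg (μ := Measure.pi fun _ : Fin (2 ^ 0) => ν)
      (Eventually.of_forall fun z => sq_nonneg ‖levelDir η h g 0 z‖)
      (integrable_const (6 * varConst Lf B η)) (Eventually.of_forall hb)
    simpa using this
  · set μ := Measure.pi fun _ : Fin (2 ^ (ℓ + 1)) => ν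
    set r := softGrad η h g ν with hr
    set lo := Finset.univ.filter fun j : Fin (2 ^ (ℓ + 1)) => (j : ℕ) < 2 ^ ℓ
    set hi := Finset.univ.filter fun j : Fin (2 ^ (ℓ + 1)) => 2 ^ ℓ ≤ (j : ℕ)
    have hlo : lo.card = 2 ^ ℓ := card_lower_half ℓ
    have hhi : hi.card = 2 ^ ℓ := card_upper_half ℓ
    have k1 := H.integral_norm_sq_softGrad_sub_le hη ν
      (Finset.univ_nonempty (α := Fin (2 ^ (ℓ + 1))))
    have k2 := H.integral_norm_sq_softGrad_sub_le hη ν (nonempty_of_card_eq_two_pow hlo)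
    have k3 := H.integral_norm_sq_softGrad_sub_le hη ν (nonempty_of_card_eq_two_pow hhi)
    have hint : ∀ s : Finset (Fin (2 ^ (ℓ + 1))), s.Nonempty → Integrable (fun z =>
        ‖softGrad η h g (empirical s z) - r‖ ^ 2) μ := fun s hs => by
      refine integrable_of_measurable_bound (R := (2 * Lf) ^ 2)
        (((H.measurable_softGrad_empirical s).sub_const r).norm.pow_const 2) fun z => ?_
      have := isProbabilityMeasure_empirical hs z
      rw [norm_pow, norm_norm]
      refine pow_le_pow_left₀ (norm_nonneg _) ((norm_sub_le _ _).trans ?_) 2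
      linarith [H.norm_softGrad_le hη (empirical s z), H.norm_softGrad_le hη ν]
    have i1 := (hint _ (Finset.univ_nonempty)).const_mul 2
    have i2 := hint _ (nonempty_of_card_eq_two_pow hlo)
    have i3 := hint _ (nonempty_of_card_eq_two_pow hhi)
    have hle := integral_mono_of_nonneg (μ := μ)
      (Eventually.of_forall fun z => sq_nonneg ‖levelDir η h g (ℓ + 1) z‖) ((i1.add i2).add i3)
      (Eventually.of_forall fun z => by
        simp only [levelDir, if_neg (Nat.succ_ne_zero ℓ), Nat.add_sub_cancel]
        exact norm_sq_sub_half_le _ _ _ r)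
    rw [integral_add' (i1.add i2) i3, integral_add' i1 i2, integral_const_mul] at hle
    rw [hlo] at k2
    rw [hhi] at k3
    rw [Finset.card_univ, Fintype.card_fin] at k1
    push_cast at k1 k2 k3
    have e1 : ((2 : ℝ) ^ ℓ)⁻¹ = 2 * (1 / 2) ^ (ℓ + 1) := by
      rw [pow_succ, one_div, inv_pow]; ring
    have e2 : ((2 : ℝ) ^ (ℓ + 1))⁻¹ = (1 / 2) ^ (ℓ + 1) := by rw [one_div, inv_pow]
    rw [e1] at k2 k3
    rw [e2] at k1
    refine hle.trans ?_
    linarith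

/-- The level means telescope. -/
theorem LossPair.sum_integral_levelDir (H : LossPair h g B Lf) (hη : 0 < η)
    (ν : Measure E) [IsProbabilityMeasure ν] (L : ℕ) :
    ∑ ℓ ∈ Finset.range (L + 1),
        ∫ z, levelDir η h g ℓ z ∂(Measure.pi fun _ : Fin (2 ^ ℓ) => ν)
      = ∫ z, softGrad η h g (empirical Finset.univ z) ∂(Measure.pi fun _ : Fin (2 ^ L) => ν) := by
  have hi : ∀ (m : ℕ) (s : Finset (Fin m)), s.Nonempty → Integrable (fun z =>
      softGrad η h g (empirical s z)) (Measure.pi fun _ : Fin m => ν) := fun m s hs =>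
    integrable_of_measurable_bound (H.measurable_softGrad_empirical s) (R := Lf) fun z => by
      have := isProbabilityMeasure_empirical hs z
      exact H.norm_softGrad_le hη _
  induction L with
  | zero => simp [levelDir]
  | succ L ih =>
    rw [Finset.sum_range_succ, ih]
    simp only [levelDir, if_neg (Nat.succ_ne_zero L), Nat.add_sub_cancel]
    have c1 := card_lower_half L
    have c2 := card_upper_half L
    have i1 := hi _ _ (Finset.univ_nonempty (α := Fin (2 ^ (L + 1))))
    have i2 := (hi _ _ (nonempty_of_card_eq_two_pow c1)).fun_smul (1 / 2 : ℝ)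
    have i3 := (hi _ _ (nonempty_of_card_eq_two_pow c2)).fun_smul (1 / 2 : ℝ)
    have i12 : Integrable (fun z => softGrad η h g (empirical Finset.univ z) - (1 / 2 : ℝ) •
      softGrad η h g (empirical (Finset.univ.filter fun j : Fin (2 ^ (L + 1)) =>
        (j : ℕ) < 2 ^ L) z)) (Measure.pi fun _ => ν) := i1.sub i2
    -- Each half has `2 ^ L` samples, so the two halves together subtract exactly the mean reached
    -- at level `L`.
    rw [integral_sub i12 i3, integral_sub i1 i2, integral_smul, integral_smul,
      H.integral_softGrad_of_card ν c1, H.integral_softGrad_of_card ν c2]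
    module

end Empirical

/-! ### A measurable substitute for the estimator -/

section LevelDiff

variable {d : ℕ} {E : Type*} [MeasurableSpace E]

theorem SmoothBoundedLoss.lossPair {Θ : Set (Param d)} {f : Param d → E → ℝ} {Lf Sf B : ℝ}
    (H : SmoothBoundedLoss Θ univ f Lf Sf B) {θ : Param d} (hθ : θ ∈ Θ) {g : E → Param d}
    (hg : GradSelection Θ f Lf Sf θ g) : LossPair (f θ) g B Lf :=
  ⟨H.measurable θ hθ, fun w => H.bounded w trivial θ hθ, hg.measurable, hg.norm_le⟩

variable [MeasurableSingletonClass E]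

/-- Only the gradient matters here, not the size of `c`, so the constant is left unspecified. -/
theorem levelDiff_quadApprox {Θ : Set (Param d)} {f : Param d → E → ℝ} {Lf Sf B η : ℝ}
    (hη : 0 < η) (H : SmoothBoundedLoss Θ univ f Lf Sf B) {θ : Param d} (hθ : θ ∈ Θ)
    {g : E → Param d} (hg : GradSelection Θ f Lf Sf θ g) (ℓ : ℕ) (z' : Fin (2 ^ ℓ) → E) :
    ∃ c, QuadApprox Θ (levelDiff η f ℓ z') θ (levelDir η (f θ) g ℓ z') c := by
  have hq : ∀ s : Finset (Fin (2 ^ ℓ)), s.Nonempty → QuadApprox Θ (softMean η f z' s) θ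
      (softGrad η (f θ) g (empirical s z')) (smoothConst Lf Sf B η) := fun s hs => by
    have := isProbabilityMeasure_empirical hs z'
    rw [softMean_eq_softLoss]
    exact softLoss_quadApprox hη H hθ hg
  rcases ℓ with _ | ℓ
  · refine ⟨smoothConst Lf Sf B η, ?_⟩
    rw [levelDir, if_pos rfl]
    exact hq _ Finset.univ_nonempty
  · have e : levelDiff η f (ℓ + 1) z' = fun ϑ => softMean η f z' Finset.univ ϑ
        - (1 / 2) * softMean η f z' (Finset.univ.filter fun j => (j : ℕ) < 2 ^ ℓ) ϑ
        - (1 / 2) * softMean η f z' (Finset.univ.filter fun j => 2 ^ ℓ ≤ (j : ℕ)) ϑ := by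
      funext ϑ
      rw [levelDiff, if_neg (Nat.succ_ne_zero ℓ), Nat.add_sub_cancel]
    rw [e, levelDir, if_neg (Nat.succ_ne_zero ℓ), Nat.add_sub_cancel]
    exact ⟨_, ((hq _ Finset.univ_nonempty).lincomb (1 / 2)
      (hq _ (nonempty_of_card_eq_two_pow (card_lower_half ℓ)))).lincomb (1 / 2)
      (hq _ (nonempty_of_card_eq_two_pow (card_upper_half ℓ)))⟩

/-- The contribution of one draw to the estimator. -/
noncomputable def drawDir (η : ℝ) (h : E → ℝ) (g : E → Param d) {L : ℕ} (b : Draw L E) : Param d :=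
  (levelProb L (b.1 : ℕ))⁻¹ • levelDir η h g (b.1 : ℕ) b.2.2

/-- The estimator from a mini-batch. -/
noncomputable def batchDir (η : ℝ) (h : E → ℝ) (g : E → Param d) {L n : ℕ} (b : Fin n → Draw L E) :
    Param d :=
  (n : ℝ)⁻¹ • ∑ i, drawDir η h g (b i)

/-- The estimator is built from `gradientWithin`, with no control of measurability or norm.
`batchDir` has the same pairings with directions of `Θ`, hence produces the same projected step, and
it is the one whose moments are computed. -/
theorem inner_rtmlmc {Θ : Set (Param d)} (hΘ : Convex ℝ Θ) {f : Param d → E → ℝ} {Lf Sf B η : ℝ}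
    (hη : 0 < η) (H : SmoothBoundedLoss Θ univ f Lf Sf B) {θ : Param d} (hθ : θ ∈ Θ)
    {g : E → Param d} (hg : GradSelection Θ f Lf Sf θ g) {L n : ℕ} (b : Fin n → Draw L E)
    {x y : Param d} (hx : x ∈ Θ) (hy : y ∈ Θ) :
    ⟪rtmlmc Θ η f b θ, y - x⟫ = ⟪batchDir η (f θ) g b, y - x⟫ := by
  simp only [rtmlmc, batchDir, drawDir, real_inner_smul_left, sum_inner]
  congr 1
  refine Finset.sum_congr rfl fun i _ => ?_
  obtain ⟨c, hc⟩ := levelDiff_quadApprox hη H hθ hg ((b i).1 : ℕ) (b i).2.2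
  rw [levelGrad, hc.inner_gradientWithin hΘ hθ hx hy]

end LevelDiff

/-! ### The truncated geometric distribution -/

section LevelProb

theorem levelProb_den_pos (L : ℕ) : (1 : ℝ) ≤ 2 - (1 / 2) ^ L := by
  have : (1 / 2 : ℝ) ^ L ≤ 1 := pow_le_one₀ (by norm_num) (by norm_num)
  linarith

theorem levelProb_pos (L ℓ : ℕ) : 0 < levelProb L ℓ :=
  div_pos (by positivity) (by linarith [levelProb_den_pos L])

theorem levelProb_le (L ℓ : ℕ) : levelProb L ℓ ≤ (1 / 2) ^ ℓ :=
  div_le_self (by positivity) (levelProb_den_pos L)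

theorem inv_levelProb_le (L ℓ : ℕ) : (levelProb L ℓ)⁻¹ ≤ 2 * 2 ^ ℓ := by
  rw [levelProb, inv_div, one_div, inv_pow, inv_pow, div_inv_eq_mul]
  have : 0 < ((2 : ℝ) ^ L)⁻¹ := by positivity
  have h2 : (0 : ℝ) < 2 ^ ℓ := by positivity
  nlinarith

theorem sum_levelProb (L : ℕ) : ∑ ℓ : Fin (L + 1), levelProb L ℓ = 1 := by
  rw [Fin.sum_univ_eq_sum_range fun ℓ => levelProb L ℓ]
  simp only [levelProb]
  rw [← Finset.sum_div, div_eq_one_iff_eq (by linarith [levelProb_den_pos L])]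
  induction L with
  | zero => norm_num
  | succ L ih => rw [Finset.sum_range_succ, ih, pow_succ]; ring

end LevelProb

/-! ### Sampling laws; bias and second moment of the estimator -/

section Laws

variable {E : Type*} [NormedAddCommGroup E] [NormedSpace ℝ E] [FiniteDimensional ℝ E]
  [MeasurableSpace E] [BorelSpace E] {ρ : ℝ}

theorem measurable_pi_ballMeasure (hρ : 0 < ρ) (m : ℕ) :
    Measurable fun z : E => Measure.pi fun _ : Fin m => ballMeasure ρ z := by
  have := fun z : E => isProbabilityMeasure_ballMeasure hρ z
  have h := (Measure.measurable_map _ (measurable_snd (α := E) (β := Fin m → E))).comp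
    (measurable_zeta hρ m)
  have e : (fun z : E => Measure.pi fun _ : Fin m => ballMeasure ρ z)
      = Measure.map Prod.snd ∘ fun z : E =>
        (Measure.dirac z).prod (Measure.pi fun _ : Fin m => ballMeasure ρ z) := by
    funext z
    simp [Measure.map_snd_prod]
  rw [e]
  exact h

/-- The uniform measure on balls, as a Markov kernel. -/
noncomputable def ballKernel (ρ : ℝ) : Kernel E E := ⟨ballMeasure ρ, measurable_ballMeasure ρ⟩

/-- The product measures of the `ballMeasure`s, as a Markov kernel. -/
noncomputable def piBallKernel (hρ : 0 < ρ) (m : ℕ) : Kernel E (Fin m → E) :=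
  ⟨fun z => Measure.pi fun _ => ballMeasure ρ z, measurable_pi_ballMeasure hρ m⟩

theorem isMarkovKernel_ballKernel (hρ : 0 < ρ) : IsMarkovKernel (ballKernel ρ : Kernel E E) :=
  ⟨fun z => isProbabilityMeasure_ballMeasure hρ z⟩

theorem isMarkovKernel_piBallKernel (hρ : 0 < ρ) (m : ℕ) :
    IsMarkovKernel (piBallKernel hρ m : Kernel E (Fin m → E)) := by
  have := fun z : E => isProbabilityMeasure_ballMeasure hρ z
  exact ⟨fun z => by show IsProbabilityMeasure (Measure.pi _); infer_instance⟩

variable (P : Measure E) [IsProbabilityMeasure P]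

/-- As a composition product with a Markov kernel, the law admits Fubini's theorem and a description
of its null sets. -/
theorem zetaLaw_eq (hρ : 0 < ρ) (ℓ : ℕ) : zetaLaw P ρ ℓ = P ⊗ₘ piBallKernel hρ (2 ^ ℓ) := by
  have := isMarkovKernel_piBallKernel (E := E) hρ (2 ^ ℓ)
  rw [Measure.compProd_eq_comp_prod, zetaLaw]
  congr 1
  funext z
  rw [Kernel.prod_apply, Kernel.id_apply]
  rfl

theorem isProbabilityMeasure_zetaLaw (hρ : 0 < ρ) (ℓ : ℕ) :
    IsProbabilityMeasure (zetaLaw P ρ ℓ) := by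
  have := isMarkovKernel_piBallKernel (E := E) hρ (2 ^ ℓ)
  rw [zetaLaw_eq P hρ]
  infer_instance

theorem integral_zetaLaw (hρ : 0 < ρ) (ℓ : ℕ) {F : Type*} [NormedAddCommGroup F] [NormedSpace ℝ F]
    [MeasurableSpace F] [BorelSpace F] [SecondCountableTopology F] {Φ : (Fin (2 ^ ℓ) → E) → F}
    (hΦ : Measurable Φ) {R : ℝ} (hR : ∀ z', ‖Φ z'‖ ≤ R) :
    ∫ p, Φ p.2 ∂(zetaLaw P ρ ℓ)
      = ∫ z, ∫ z', Φ z' ∂(Measure.pi fun _ : Fin (2 ^ ℓ) => ballMeasure ρ z) ∂P := by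
  have := isMarkovKernel_piBallKernel (E := E) hρ (2 ^ ℓ)
  have hi : Integrable (fun p : E × (Fin (2 ^ ℓ) → E) => Φ p.2)
      (P ⊗ₘ piBallKernel hρ (2 ^ ℓ)) :=
    integrable_of_measurable_bound (hΦ.comp measurable_snd) fun p => hR p.2
  rw [zetaLaw_eq P hρ, Measure.integral_compProd hi]
  rfl

theorem measurable_sigma_mk {ι : Type*} {β : ι → Type*} [∀ i, MeasurableSpace (β i)] (i : ι) :
    Measurable (Sigma.mk (β := β) i) := by
  rw [measurable_iff_le_map]
  exact iInf_le _ i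

theorem measurable_sigma {ι γ : Type*} {β : ι → Type*} [∀ i, MeasurableSpace (β i)]
    [MeasurableSpace γ] {Ψ : Sigma β → γ} (h : ∀ i, Measurable fun x : β i => Ψ ⟨i, x⟩) :
    Measurable Ψ := fun _ hs =>
  MeasurableSpace.measurableSet_iInf.2 fun i => h i hs

theorem isProbabilityMeasure_drawLaw (hρ : 0 < ρ) (L : ℕ) :
    IsProbabilityMeasure (drawLaw P ρ L) := by
  constructor
  have : ∀ ℓ : Fin (L + 1), (ENNReal.ofReal (levelProb L ℓ) • (zetaLaw P ρ (ℓ : ℕ)).map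
      (Sigma.mk (β := fun m : Fin (L + 1) => E × (Fin (2 ^ (m : ℕ)) → E)) ℓ)) univ
      = ENNReal.ofReal (levelProb L ℓ) := fun ℓ => by
    have := isProbabilityMeasure_zetaLaw P hρ (ℓ : ℕ)
    rw [Measure.smul_apply, Measure.map_apply (measurable_sigma_mk ℓ) MeasurableSet.univ]
    simp
  rw [drawLaw, Measure.finsetSum_apply]
  simp only [this]
  rw [← ENNReal.ofReal_sum_of_nonneg (f := fun ℓ : Fin (L + 1) => levelProb L ℓ)
    fun ℓ _ => (levelProb_pos L ℓ).le, sum_levelProb, ENNReal.ofReal_one]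

theorem integral_drawLaw (hρ : 0 < ρ) (L : ℕ) {F : Type*} [NormedAddCommGroup F] [NormedSpace ℝ F]
    [CompleteSpace F] [MeasurableSpace F] [BorelSpace F] [SecondCountableTopology F]
    {Φ : (ℓ : ℕ) → (Fin (2 ^ ℓ) → E) → F} (hΦ : ∀ ℓ, Measurable (Φ ℓ)) {R : ℕ → ℝ}
    (hR : ∀ ℓ z', ‖Φ ℓ z'‖ ≤ R ℓ) :
    ∫ b : Draw L E, Φ (b.1 : ℕ) b.2.2 ∂(drawLaw P ρ L)
      = ∑ ℓ : Fin (L + 1), levelProb L ℓ •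
        ∫ z, ∫ z', Φ ℓ z' ∂(Measure.pi fun _ : Fin (2 ^ (ℓ : ℕ)) => ballMeasure ρ z) ∂P := by
  have hm : Measurable fun b : Draw L E => Φ (b.1 : ℕ) b.2.2 :=
    measurable_sigma fun ℓ => (hΦ ℓ).comp measurable_snd
  have hi : ∀ ℓ : Fin (L + 1), Integrable (fun b : Draw L E => Φ (b.1 : ℕ) b.2.2)
      ((zetaLaw P ρ (ℓ : ℕ)).map
        (Sigma.mk (β := fun m : Fin (L + 1) => E × (Fin (2 ^ (m : ℕ)) → E)) ℓ)) := fun ℓ => by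
    have := isProbabilityMeasure_zetaLaw P hρ (ℓ : ℕ)
    rw [integrable_map_measure hm.aestronglyMeasurable (measurable_sigma_mk ℓ).aemeasurable]
    exact integrable_of_measurable_bound ((hΦ ℓ).comp measurable_snd) fun p => hR ℓ p.2
  rw [drawLaw, integral_finsetSum_measure fun ℓ _ => (hi ℓ).smul_measure ENNReal.ofReal_ne_top]
  refine Finset.sum_congr rfl fun ℓ _ => ?_
  rw [integral_smul_measure, ENNReal.toReal_ofReal (levelProb_pos L ℓ).le,
    integral_map (measurable_sigma_mk ℓ).aemeasurable hm.aestronglyMeasurable,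
    ← integral_zetaLaw P hρ ℓ (hΦ ℓ) (hR ℓ)]

variable {d : ℕ} {h : E → ℝ} {g : E → Param d} {B Lf η : ℝ}

theorem LossPair.measurable_softGrad_ball (H : LossPair h g B Lf) (hρ : 0 < ρ) :
    Measurable fun z => softGrad η h g (ballMeasure ρ z) := by
  have := isMarkovKernel_ballKernel (E := E) hρ
  have h1 := H.measurable_loss
  have h2 := H.measurable_grad
  have m1 : Measurable fun w => Real.exp (h w / η) := by fun_prop
  have m2 : Measurable fun w => Real.exp (h w / η) • g w := by fun_prop
  exact (m1.stronglyMeasurable.integral_kernel (κ := ballKernel ρ)).measurable.inv.smul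
    (m2.stronglyMeasurable.integral_kernel (κ := ballKernel ρ)).measurable

theorem LossPair.measurable_drawDir (H : LossPair h g B Lf) (L : ℕ) :
    Measurable (drawDir (L := L) η h g) := by
  refine measurable_sigma fun ℓ => ?_
  have hm : Measurable fun x : E × (Fin (2 ^ (ℓ : ℕ)) → E) => levelDir η h g (ℓ : ℕ) x.2 :=
    (H.measurable_levelDir ℓ).comp measurable_snd
  exact hm.fun_const_smul (levelProb L (ℓ : ℕ))⁻¹

theorem LossPair.norm_drawDir_le (H : LossPair h g B Lf) (hη : 0 < η) (hLf : 0 ≤ Lf) (L : ℕ)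
    (b : Draw L E) : ‖drawDir η h g b‖ ≤ 2 * 2 ^ L * (2 * Lf) := by
  rw [drawDir, norm_smul, norm_inv, Real.norm_eq_abs, abs_of_pos (levelProb_pos L _)]
  refine mul_le_mul ((inv_levelProb_le L _).trans ?_) (H.norm_levelDir_le hη hLf _ _)
    (norm_nonneg _) (by positivity)
  have : (2 : ℝ) ^ (b.1 : ℕ) ≤ 2 ^ L := pow_le_pow_right₀ one_le_two (Nat.lt_succ_iff.1 b.1.2)
  linarith

/-- The weights `1/p_ℓ` cancel the level probabilities and the level means telescope, so the mean is
that of the plug-in gradient with `2 ^ L` samples. Jensen's inequality, over `z` and over the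
samples, bounds the squared bias by the mean square error. -/
theorem LossPair.norm_sq_integral_drawDir_sub_le (H : LossPair h g B Lf) (hη : 0 < η)
    (hLf : 0 ≤ Lf) (hρ : 0 < ρ) (L : ℕ) :
    ‖∫ b, drawDir η h g b ∂(drawLaw P ρ L) - ∫ z, softGrad η h g (ballMeasure ρ z) ∂P‖ ^ 2
      ≤ varConst Lf B η * (1 / 2) ^ L := by
  have hprob := fun z : E => isProbabilityMeasure_ballMeasure hρ z
  have hml : ∀ ℓ, Measurable fun z : E => ∫ z', levelDir η h g ℓ z'
      ∂(Measure.pi fun _ : Fin (2 ^ ℓ) => ballMeasure ρ z) := fun ℓ => by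
    have := isMarkovKernel_piBallKernel (E := E) hρ (2 ^ ℓ)
    exact ((H.measurable_levelDir ℓ).stronglyMeasurable.integral_kernel
      (κ := piBallKernel hρ (2 ^ ℓ))).measurable
  have hbl : ∀ (ℓ : ℕ) (z : E), ‖∫ z', levelDir η h g ℓ z'
      ∂(Measure.pi fun _ : Fin (2 ^ ℓ) => ballMeasure ρ z)‖ ≤ 2 * Lf := fun ℓ z =>
    (norm_integral_le_of_norm_le_const (Eventually.of_forall
      (H.norm_levelDir_le hη hLf ℓ))).trans (by simp)
  have hsum : ∫ b, drawDir η h g b ∂(drawLaw P ρ L) = ∫ z, ∫ z', softGrad η h g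
      (empirical Finset.univ z') ∂(Measure.pi fun _ : Fin (2 ^ L) => ballMeasure ρ z) ∂P := by
    have e1 := integral_drawLaw P hρ L (Φ := fun ℓ z' => (levelProb L ℓ)⁻¹ • levelDir η h g ℓ z')
      (fun ℓ => (H.measurable_levelDir ℓ).fun_const_smul _)
      (R := fun ℓ => (levelProb L ℓ)⁻¹ * (2 * Lf)) (fun ℓ z' => by
        rw [norm_smul, norm_inv, Real.norm_eq_abs, abs_of_pos (levelProb_pos L ℓ)]
        exact mul_le_mul_of_nonneg_left (H.norm_levelDir_le hη hLf _ _)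
          (inv_nonneg.2 (levelProb_pos L ℓ).le))
    have e2 : ∀ ℓ : ℕ, levelProb L ℓ • ∫ z, ∫ z', (levelProb L ℓ)⁻¹ • levelDir η h g ℓ z'
        ∂(Measure.pi fun _ : Fin (2 ^ ℓ) => ballMeasure ρ z) ∂P = ∫ z, ∫ z', levelDir η h g ℓ z'
        ∂(Measure.pi fun _ : Fin (2 ^ ℓ) => ballMeasure ρ z) ∂P := fun ℓ => by
      simp only [integral_smul]
      rw [smul_smul, mul_inv_cancel₀ (levelProb_pos L ℓ).ne', one_smul]
    simp only [e2] at e1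
    refine e1.trans ?_
    rw [Fin.sum_univ_eq_sum_range fun ℓ => ∫ z, ∫ z', levelDir η h g ℓ z'
        ∂(Measure.pi fun _ : Fin (2 ^ ℓ) => ballMeasure ρ z) ∂P,
      ← integral_finsetSum _ fun ℓ _ => integrable_of_measurable_bound (hml ℓ) (hbl ℓ)]
    simp only [H.sum_integral_levelDir hη]
  have hme : Measurable fun z : E => ∫ z', softGrad η h g (empirical Finset.univ z')
      ∂(Measure.pi fun _ : Fin (2 ^ L) => ballMeasure ρ z) := by
    have := isMarkovKernel_piBallKernel (E := E) hρ (2 ^ L)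
    exact ((H.measurable_softGrad_empirical Finset.univ).stronglyMeasurable.integral_kernel
      (κ := piBallKernel hρ (2 ^ L))).measurable
  have hbe : ∀ z' : Fin (2 ^ L) → E, ‖softGrad η h g (empirical Finset.univ z')‖ ≤ Lf := fun z' => by
    have := isProbabilityMeasure_empirical Finset.univ_nonempty z'
    exact H.norm_softGrad_le hη _
  have hbe' : ∀ z : E, ‖∫ z', softGrad η h g (empirical Finset.univ z')
      ∂(Measure.pi fun _ : Fin (2 ^ L) => ballMeasure ρ z)‖ ≤ Lf := fun z =>
    (norm_integral_le_of_norm_le_const (Eventually.of_forall hbe)).trans (by simp)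
  have hmr := H.measurable_softGrad_ball (η := η) hρ
  have hbr : ∀ z : E, ‖softGrad η h g (ballMeasure ρ z)‖ ≤ Lf := fun z => H.norm_softGrad_le hη _
  rw [hsum, ← integral_sub (integrable_of_measurable_bound hme hbe')
    (integrable_of_measurable_bound hmr hbr)]
  have hb2 : ∀ z : E, ‖∫ z', softGrad η h g (empirical Finset.univ z')
      ∂(Measure.pi fun _ : Fin (2 ^ L) => ballMeasure ρ z) - softGrad η h g (ballMeasure ρ z)‖
      ≤ 2 * Lf := fun z => (norm_sub_le _ _).trans (by linarith [hbe' z, hbr z])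
  refine (sq_norm_integral_le (hme.sub hmr) hb2).trans ?_
  have hpt : ∀ z : E, ‖∫ z', softGrad η h g (empirical Finset.univ z')
      ∂(Measure.pi fun _ : Fin (2 ^ L) => ballMeasure ρ z) - softGrad η h g (ballMeasure ρ z)‖ ^ 2
      ≤ varConst Lf B η * (1 / 2) ^ L := fun z => by
    have e : ∫ z', softGrad η h g (empirical Finset.univ z')
        ∂(Measure.pi fun _ : Fin (2 ^ L) => ballMeasure ρ z) - softGrad η h g (ballMeasure ρ z)
        = ∫ z', (softGrad η h g (empirical Finset.univ z') - softGrad η h g (ballMeasure ρ z))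
        ∂(Measure.pi fun _ : Fin (2 ^ L) => ballMeasure ρ z) := by
      rw [integral_sub (integrable_of_measurable_bound (H.measurable_softGrad_empirical _) hbe)
        (integrable_const _)]
      simp
    rw [e]
    refine (sq_norm_integral_le (R := 2 * Lf) ((H.measurable_softGrad_empirical _).sub_const _)
      fun z' => (norm_sub_le _ _).trans (by linarith [hbe z', hbr z])).trans ?_
    refine (H.integral_norm_sq_softGrad_sub_le hη (ballMeasure ρ z) Finset.univ_nonempty).trans
      (le_of_eq ?_)
    rw [Finset.card_univ, Fintype.card_fin, one_div, inv_pow]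
    push_cast
    rfl
  have := integral_mono_of_nonneg (μ := P) (Eventually.of_forall fun z => sq_nonneg _)
    (integrable_const (varConst Lf B η * (1 / 2) ^ L)) (Eventually.of_forall hpt)
  simpa using this

/-- Level `ℓ` contributes `1/p_ℓ ≤ 2 · 2^ℓ` times a second moment of at most `6 K 2^{-ℓ}`, with `K`
the `varConst`. This is at most `12 K` for each of the `L + 1` levels. -/
theorem LossPair.integral_norm_sq_drawDir_le (H : LossPair h g B Lf) (hη : 0 < η)
    (hLf : 0 ≤ Lf) (hB : 0 ≤ B) (hρ : 0 < ρ) (L : ℕ) :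
    ∫ b, ‖drawDir η h g b‖ ^ 2 ∂(drawLaw P ρ L) ≤ 12 * varConst Lf B η * (L + 1) := by
  have hprob := fun z : E => isProbabilityMeasure_ballMeasure hρ z
  have hK := varConst_nonneg Lf B η
  have e1 := integral_drawLaw P hρ L
    (Φ := fun ℓ z' => ‖(levelProb L ℓ)⁻¹ • levelDir η h g ℓ z'‖ ^ 2)
    (fun ℓ => ((H.measurable_levelDir ℓ).fun_const_smul _).norm.pow_const 2)
    (R := fun ℓ => ((levelProb L ℓ)⁻¹ * (2 * Lf)) ^ 2) (fun ℓ z' => by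
      rw [norm_pow, norm_norm, norm_smul, norm_inv, Real.norm_eq_abs,
        abs_of_pos (levelProb_pos L ℓ)]
      have := levelProb_pos L ℓ
      exact pow_le_pow_left₀ (by positivity) (mul_le_mul_of_nonneg_left
        (H.norm_levelDir_le hη hLf _ _) (inv_nonneg.2 this.le)) 2)
  refine e1.trans_le ?_
  have hterm : ∀ ℓ : Fin (L + 1), levelProb L ℓ • ∫ z, ∫ z',
      ‖(levelProb L ℓ)⁻¹ • levelDir η h g ℓ z'‖ ^ 2
      ∂(Measure.pi fun _ : Fin (2 ^ (ℓ : ℕ)) => ballMeasure ρ z) ∂P ≤ 12 * varConst Lf B η :=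
    fun ℓ => by
    have hp := levelProb_pos L ℓ
    have hn : ∀ z', ‖(levelProb L ℓ)⁻¹ • levelDir η h g ℓ z'‖ ^ 2
        = (levelProb L ℓ)⁻¹ ^ 2 * ‖levelDir η h g ℓ z'‖ ^ 2 := fun z' => by
      rw [norm_smul, mul_pow, norm_inv, Real.norm_eq_abs, abs_of_pos hp]
    simp only [hn, integral_const_mul, smul_eq_mul]
    have hle : ∫ z, ∫ z', ‖levelDir η h g ℓ z'‖ ^ 2
        ∂(Measure.pi fun _ : Fin (2 ^ (ℓ : ℕ)) => ballMeasure ρ z) ∂P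
        ≤ 6 * varConst Lf B η * (1 / 2) ^ (ℓ : ℕ) := by
      have := integral_mono_of_nonneg (μ := P)
        (f := fun z => ∫ z', ‖levelDir η h g ℓ z'‖ ^ 2
          ∂(Measure.pi fun _ : Fin (2 ^ (ℓ : ℕ)) => ballMeasure ρ z))
        (Eventually.of_forall fun z => integral_nonneg fun z' => sq_nonneg _)
        (integrable_const (6 * varConst Lf B η * (1 / 2) ^ (ℓ : ℕ)))
        (Eventually.of_forall fun z =>
          H.integral_norm_sq_levelDir_le hη hLf hB (ballMeasure ρ z) ℓ)
      simpa using this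
    rw [← mul_assoc, sq, ← mul_assoc, mul_inv_cancel₀ hp.ne', one_mul]
    have h2 := mul_le_mul (inv_levelProb_le L ℓ) hle (integral_nonneg fun z =>
      integral_nonneg fun z' => sq_nonneg _) (by positivity)
    refine h2.trans (le_of_eq ?_)
    rw [one_div, inv_pow]
    field_simp
    ring
  refine (Finset.sum_le_card_nsmul _ _ _ fun ℓ _ => hterm ℓ).trans (le_of_eq ?_)
  rw [Finset.card_univ, Fintype.card_fin, nsmul_eq_mul]
  push_cast
  ring

theorem isProbabilityMeasure_batchLaw (hρ : 0 < ρ) (L n : ℕ) :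
    IsProbabilityMeasure (batchLaw P ρ L n) := by
  have := isProbabilityMeasure_drawLaw P hρ L
  unfold batchLaw
  infer_instance

theorem LossPair.measurable_batchDir (H : LossPair h g B Lf) (L n : ℕ) :
    Measurable (batchDir (L := L) (n := n) η h g) := by
  have := H.measurable_drawDir (η := η) L
  unfold batchDir
  fun_prop

theorem LossPair.norm_batchDir_le (H : LossPair h g B Lf) (hη : 0 < η) (hLf : 0 ≤ Lf) {L n : ℕ}
    (hn : 0 < n) (b : Fin n → Draw L E) : ‖batchDir η h g b‖ ≤ 2 * 2 ^ L * (2 * Lf) := by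
  have hc : (0 : ℝ) < n := by exact_mod_cast hn
  rw [batchDir, norm_smul, norm_inv, Real.norm_natCast, inv_mul_le_iff₀ hc]
  refine (norm_sum_le _ _).trans ((Finset.sum_le_card_nsmul _ _ _ fun i _ =>
    H.norm_drawDir_le hη hLf L (b i)).trans ?_)
  rw [nsmul_eq_mul, Finset.card_univ, Fintype.card_fin]

theorem LossPair.integral_norm_sq_batchDir_sub_le (H : LossPair h g B Lf) (hη : 0 < η)
    (hLf : 0 ≤ Lf) (hB : 0 ≤ B) (hρ : 0 < ρ) (L : ℕ) {n : ℕ} (hn : 0 < n) (c : Param d) :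
    ∫ b, ‖batchDir η h g b - c‖ ^ 2 ∂(batchLaw P ρ L n)
      ≤ ‖∫ b, drawDir η h g b ∂(drawLaw P ρ L) - c‖ ^ 2
        + (n : ℝ)⁻¹ * (12 * varConst Lf B η * (L + 1)) := by
  have := isProbabilityMeasure_drawLaw P hρ L
  have : Nonempty (Fin n) := ⟨⟨0, hn⟩⟩
  have key := integral_norm_sq_mean_sub_le (μ := drawLaw P ρ L) (H.measurable_drawDir (η := η) L)
    (H.norm_drawDir_le hη hLf L) (s := (Finset.univ : Finset (Fin n))) Finset.univ_nonempty c
  rw [Finset.card_univ, Fintype.card_fin] at key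
  refine key.trans (add_le_add le_rfl (mul_le_mul_of_nonneg_left ?_ (by positivity)))
  exact H.integral_norm_sq_drawDir_le P hη hLf hB hρ L

theorem LossPair.integral_batchDir (H : LossPair h g B Lf) (hη : 0 < η)
    (hLf : 0 ≤ Lf) (hρ : 0 < ρ) (L : ℕ) {n : ℕ} (hn : 0 < n) :
    ∫ b, batchDir η h g b ∂(batchLaw P ρ L n) = ∫ b, drawDir η h g b ∂(drawLaw P ρ L) := by
  have := isProbabilityMeasure_drawLaw P hρ L
  have hm := H.measurable_drawDir (η := η) L
  have hc : (n : ℝ) ≠ 0 := by exact_mod_cast hn.ne'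
  simp only [batchDir, batchLaw]
  have hi : ∀ i : Fin n, Integrable (fun b : Fin n → Draw L E => drawDir η h g (b i))
      (Measure.pi fun _ => drawLaw P ρ L) := fun i => integrable_of_measurable_bound
    (hm.comp (measurable_pi_apply i)) fun b => H.norm_drawDir_le hη hLf L (b i)
  rw [integral_smul, integral_finsetSum _ fun i _ => hi i]
  simp only [integral_pi_eval hm.aestronglyMeasurable, Finset.sum_const, Finset.card_univ,
    Fintype.card_fin]
  rw [← Nat.cast_smul_eq_nsmul ℝ, smul_smul, inv_mul_cancel₀ hc, one_smul]

end Laws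

/-! ### Bounds and smoothness of the objective -/

section Objective

variable {E : Type*} [NormedAddCommGroup E] [NormedSpace ℝ E] [FiniteDimensional ℝ E]
  [MeasurableSpace E] [BorelSpace E] {ρ : ℝ} (P : Measure E) [IsProbabilityMeasure P]
  {d : ℕ} {Θ : Set (Param d)} {f : Param d → E → ℝ} {Lf Sf B η : ℝ}

/-- The gradient of the objective, for the loss `h` with the gradient `g`. -/
noncomputable def objGrad (ρ η : ℝ) (h : E → ℝ) (g : E → Param d) : Param d :=
  ∫ z, softGrad η h g (ballMeasure ρ z) ∂P

theorem objective_eq (hρ : 0 < ρ) (hη : 0 < η) (H : SmoothBoundedLoss Θ univ f Lf Sf B)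
    {θ : Param d} (hθ : θ ∈ Θ) :
    objective P ρ η f θ = ∫ z, softLoss η f (ballMeasure ρ z) θ ∂P :=
  integral_congr_ae (Eventually.of_forall fun z =>
    robustLoss_eq hρ hη (H.measurable θ hθ) (fun w => H.bounded w trivial θ hθ) z)

theorem integrable_softLoss_ball (hρ : 0 < ρ) (hη : 0 < η)
    (H : SmoothBoundedLoss Θ univ f Lf Sf B) {θ : Param d} (hθ : θ ∈ Θ) :
    Integrable (fun z => softLoss η f (ballMeasure ρ z) θ) P := by
  have := isMarkovKernel_ballKernel (E := E) hρ
  have := fun z : E => isProbabilityMeasure_ballMeasure hρ z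
  have hm := H.measurable θ hθ
  have m1 : Measurable fun w => Real.exp (f θ w / η) := by fun_prop
  have m2 := ((m1.stronglyMeasurable.integral_kernel (κ := ballKernel ρ)).measurable.log).const_mul η
  refine integrable_of_measurable_bound (R := B) m2 fun z => ?_
  have := softLoss_mem (Q := ballMeasure ρ z) hη hm fun w => H.bounded w trivial θ hθ
  rw [Real.norm_eq_abs]
  exact (abs_of_nonneg this.1).trans_le this.2

theorem objective_mem (hρ : 0 < ρ) (hη : 0 < η) (H : SmoothBoundedLoss Θ univ f Lf Sf B)
    {θ : Param d} (hθ : θ ∈ Θ) : 0 ≤ objective P ρ η f θ ∧ objective P ρ η f θ ≤ B := by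
  have := fun z : E => isProbabilityMeasure_ballMeasure hρ z
  have hb := fun z => softLoss_mem (Q := ballMeasure ρ z) hη (H.measurable θ hθ)
    fun w => H.bounded w trivial θ hθ
  rw [objective_eq P hρ hη H hθ]
  refine ⟨integral_nonneg fun z => (hb z).1, ?_⟩
  have := integral_mono (integrable_softLoss_ball P hρ hη H hθ) (integrable_const B)
    fun z => (hb z).2
  simpa using this

theorem objective_quadApprox (hρ : 0 < ρ) (hη : 0 < η) (H : SmoothBoundedLoss Θ univ f Lf Sf B)
    {θ : Param d} (hθ : θ ∈ Θ) {g : E → Param d} (hg : GradSelection Θ f Lf Sf θ g) :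
    QuadApprox Θ (objective P ρ η f) θ (objGrad P ρ η (f θ) g) (smoothConst Lf Sf B η) := by
  have := fun z : E => isProbabilityMeasure_ballMeasure hρ z
  have hp := H.lossPair hθ hg
  have q := QuadApprox.integral (Q := P) hθ
    (h := fun ϑ z => softLoss η f (ballMeasure ρ z) ϑ)
    (fun ϑ h => integrable_softLoss_ball P hρ hη H h)
    (integrable_of_measurable_bound (hp.measurable_softGrad_ball (η := η) hρ)
      fun z => hp.norm_softGrad_le hη _)
    fun z => softLoss_quadApprox hη H hθ hg
  intro θ' hθ'
  rw [objective_eq P hρ hη H hθ, objective_eq P hρ hη H hθ']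
  exact q θ' hθ'

end Objective

/-! ### Summing the descent inequality over a run -/

section Recursion

variable {d : ℕ} {E : Type*}

/-- One step of the algorithm. -/
noncomputable def sgdStep (Θ : Set (Param d)) (η : ℝ) (f : Param d → E → ℝ) (τ : ℝ) {L n : ℕ}
    (θ : Param d) (b : Fin n → Draw L E) : Param d :=
  proj Θ (θ - τ • rtmlmc Θ η f b θ)

/-- Peeling off the first batch instead of the last makes the remaining run independent of the new
initial point, so no conditional expectations are needed. -/
theorem iterate_succ_eq (Θ : Set (Param d)) (η : ℝ) (f : Param d → E → ℝ) (τ : ℝ) (θ : Param d)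
    {L n N : ℕ} (ω : Fin (N + 1) → Fin n → Draw L E) (t : ℕ) :
    iterate Θ η f τ θ ω (t + 1)
      = iterate Θ η f τ (sgdStep Θ η f τ θ (ω 0)) (fun i : Fin N => ω i.succ) t := by
  induction t with
  | zero => simp [iterate, sgdStep]
  | succ t ih =>
    rw [iterate, ih, iterate]
    by_cases h : t < N
    · rw [dif_pos (Nat.succ_lt_succ h), dif_pos h]
      rfl
    · rw [dif_neg (fun h' => h (Nat.lt_of_succ_lt_succ h')), dif_neg h]

theorem sum_lintegral_le_lintegral_sum {α ι : Type*} [MeasurableSpace α] (μ : Measure α)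
    (s : Finset ι) (F : ι → α → ℝ≥0∞) :
    ∑ i ∈ s, ∫⁻ a, F i a ∂μ ≤ ∫⁻ a, ∑ i ∈ s, F i a ∂μ := by
  classical
  induction s using Finset.induction_on with
  | empty => simp
  | insert i s hi ih =>
    simp only [Finset.sum_insert hi]
    exact (add_le_add le_rfl ih).trans (le_lintegral_add _ _)

/-- One half of Tonelli's theorem, valid for functions that need not be measurable; the iterates are
not known to be. -/
theorem lintegral_pi_succ_le {α : Type*} [MeasurableSpace α] (μ : Measure α)
    [IsProbabilityMeasure μ] (N : ℕ) (F : (Fin (N + 1) → α) → ℝ≥0∞) (G : α → (Fin N → α) → ℝ≥0∞)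
    (hFG : ∀ ω, F ω = G (ω 0) fun i => ω i.succ) :
    ∫⁻ ω, F ω ∂(Measure.pi fun _ => μ) ≤ ∫⁻ a, ∫⁻ ω, G a ω ∂(Measure.pi fun _ => μ) ∂μ := by
  have h := measurePreserving_piFinSuccAbove (fun _ : Fin (N + 1) => μ) 0
  have e : ∫⁻ ω, F ω ∂(Measure.pi fun _ => μ)
      = ∫⁻ p : α × (Fin N → α), G p.1 p.2 ∂(μ.prod (Measure.pi fun _ => μ)) := by
    rw [← h.map_eq, lintegral_map_equiv]
    refine lintegral_congr fun ω => ?_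
    rw [hFG]
    rfl
  rw [e]
  exact lintegral_prod_le _

variable [MeasurableSpace E]

/-- Telescoping of the potential `Φ`, by induction on the number of batches for all initial points
at once. There are `N + 1` iterates but only `N` steps: `hstep` pays for all iterates except the
last, which `hbase` covers. -/
theorem sum_lintegral_iterate_le {Θ : Set (Param d)} (hcl : IsClosed Θ) {η : ℝ}
    {f : Param d → E → ℝ} {τ : ℝ} {L n : ℕ} (μ : Measure (Fin n → Draw L E))
    [IsProbabilityMeasure μ] {Φ D : Param d → ℝ≥0∞} {c : ℝ≥0∞}
    (hstep : ∀ θ ∈ Θ, ∫⁻ b, Φ (sgdStep Θ η f τ θ b) ∂μ + D θ ≤ Φ θ + c)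
    (hbase : ∀ θ ∈ Θ, D θ ≤ Φ θ) (N : ℕ) {θ : Param d} (hθ : θ ∈ Θ) :
    ∑ t ∈ Finset.range (N + 1), ∫⁻ ω : Fin N → Fin n → Draw L E, D (iterate Θ η f τ θ ω t)
      ∂(Measure.pi fun _ => μ) ≤ Φ θ + N * c := by
  induction N generalizing θ with
  | zero => simpa [iterate] using hbase θ hθ
  | succ N ih =>
    rw [Finset.sum_range_succ']
    have h0 : ∫⁻ ω : Fin (N + 1) → Fin n → Draw L E, D (iterate Θ η f τ θ ω 0)
        ∂(Measure.pi fun _ => μ) = D θ := by simp [iterate]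
    have h1 : ∀ t, ∫⁻ ω : Fin (N + 1) → Fin n → Draw L E, D (iterate Θ η f τ θ ω (t + 1))
        ∂(Measure.pi fun _ => μ) ≤ ∫⁻ b, ∫⁻ ω : Fin N → Fin n → Draw L E,
          D (iterate Θ η f τ (sgdStep Θ η f τ θ b) ω t) ∂(Measure.pi fun _ => μ) ∂μ := fun t =>
      lintegral_pi_succ_le μ N _ (fun b ω => D (iterate Θ η f τ (sgdStep Θ η f τ θ b) ω t))
        fun ω => by rw [iterate_succ_eq]
    rw [h0]
    calc _ ≤ ∑ t ∈ Finset.range (N + 1), ∫⁻ b, ∫⁻ ω : Fin N → Fin n → Draw L E,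
          D (iterate Θ η f τ (sgdStep Θ η f τ θ b) ω t) ∂(Measure.pi fun _ => μ) ∂μ + D θ :=
          add_le_add (Finset.sum_le_sum fun t _ => h1 t) le_rfl
      _ ≤ ∫⁻ b, (Φ (sgdStep Θ η f τ θ b) + N * c) ∂μ + D θ := by
          refine add_le_add ((sum_lintegral_le_lintegral_sum μ _ _).trans
            (lintegral_mono fun b => ih ?_)) le_rfl
          exact (proj_spec ⟨θ, hθ⟩ hcl _).1
      _ = ∫⁻ b, Φ (sgdStep Θ η f τ θ b) ∂μ + D θ + N * c := by
          rw [lintegral_add_right _ measurable_const, lintegral_const, measure_univ, mul_one]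
          ring
      _ ≤ Φ θ + c + N * c := add_le_add (hstep θ hθ) le_rfl
      _ = Φ θ + (N + 1 : ℕ) * c := by push_cast; ring

/-- A pointwise bound of the potential after one step gives the bound in expectation. -/
theorem lintegral_ofReal_add_le {α : Type*} [MeasurableSpace α] {μ : Measure α}
    [IsProbabilityMeasure μ] {φ Q : α → ℝ} {D a c : ℝ} (hQ : Integrable Q μ) (hφ : ∀ b, 0 ≤ φ b)
    (hD : 0 ≤ D) (ha : 0 ≤ a) (hc : 0 ≤ c) (h : ∀ b, φ b + D ≤ Q b) (hi : ∫ b, Q b ∂μ ≤ a + c) :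
    ∫⁻ b, ENNReal.ofReal (φ b) ∂μ + ENNReal.ofReal D ≤ ENNReal.ofReal a + ENNReal.ofReal c := by
  rw [← ENNReal.ofReal_add ha hc]
  calc _ = ∫⁻ b, (ENNReal.ofReal (φ b) + ENNReal.ofReal D) ∂μ := by
        rw [lintegral_add_right _ measurable_const, lintegral_const, measure_univ, mul_one]
    _ ≤ ∫⁻ b, ENNReal.ofReal (Q b) ∂μ := lintegral_mono fun b => by
        rw [← ENNReal.ofReal_add (hφ b) hD]
        exact ENNReal.ofReal_le_ofReal (h b)
    _ = ENNReal.ofReal (∫ b, Q b ∂μ) := (ofReal_integral_eq_lintegral_ofReal hQ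
        (Eventually.of_forall fun b => (add_nonneg (hφ b) hD).trans (h b))).symm
    _ ≤ _ := ENNReal.ofReal_le_ofReal hi

theorem lintegral_uniformOn_univ {T : ℕ} (G : Fin T → ℝ≥0∞) :
    ∫⁻ t, G t ∂(uniformOn (univ : Set (Fin T))) = (T : ℝ≥0∞)⁻¹ * ∑ t, G t := by
  rw [uniformOn, ProbabilityTheory.cond, Measure.restrict_univ, lintegral_smul_measure, lintegral_count,
    tsum_fintype, Measure.count_univ]
  simp

end Recursion

/-! ### Stationarity of the output in both regimes -/

section Stationary

variable {E : Type*} [NormedAddCommGroup E] [NormedSpace ℝ E] [FiniteDimensional ℝ E]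
  [MeasurableSpace E] [BorelSpace E] {ρ : ℝ} (P : Measure E) [IsProbabilityMeasure P]
  {d : ℕ} {Θ : Set (Param d)} {f : Param d → E → ℝ} {Lf Sf B η τ : ℝ}

/-- The uniform index turns the summed bound into an average. The initial potential is at most `A *
B`, so it contributes `A * B / T`, and each step adds at most `c`. -/
theorem isStationary_output (hρ : 0 < ρ) (hcl : IsClosed Θ) {F : Param d → ℝ} {c ε A : ℝ}
    {L n T : ℕ} (hT : 0 < T) (hA : 0 < A) (hc : 0 ≤ c)
    (hF : ∀ θ ∈ Θ, 0 ≤ F θ ∧ F θ ≤ B)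
    (hstep : ∀ θ ∈ Θ, ∫⁻ b, ENNReal.ofReal (A * F (sgdStep Θ η f τ θ b)) ∂(batchLaw P ρ L n)
      + ENNReal.ofReal (mapSq Θ F τ θ) ≤ ENNReal.ofReal (A * F θ) + ENNReal.ofReal c)
    (hbase : ∀ θ ∈ Θ, mapSq Θ F τ θ ≤ A * F θ) (hε : A * B / T + c ≤ ε ^ 2)
    {θ₁ : Param d} (hθ₁ : θ₁ ∈ Θ) :
    IsStationary (outputLaw P ρ L n T) (output Θ η f τ θ₁) Θ F τ ε := by
  have := isProbabilityMeasure_batchLaw P hρ L n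
  obtain ⟨N, rfl⟩ : ∃ N, T = N + 1 := ⟨T - 1, by omega⟩
  have key := sum_lintegral_iterate_le hcl (batchLaw P ρ L n)
    (Φ := fun θ => ENNReal.ofReal (A * F θ)) (D := fun θ => ENNReal.ofReal (mapSq Θ F τ θ)) hstep
    (fun θ hθ => ENNReal.ofReal_le_ofReal (hbase θ hθ)) N hθ₁
  have hsq : ∀ x : Param d, ‖τ⁻¹ • (x - proj Θ (x - τ • gradientWithin F Θ x))‖ₑ ^ 2
      = ENNReal.ofReal (mapSq Θ F τ x) := fun x => by
    rw [mapSq, ENNReal.ofReal_pow (norm_nonneg _), ofReal_norm]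
  unfold IsStationary outputLaw
  simp only [hsq]
  refine (lintegral_prod_le _).trans ?_
  rw [lintegral_uniformOn_univ]
  have hT0 : ((N + 1 : ℕ) : ℝ≥0∞) ≠ 0 := by simp
  rw [ENNReal.inv_mul_le_iff hT0 (ENNReal.natCast_ne_top _)]
  rw [← Fin.sum_univ_eq_sum_range (fun t => ∫⁻ ω : Fin N → Fin n → Draw L E,
    ENNReal.ofReal (mapSq Θ F τ (iterate Θ η f τ θ₁ ω t)) ∂(Measure.pi fun _ =>
      batchLaw P ρ L n))] at key
  refine key.trans ?_
  rw [← ENNReal.ofReal_natCast, ← ENNReal.ofReal_natCast, ← ENNReal.ofReal_mul (by positivity),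
    ← ENNReal.ofReal_mul (by positivity),
    ← ENNReal.ofReal_add (mul_nonneg hA.le (hF θ₁ hθ₁).1) (by positivity)]
  refine ENNReal.ofReal_le_ofReal ?_
  have h1 := mul_le_mul_of_nonneg_left hε (show (0 : ℝ) ≤ (N + 1 : ℕ) by positivity)
  rw [mul_add, mul_div_cancel₀ _ (by positivity)] at h1
  have h2 := mul_le_mul_of_nonneg_left (hF θ₁ hθ₁).2 hA.le
  push_cast at h1 ⊢
  nlinarith

theorem exists_gradSelection (hΘ : Convex ℝ Θ) (hLf : 0 ≤ Lf) (hSf : 0 ≤ Sf)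
    (H : SmoothBoundedLoss Θ univ f Lf Sf B) {θ : Param d} (hθ : θ ∈ Θ) :
    ∃ g, GradSelection Θ f Lf Sf θ g := by
  obtain ⟨g, h1, h2, h3⟩ := H.exists_gradient hΘ hLf hSf hθ
  exact ⟨g, h1, h2, h3⟩

theorem differentiableOn_objective (hρ : 0 < ρ) (hη : 0 < η) (hΘ : Convex ℝ Θ) (hLf : 0 ≤ Lf)
    (hSf : 0 ≤ Sf) (H : SmoothBoundedLoss Θ univ f Lf Sf B) :
    DifferentiableOn ℝ (objective P ρ η f) Θ := fun θ hθ => by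
  obtain ⟨g, hg⟩ := exists_gradSelection hΘ hLf hSf H hθ
  exact (objective_quadApprox P hρ hη H hθ hg).hasGradientWithinAt.differentiableWithinAt

/-- Large mini-batches and a constant step size. -/
theorem isStationary_constrained (hρ : 0 < ρ) (hη : 0 < η) (hcl : IsClosed Θ) (hΘ : Convex ℝ Θ)
    (hLf : 0 ≤ Lf) (hSf : 0 ≤ Sf) (hB : 0 ≤ B) (H : SmoothBoundedLoss Θ univ f Lf Sf B)
    (hτ : 0 < τ) (hS : smoothConst Lf Sf B η * (4 * τ) ≤ 1) {L n T : ℕ} (hT : 0 < T) (hn : 0 < n)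
    {ε : ℝ} (hε : 8 / τ * B / T + 6 * (varConst Lf B η * (1 / 2) ^ L
      + (n : ℝ)⁻¹ * (12 * varConst Lf B η * (L + 1))) ≤ ε ^ 2) {θ₁ : Param d} (hθ₁ : θ₁ ∈ Θ) :
    IsStationary (outputLaw P ρ L n T) (output Θ η f τ θ₁) Θ (objective P ρ η f) τ ε := by
  have := isProbabilityMeasure_batchLaw P hρ L n
  have hK := varConst_nonneg Lf B η
  have hF := fun θ hθ => objective_mem P hρ hη H (θ := θ) hθ
  refine isStationary_output P hρ hcl hT (A := 8 / τ) (by positivity) (by positivity) hF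
    (fun θ hθ => ?_) (fun θ hθ => ?_) hε hθ₁
  · obtain ⟨g, hg⟩ := exists_gradSelection hΘ hLf hSf H hθ
    have hq := objective_quadApprox P hρ hη H hθ hg
    have hp := H.lossPair hθ hg
    set G := objGrad P ρ η (f θ) g with hG
    have hi : Integrable (fun b : Fin n → Draw L E => ‖batchDir η (f θ) g b - G‖ ^ 2)
        (batchLaw P ρ L n) := by
      refine integrable_of_measurable_bound (R := (2 * 2 ^ L * (2 * Lf) + ‖G‖) ^ 2)
        (((hp.measurable_batchDir L n).sub_const G).norm.pow_const 2) fun b => ?_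
      rw [norm_pow, norm_norm]
      exact pow_le_pow_left₀ (norm_nonneg _) ((norm_sub_le _ _).trans
        (add_le_add (hp.norm_batchDir_le hη hLf hn b) le_rfl)) 2
    refine lintegral_ofReal_add_le
      (Q := fun b => 8 / τ * objective P ρ η f θ + 6 * ‖batchDir η (f θ) g b - G‖ ^ 2)
      ((integrable_const _).add (hi.const_mul 6)) (fun b => ?_) (mapSq_nonneg _ _ _ _)
      (mul_nonneg (by positivity) (hF θ hθ).1) (by positivity) (fun b => ?_) ?_
    · exact mul_nonneg (by positivity) (hF _ (proj_spec ⟨θ, hθ⟩ hcl _).1).1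
    · exact descent_step hcl hΘ hθ hτ hS hq fun x hx y hy => inner_rtmlmc hΘ hη H hθ hg b hx hy
    · rw [integral_add (integrable_const _) (hi.const_mul 6), integral_const_mul 6]
      simp only [integral_const, probReal_univ, smul_eq_mul, one_mul]
      -- The mean square error about the exact gradient splits into squared bias and variance; only
      -- the variance is divided by `n`.
      have h1 := hp.integral_norm_sq_batchDir_sub_le P hη hLf hB hρ L hn G
      have h2 := hp.norm_sq_integral_drawDir_sub_le P hη hLf hρ L
      rw [← objGrad, ← hG] at h2
      linarith
  · obtain ⟨g, hg⟩ := exists_gradSelection hΘ hLf hSf H hθ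
    exact mapSq_le hcl hΘ hθ hτ hS (objective_quadApprox P hρ hη H hθ hg) fun θ hθ => (hF θ hθ).1

/-- Small mini-batches and a small step size, without constraints. -/
theorem isStationary_unconstrained (hρ : 0 < ρ) (hη : 0 < η)
    (hLf : 0 ≤ Lf) (hSf : 0 ≤ Sf) (hB : 0 ≤ B) (H : SmoothBoundedLoss univ univ f Lf Sf B)
    (hτ : 0 < τ) (hS0 : 0 ≤ smoothConst Lf Sf B η) (hS : smoothConst Lf Sf B η * (4 * τ) ≤ 1)
    {L n T : ℕ} (hT : 0 < T) (hn : 0 < n)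
    {ε : ℝ} (hε : 8 / τ * B / T + (4 * (varConst Lf B η * (1 / 2) ^ L)
      + 8 * (smoothConst Lf Sf B η * τ) * (24 * varConst Lf B η * (L + 1))) ≤ ε ^ 2)
    (θ₁ : Param d) :
    IsStationary (outputLaw P ρ L n T) (output univ η f τ θ₁) univ (objective P ρ η f) τ ε := by
  have := isProbabilityMeasure_batchLaw P hρ L n
  have := isProbabilityMeasure_drawLaw P hρ L
  have hK := varConst_nonneg Lf B η
  have hF := fun θ (hθ : θ ∈ univ) => objective_mem P hρ hη H (θ := θ) hθ
  refine isStationary_output P hρ isClosed_univ hT (A := 8 / τ) (by positivity) (by positivity)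
    hF (fun θ hθ => ?_) (fun θ hθ => ?_) hε (mem_univ θ₁)
  · obtain ⟨g, hg⟩ := exists_gradSelection convex_univ hLf hSf H hθ
    have hq := objective_quadApprox P hρ hη H hθ hg
    have hp := H.lossPair hθ hg
    set G := objGrad P ρ η (f θ) g with hG
    set S := smoothConst Lf Sf B η with hSd
    set m := ∫ b, drawDir η (f θ) g b ∂(drawLaw P ρ L) with hm
    have hbm := hp.measurable_batchDir (η := η) L n
    have hbb := hp.norm_batchDir_le (L := L) hη hLf hn
    have hi1 : Integrable (fun b : Fin n → Draw L E => batchDir η (f θ) g b)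
        (batchLaw P ρ L n) := integrable_of_measurable_bound hbm hbb
    have hi2 : Integrable (fun b : Fin n → Draw L E => ‖batchDir η (f θ) g b‖ ^ 2)
        (batchLaw P ρ L n) := by
      refine integrable_of_measurable_bound (R := (2 * 2 ^ L * (2 * Lf)) ^ 2)
        (hbm.norm.pow_const 2) fun b => ?_
      rw [norm_pow, norm_norm]
      exact pow_le_pow_left₀ (norm_nonneg _) (hbb b) 2
    have hi3 := (hi1.const_inner (𝕜 := ℝ) G).const_mul (8 : ℝ)
    have hi4 := hi2.const_mul (8 * (S * τ))
    have hi5 : Integrable (fun b : Fin n → Draw L E => 8 / τ * objective P ρ η f θ + 4 * ‖G‖ ^ 2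
        - 8 * ⟪G, batchDir η (f θ) g b⟫) (batchLaw P ρ L n) := (integrable_const _).sub hi3
    rw [mapSq_univ hτ hq]
    -- The term `4 ‖G‖²` exceeds the required `‖G‖²` in order to complete the square: in expectation
    -- `4 ‖G‖² - 8 ⟪G, m⟫` is at most four times the squared bias `‖m - G‖²`.
    refine lintegral_ofReal_add_le
      (Q := fun b => 8 / τ * objective P ρ η f θ + 4 * ‖G‖ ^ 2 - 8 * ⟪G, batchDir η (f θ) g b⟫
        + 8 * (S * τ) * ‖batchDir η (f θ) g b‖ ^ 2)
      (hi5.add hi4) (fun b => ?_) (sq_nonneg _)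
      (mul_nonneg (by positivity) (hF θ hθ).1) (by positivity) (fun b => ?_) ?_
    · exact mul_nonneg (by positivity) (hF _ (mem_univ _)).1
    · have h1 := descent_step_univ (τ := τ) hq fun x hx y hy =>
        inner_rtmlmc convex_univ hη H hθ hg b hx hy
      have h2 := mul_le_mul_of_nonneg_left h1 (show 0 ≤ 8 / τ by positivity)
      have e : 8 / τ * (objective P ρ η f θ - τ * ⟪G, batchDir η (f θ) g b⟫
          + S * τ ^ 2 * ‖batchDir η (f θ) g b‖ ^ 2) = 8 / τ * objective P ρ η f θ
          - 8 * ⟪G, batchDir η (f θ) g b⟫ + 8 * (S * τ) * ‖batchDir η (f θ) g b‖ ^ 2 := by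
        field_simp
      rw [e] at h2
      unfold sgdStep
      nlinarith [sq_nonneg ‖G‖]
    · rw [integral_add hi5 hi4, integral_sub (integrable_const _) hi3, integral_const_mul 8,
        integral_const_mul (8 * (S * τ)), integral_inner hi1, hp.integral_batchDir P hη hLf hρ L hn, ← hm]
      simp only [integral_const, probReal_univ, smul_eq_mul, one_mul]
      have h1 := hp.integral_norm_sq_batchDir_sub_le P hη hLf hB hρ L hn 0
      have h2 := hp.norm_sq_integral_drawDir_sub_le P hη hLf hρ L
      have h3 := hp.integral_norm_sq_drawDir_le P hη hLf hB hρ L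
      -- The second moment of a batch is bounded by `‖m‖²` plus a variance term. Both are at most
      -- the second moment of one draw, hence the factor 24.
      have h4 := sq_norm_integral_le (μ := drawLaw P ρ L) (hp.measurable_drawDir (η := η) L)
        (hp.norm_drawDir_le hη hLf L)
      rw [← objGrad, ← hG, ← hm] at h2
      simp only [sub_zero] at h1
      rw [← hm] at h1 h4
      have h5 : ‖m - G‖ ^ 2 = ‖m‖ ^ 2 - 2 * ⟪G, m⟫ + ‖G‖ ^ 2 := by
        rw [norm_sub_sq_real, real_inner_comm]
      have h6 : (n : ℝ)⁻¹ * (12 * varConst Lf B η * (L + 1)) ≤ 12 * varConst Lf B η * (L + 1) :=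
        mul_le_of_le_one_left (by positivity) (inv_le_one_of_one_le₀ (by exact_mod_cast hn))
      have h7 : ∫ b, ‖batchDir η (f θ) g b‖ ^ 2 ∂(batchLaw P ρ L n)
          ≤ 24 * varConst Lf B η * (L + 1) := by linarith
      have h8 := mul_le_mul_of_nonneg_left h7 (show 0 ≤ 8 * (S * τ) by positivity)
      nlinarith [sq_nonneg ‖m‖]
  · obtain ⟨g, hg⟩ := exists_gradSelection convex_univ hLf hSf H hθ
    exact mapSq_le isClosed_univ convex_univ hθ hτ hS (objective_quadApprox P hρ hη H hθ hg)
      fun θ hθ => (hF θ hθ).1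

end Stationary

/-! ### Expected sampling costs -/

section CostBounds

variable {E : Type*} [NormedAddCommGroup E] [NormedSpace ℝ E] [FiniteDimensional ℝ E]
  [MeasurableSpace E] [BorelSpace E] {ρ : ℝ} (P : Measure E) [IsProbabilityMeasure P]

theorem lintegral_pi_sum_eval {α : Type*} [MeasurableSpace α] (μ : Measure α)
    [IsProbabilityMeasure μ] {n : ℕ} {c : α → ℝ≥0∞} (hc : Measurable c) :
    ∫⁻ x, ∑ i, c (x i) ∂(Measure.pi fun _ : Fin n => μ) = n * ∫⁻ a, c a ∂μ := by
  have hci : ∀ i : Fin n, Measurable fun x : Fin n → α => c (x i) := fun i =>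
    hc.comp (measurable_pi_apply i)
  rw [lintegral_finsetSum _ fun i _ => hci i]
  have : ∀ i : Fin n, ∫⁻ x, c (x i) ∂(Measure.pi fun _ : Fin n => μ) = ∫⁻ a, c a ∂μ := fun i =>
    (measurePreserving_eval (fun _ : Fin n => μ) i).lintegral_comp hc
  simp [this]

theorem measurable_drawCost (L : ℕ) :
    Measurable fun b : Draw L E => ((1 + 2 ^ (b.1 : ℕ) : ℕ) : ℝ≥0∞) :=
  measurable_sigma fun ℓ => measurable_const (a := ((1 + 2 ^ (ℓ : ℕ) : ℕ) : ℝ≥0∞))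

/-- The point `z` costs 1, and level `ℓ` costs `p_ℓ 2^ℓ ≤ 1` in expectation. -/
theorem lintegral_drawCost_le (hρ : 0 < ρ) (L : ℕ) :
    ∫⁻ b : Draw L E, ((1 + 2 ^ (b.1 : ℕ) : ℕ) : ℝ≥0∞) ∂(drawLaw P ρ L)
      ≤ ENNReal.ofReal (L + 2) := by
  have hterm : ∀ ℓ : Fin (L + 1), ∫⁻ b : Draw L E, ((1 + 2 ^ (b.1 : ℕ) : ℕ) : ℝ≥0∞)
      ∂(ENNReal.ofReal (levelProb L ℓ) • (zetaLaw P ρ (ℓ : ℕ)).map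
        (Sigma.mk (β := fun m : Fin (L + 1) => E × (Fin (2 ^ (m : ℕ)) → E)) ℓ))
      = ENNReal.ofReal (levelProb L ℓ * (1 + 2 ^ (ℓ : ℕ))) := fun ℓ => by
    have := isProbabilityMeasure_zetaLaw P hρ (ℓ : ℕ)
    rw [lintegral_smul_measure, lintegral_map (measurable_drawCost L) (measurable_sigma_mk ℓ)]
    have hconst : ∫⁻ _ : E × (Fin (2 ^ (ℓ : ℕ)) → E), ((1 + 2 ^ (ℓ : ℕ) : ℕ) : ℝ≥0∞)
        ∂(zetaLaw P ρ (ℓ : ℕ)) = ((1 + 2 ^ (ℓ : ℕ) : ℕ) : ℝ≥0∞) := by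
      rw [lintegral_const, measure_univ, mul_one]
    refine (congrArg _ hconst).trans ?_
    rw [ smul_eq_mul, ENNReal.ofReal_mul (levelProb_pos L ℓ).le,
      ← ENNReal.ofReal_natCast]
    push_cast
    rfl
  rw [drawLaw, lintegral_finsetSum_measure]
  simp only [hterm]
  rw [← ENNReal.ofReal_sum_of_nonneg fun ℓ _ =>
    mul_nonneg (levelProb_pos L _).le (by positivity)]
  refine ENNReal.ofReal_le_ofReal ?_
  simp only [mul_add, mul_one, Finset.sum_add_distrib, sum_levelProb]
  have h1 : ∀ ℓ : Fin (L + 1), levelProb L ℓ * 2 ^ (ℓ : ℕ) ≤ 1 := fun ℓ => by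
    refine (mul_le_mul_of_nonneg_right (levelProb_le L ℓ) (by positivity)).trans (le_of_eq ?_)
    rw [← mul_pow]; norm_num
  have h2 := Finset.sum_le_card_nsmul Finset.univ
    (fun ℓ : Fin (L + 1) => levelProb L ℓ * 2 ^ (ℓ : ℕ)) 1 fun ℓ _ => h1 ℓ
  rw [Finset.card_univ, Fintype.card_fin, nsmul_eq_mul, mul_one] at h2
  push_cast at h2
  linarith

theorem measurable_batchCost (L n : ℕ) :
    Measurable fun b : Fin n → Draw L E => (batchCost b : ℝ≥0∞) := by
  simp only [batchCost, Nat.cast_sum]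
  exact Finset.measurable_sum _ fun i _ => (measurable_drawCost L).comp (measurable_pi_apply i)

theorem memoryCost_le (hρ : 0 < ρ) (L n : ℕ) :
    memoryCost P ρ L n ≤ ENNReal.ofReal (n * (L + 2)) := by
  have := isProbabilityMeasure_drawLaw P hρ L
  simp only [memoryCost, batchCost, batchLaw, Nat.cast_sum]
  rw [lintegral_pi_sum_eval _ (measurable_drawCost L), ENNReal.ofReal_mul (by positivity),
    ENNReal.ofReal_natCast]
  exact mul_le_mul_right (lintegral_drawCost_le P hρ L) _

theorem computationalCost_le (hρ : 0 < ρ) (L n T : ℕ) :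
    computationalCost P ρ L n T ≤ ENNReal.ofReal (T * (n * (L + 2))) := by
  have := isProbabilityMeasure_batchLaw P hρ L n
  simp only [computationalCost, runLaw, Nat.cast_sum]
  rw [lintegral_pi_sum_eval _ (measurable_batchCost L n), ENNReal.ofReal_mul (by positivity),
    ENNReal.ofReal_natCast]
  exact mul_le_mul' (by exact_mod_cast Nat.sub_le T 1) (memoryCost_le P hρ L n)

end CostBounds

/-! ### Reduction to losses whose bounds hold on the whole data space -/

section Extension

variable {E : Type*} [NormedAddCommGroup E] [NormedSpace ℝ E] [FiniteDimensional ℝ E]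
  [MeasurableSpace E] [BorelSpace E] {ρ : ℝ} (P : Measure E) [IsProbabilityMeasure P]
  {d : ℕ} {Θ : Set (Param d)} {𝒵 : Set E} {f : Param d → E → ℝ} {Lf Sf B η τ : ℝ}

/-- The extension of a loss on `𝒵` by zero. -/
noncomputable def extendLoss (𝒵 : Set E) (f : Param d → E → ℝ) (θ : Param d) : E → ℝ :=
  𝒵.indicator (f θ)

/-- Outside `𝒵` the extension vanishes for every parameter, so nonnegativity of the constants is all
that has to be added. -/
theorem SmoothBoundedLoss.extendLoss (h𝒵 : MeasurableSet 𝒵) (hLf : 0 ≤ Lf) (hSf : 0 ≤ Sf)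
    (hB : 0 ≤ B) (H : SmoothBoundedLoss Θ 𝒵 f Lf Sf B) :
    SmoothBoundedLoss Θ univ (extendLoss 𝒵 f) Lf Sf B where
  measurable θ hθ := (H.measurable θ hθ).indicator h𝒵
  lipschitz z _ θ₁ h₁ θ₂ h₂ := by
    by_cases hz : z ∈ 𝒵
    · simpa [EntropicSGD.extendLoss, hz] using H.lipschitz z hz θ₁ h₁ θ₂ h₂
    · simpa [EntropicSGD.extendLoss, hz] using mul_nonneg hLf (norm_nonneg (θ₁ - θ₂))
  bounded z _ θ hθ := by
    by_cases hz : z ∈ 𝒵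
    · simpa [EntropicSGD.extendLoss, hz] using H.bounded z hz θ hθ
    · simpa [EntropicSGD.extendLoss, hz] using hB
  smooth z _ := by
    by_cases hz : z ∈ 𝒵
    · simpa [EntropicSGD.extendLoss, hz] using H.smooth z hz
    · refine ⟨fun _ => 0, fun θ _ => ?_, fun θ₁ _ θ₂ _ => ?_⟩
      · simp only [EntropicSGD.extendLoss, indicator_of_notMem hz]
        rw [hasGradientWithinAt_iff_hasFDerivWithinAt, map_zero]
        exact hasFDerivWithinAt_const _ _ _
      · simpa using mul_nonneg hSf (norm_nonneg (θ₁ - θ₂))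

theorem objective_extendLoss (hball : ∀ᵐ z ∂P, Metric.closedBall z ρ ⊆ 𝒵) :
    objective P ρ η (extendLoss 𝒵 f) = objective P ρ η f := by
  funext θ
  refine integral_congr_ae ?_
  filter_upwards [hball] with z hz
  exact robustLoss_congr fun w hw => indicator_of_mem (hz hw) _

theorem ae_drawLaw_mem (hρ : 0 < ρ) (h𝒵 : MeasurableSet 𝒵)
    (hball : ∀ᵐ z ∂P, Metric.closedBall z ρ ⊆ 𝒵) (L : ℕ) :
    ∀ᵐ b ∂(drawLaw P ρ L), ∀ j, b.2.2 j ∈ 𝒵 := by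
  have hprob := fun z : E => isProbabilityMeasure_ballMeasure hρ z
  have hset : ∀ m : ℕ, MeasurableSet {p : E × (Fin m → E) | ∀ j, p.2 j ∈ 𝒵} := fun m => by
    rw [ofPred_forall]
    exact MeasurableSet.iInter fun j => (measurable_pi_apply j).comp measurable_snd h𝒵
  have hz : ∀ ℓ : ℕ, ∀ᵐ p ∂(zetaLaw P ρ ℓ), ∀ j, p.2 j ∈ 𝒵 := fun ℓ => by
    have := isMarkovKernel_piBallKernel (E := E) hρ (2 ^ ℓ)
    rw [zetaLaw_eq P hρ, Measure.ae_compProd_iff (hset _)]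
    filter_upwards [hball] with z hz
    refine ae_all_iff.2 fun j => ?_
    refine (measurePreserving_eval (fun _ : Fin (2 ^ ℓ) => ballMeasure ρ z)
      j).quasiMeasurePreserving.ae (p := fun w => w ∈ 𝒵) ?_
    filter_upwards [ae_ballMeasure_mem ρ z] with w hw using hz hw
  have hm : MeasurableSet {b : Draw L E | ∀ j, b.2.2 j ∈ 𝒵} :=
    MeasurableSpace.measurableSet_iInf.2 fun ℓ => hset (2 ^ (ℓ : ℕ))
  rw [ae_iff, drawLaw, Measure.finsetSum_apply]
  refine Finset.sum_eq_zero fun ℓ _ => ?_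
  have hmap := Measure.map_apply (μ := zetaLaw P ρ (ℓ : ℕ)) (measurable_sigma_mk ℓ) hm.compl
  rw [Measure.smul_apply]
  refine (congrArg _ hmap).trans ?_
  exact (congrArg _ (ae_iff.1 (hz ℓ))).trans (mul_zero _)

theorem rtmlmc_extendLoss {L n : ℕ} {b : Fin n → Draw L E} (hb : ∀ i j, (b i).2.2 j ∈ 𝒵)
    (θ : Param d) : rtmlmc Θ η (extendLoss 𝒵 f) b θ = rtmlmc Θ η f b θ := by
  have hs : ∀ (m : ℕ) (z' : Fin m → E), (∀ j, z' j ∈ 𝒵) →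
      ∀ s, softMean η (extendLoss 𝒵 f) z' s = softMean η f z' s := fun m z' hz s => by
    funext ϑ
    simp only [softMean, extendLoss, indicator_of_mem (hz _)]
  have hl : ∀ i, levelDiff η (extendLoss 𝒵 f) _ (b i).2.2 = levelDiff η f _ (b i).2.2 := fun i => by
    funext ϑ
    simp only [levelDiff, hs _ _ (hb i)]
  simp only [rtmlmc, levelGrad, hl]

theorem iterate_extendLoss {L n N : ℕ} {ω : Fin N → Fin n → Draw L E}
    (hω : ∀ t i j, (ω t i).2.2 j ∈ 𝒵) (θ₁ : Param d) (t : ℕ) :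
    iterate Θ η (extendLoss 𝒵 f) τ θ₁ ω t = iterate Θ η f τ θ₁ ω t := by
  induction t with
  | zero => rfl
  | succ t ih =>
    rw [iterate, iterate, ih]
    by_cases h : t < N
    · rw [dif_pos h, dif_pos h, rtmlmc_extendLoss (hω ⟨t, h⟩)]
    · rw [dif_neg h, dif_neg h]

/-- Almost surely every sampled `z'` lies in `𝒵`, and then the runs with the loss and with its
extension coincide. -/
theorem isStationary_of_extendLoss (hρ : 0 < ρ) (h𝒵 : MeasurableSet 𝒵)
    (hball : ∀ᵐ z ∂P, Metric.closedBall z ρ ⊆ 𝒵) {L n T : ℕ} {F : Param d → ℝ} {ε : ℝ}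
    {θ₁ : Param d}
    (h : IsStationary (outputLaw P ρ L n T) (output Θ η (extendLoss 𝒵 f) τ θ₁) Θ F τ ε) :
    IsStationary (outputLaw P ρ L n T) (output Θ η f τ θ₁) Θ F τ ε := by
  have := isProbabilityMeasure_drawLaw P hρ L
  have := isProbabilityMeasure_batchLaw P hρ L n
  have hbatch : ∀ᵐ b ∂(batchLaw P ρ L n), ∀ i j, (b i).2.2 j ∈ 𝒵 := ae_all_iff.2 fun i =>
    (measurePreserving_eval (fun _ : Fin n => drawLaw P ρ L) i).quasiMeasurePreserving.ae
      (ae_drawLaw_mem P hρ h𝒵 hball L)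
  have hrun : ∀ᵐ ω ∂(runLaw P ρ L n T), ∀ t i j, (ω t i).2.2 j ∈ 𝒵 := ae_all_iff.2 fun t =>
    (measurePreserving_eval (fun _ : Fin (T - 1) => batchLaw P ρ L n)
      t).quasiMeasurePreserving.ae hbatch
  have hrunP : IsProbabilityMeasure (runLaw P ρ L n T) := by unfold runLaw; infer_instance
  have hout : ∀ᵐ ω ∂(outputLaw P ρ L n T), ∀ t i j, (ω.2 t i).2.2 j ∈ 𝒵 :=
    Measure.quasiMeasurePreserving_snd.ae hrun
  unfold IsStationary at h ⊢
  refine (le_of_eq (lintegral_congr_ae ?_)).trans h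
  filter_upwards [hout] with ω hω
  simp only [output, iterate_extendLoss hω]

end Extension

/-! ### Choice of the hyper-parameters -/

section Parameters

/-- This lower bound on the logarithm lets constants and lower powers of it be absorbed into `C *
Real.log (1 / ε) ^ 2`. -/
theorem half_le_log_inv {ε : ℝ} (hε : 0 < ε) (hε2 : ε ≤ 1 / 2) : 1 / 2 ≤ Real.log (1 / ε) := by
  have h2 : (2 : ℝ) ≤ 1 / ε := by rw [le_div_iff₀ hε]; linarith
  have := Real.log_le_log two_pos h2
  linarith [Real.log_two_gt_d9]

/-- `L = N + 2 q`, where `2^{-N}` absorbs `24 K` and `q`, about `2 log (1/ε)`, gives `2^{-q} ≤ ε`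
because `log 2 > 1/2`. -/
theorem exists_level (K : ℝ) : ∃ A : ℝ, 1 ≤ A ∧ ∀ ε : ℝ, 0 < ε → ε ≤ 1 / 2 →
    ∃ L : ℕ, K * (1 / 2) ^ L ≤ ε ^ 2 / 24 ∧ (L : ℝ) + 2 ≤ A * Real.log (1 / ε) := by
  obtain ⟨N, hN⟩ := pow_unbounded_of_one_lt (24 * K) (one_lt_two (α := ℝ))
  refine ⟨2 * N + 12, by linarith [N.cast_nonneg (α := ℝ)], fun ε hε hε2 => ?_⟩
  have hl := half_le_log_inv hε hε2
  set l := Real.log (1 / ε) with hld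
  set q := ⌈2 * l⌉₊ with hq
  have hq1 : 2 * l ≤ q := Nat.le_ceil _
  have hq2 : (q : ℝ) < 2 * l + 1 := Nat.ceil_lt_add_one (by linarith)
  refine ⟨N + 2 * q, ?_, ?_⟩
  · have h1 : 1 / ε ≤ 2 ^ q := by
      rw [← Real.exp_log (show 0 < 1 / ε by positivity), ← hld,
        ← Real.exp_log (show (0 : ℝ) < 2 ^ q by positivity), Real.log_pow]
      refine Real.exp_le_exp.2 ?_
      nlinarith [Real.log_two_gt_d9]
    have h2 : (1 / 2 : ℝ) ^ q ≤ ε := by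
      rw [one_div, inv_pow]
      refine inv_le_of_inv_le₀ hε ?_
      rwa [← one_div]
    have h3 : ((1 / 2 : ℝ) ^ q) ^ 2 ≤ ε ^ 2 := pow_le_pow_left₀ (by positivity) h2 2
    have h4 : K * (1 / 2) ^ N ≤ 1 / 24 := by
      rw [one_div, inv_pow, mul_inv_le_iff₀ (by positivity)]
      linarith
    rw [pow_add, mul_comm 2 q, pow_mul, ← mul_assoc]
    calc _ ≤ 1 / 24 * ε ^ 2 := mul_le_mul h4 h3 (by positivity) (by norm_num)
      _ = _ := by ring
  · push_cast
    nlinarith [N.cast_nonneg (α := ℝ)]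

/-- The initial potential uses `ε²/4`, and bias and variance use `6 · ε²/24` each, in total `3
ε²/4`. The bounds hold for all large `C`, so that one constant can serve both parts of the theorem.
-/
theorem exists_params_constrained {S K B : ℝ} (hS : 0 ≤ S) (hK : 0 ≤ K) (hB : 0 ≤ B) :
    ∃ C₀ : ℝ, ∀ C, C₀ ≤ C → ∀ ε : ℝ, 0 < ε → ε ≤ 1 / 2 →
      ∃ (L T n : ℕ) (τ : ℝ), 0 < T ∧ 0 < n ∧ 0 < τ ∧
        (L : ℝ) ≤ C * Real.log (1 / ε ^ 2) ∧
        (T : ℝ) ≤ C * (1 / ε) ^ 2 * Real.log (1 / ε) ^ 2 ∧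
        (n : ℝ) ≤ C * (1 / ε) ^ 2 * Real.log (1 / ε) ^ 2 ∧ τ ≤ C ∧ S * (4 * τ) ≤ 1 ∧
        8 / τ * B / T + 6 * (K * (1 / 2) ^ L + (n : ℝ)⁻¹ * (12 * K * (L + 1))) ≤ ε ^ 2 ∧
        (T : ℝ) * (n * (L + 2)) ≤ C * (1 / ε) ^ 4 * Real.log (1 / ε) ^ 2 ∧
        (n : ℝ) * (L + 2) ≤ C * (1 / ε) ^ 2 * Real.log (1 / ε) ^ 2 := by
  obtain ⟨A, hA, hlev⟩ := exists_level K
  set a := 128 * B * (S + 1) + 2 with ha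
  set b := 288 * K * A + 4 with hb
  have ha0 : 0 ≤ a := by positivity
  have hb0 : 0 ≤ b := by positivity
  have hA0 : 0 ≤ A := by linarith
  refine ⟨1 + A + 4 * a + 2 * b + b * A + a * (b * A), fun C hC ε hε hε2 => ?_⟩
  have hbA : 0 ≤ b * A := by positivity
  have habA : 0 ≤ a * (b * A) := by positivity
  obtain ⟨L, hL1, hL2⟩ := hlev ε hε hε2
  have hl := half_le_log_inv hε hε2
  have hx : 1 ≤ 1 / ε := by rw [le_div_iff₀ hε]; linarith
  have hlog : Real.log (1 / ε ^ 2) = 2 * Real.log (1 / ε) := by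
    rw [← one_div_pow, Real.log_pow]; norm_num
  have hεx : ε * (1 / ε) = 1 := by field_simp
  rw [hlog]
  set l := Real.log (1 / ε)
  set x := 1 / ε
  have hl0 : 0 < l := by linarith
  have hx2 : 1 ≤ x ^ 2 := one_le_pow₀ hx
  have hεx2 : ε ^ 2 * x ^ 2 = 1 := by rw [← mul_pow, hεx, one_pow]
  have h1l : 1 ≤ 4 * l ^ 2 := by nlinarith
  -- With `8/τ = 32 (S + 1)`, the factor 128 makes `8 B / (τ T) ≤ ε²/4`; below, `288 = 24 · 12`. The
  -- added 1 keeps `T` and `n` positive even if `B` or `K` is zero.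
  set T := ⌈128 * B * (S + 1) * x ^ 2⌉₊ + 1 with hT
  set n := ⌈288 * K * A * l * x ^ 2⌉₊ + 1 with hn
  have hT1 : 128 * B * (S + 1) * x ^ 2 ≤ T := by
    rw [hT]; push_cast
    linarith [Nat.le_ceil (128 * B * (S + 1) * x ^ 2)]
  have hT2 : (T : ℝ) ≤ a * x ^ 2 := by
    rw [hT]; push_cast
    linarith [Nat.ceil_lt_add_one (show 0 ≤ 128 * B * (S + 1) * x ^ 2 by positivity)]
  have hn1 : 288 * K * A * l * x ^ 2 ≤ n := by
    rw [hn]; push_cast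
    linarith [Nat.le_ceil (288 * K * A * l * x ^ 2)]
  have hn2 : (n : ℝ) ≤ b * (l * x ^ 2) := by
    have h4 : 2 ≤ 4 * (l * x ^ 2) := by nlinarith
    rw [hn]; push_cast
    linarith [Nat.ceil_lt_add_one (show 0 ≤ 288 * K * A * l * x ^ 2 by positivity)]
  have hTp : (0 : ℝ) < T := by rw [hT]; positivity
  have hnp : (0 : ℝ) < n := by rw [hn]; positivity
  have hmem : (n : ℝ) * (L + 2) ≤ b * A * (x ^ 2 * l ^ 2) := by
    calc (n : ℝ) * (L + 2) ≤ b * (l * x ^ 2) * (A * l) :=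
          mul_le_mul hn2 hL2 (by positivity) (by positivity)
      _ = _ := by ring
  refine ⟨L, T, n, 1 / (4 * (S + 1)), Nat.succ_pos _, Nat.succ_pos _, by positivity, ?_, ?_, ?_, ?_,
    ?_, ?_, ?_, ?_⟩
  · have : A * l ≤ C * l := mul_le_mul_of_nonneg_right (by linarith) hl0.le
    nlinarith
  · calc (T : ℝ) ≤ a * x ^ 2 * 1 := by linarith
      _ ≤ a * x ^ 2 * (4 * l ^ 2) := mul_le_mul_of_nonneg_left h1l (by positivity)
      _ = 4 * a * (x ^ 2 * l ^ 2) := by ring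
      _ ≤ C * (x ^ 2 * l ^ 2) := mul_le_mul_of_nonneg_right (by linarith) (by positivity)
      _ = _ := by ring
  · calc (n : ℝ) ≤ b * (l * x ^ 2) * 1 := by linarith
      _ ≤ b * (l * x ^ 2) * (2 * l) := mul_le_mul_of_nonneg_left (by linarith) (by positivity)
      _ = 2 * b * (x ^ 2 * l ^ 2) := by ring
      _ ≤ C * (x ^ 2 * l ^ 2) := mul_le_mul_of_nonneg_right (by linarith) (by positivity)
      _ = _ := by ring
  · have : 1 / (4 * (S + 1)) ≤ 1 := by
      rw [div_le_one (by positivity)]; linarith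
    linarith
  · have e : S * (4 * (1 / (4 * (S + 1)))) = S / (S + 1) := by field_simp
    rw [e, div_le_one (by positivity)]
    linarith
  · have t1 : 8 / (1 / (4 * (S + 1))) * B / T ≤ ε ^ 2 / 4 := by
      rw [div_le_iff₀ hTp]
      have := mul_le_mul_of_nonneg_left hT1 (sq_nonneg ε)
      have e : ε ^ 2 * (128 * B * (S + 1) * x ^ 2) = 128 * B * (S + 1) * (ε ^ 2 * x ^ 2) := by ring
      rw [e, hεx2] at this
      rw [div_div_eq_mul_div, div_one]
      linarith
    have t2 : (n : ℝ)⁻¹ * (12 * K * (L + 1)) ≤ ε ^ 2 / 24 := by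
      rw [inv_mul_le_iff₀ hnp]
      have := mul_le_mul_of_nonneg_left hn1 (sq_nonneg ε)
      have e : ε ^ 2 * (288 * K * A * l * x ^ 2) = 288 * K * (A * l) * (ε ^ 2 * x ^ 2) := by ring
      rw [e, hεx2] at this
      have h3 : K * (L + 1) ≤ K * (A * l) := mul_le_mul_of_nonneg_left (by linarith) hK
      linarith
    linarith [sq_nonneg ε]
  · calc (T : ℝ) * (n * (L + 2)) ≤ a * x ^ 2 * (b * A * (x ^ 2 * l ^ 2)) :=
          mul_le_mul hT2 hmem (by positivity) (by positivity)
      _ = a * (b * A) * (x ^ 4 * l ^ 2) := by ring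
      _ ≤ C * (x ^ 4 * l ^ 2) := mul_le_mul_of_nonneg_right (by linarith) (by positivity)
      _ = _ := by ring
  · calc (n : ℝ) * (L + 2) ≤ b * A * (x ^ 2 * l ^ 2) := hmem
      _ ≤ C * (x ^ 2 * l ^ 2) := mul_le_mul_of_nonneg_right (by linarith) (by positivity)
      _ = _ := by ring

/-- One draw per iteration and `τ = ε²/(D l)`, with `l = log (1/ε)`. The factor `1/l` offsets the
growth of the second moment with `L`. -/
theorem exists_params_unconstrained {S K B : ℝ} (hS : 0 ≤ S) (hK : 0 ≤ K) (hB : 0 ≤ B) :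
    ∃ C₀ : ℝ, ∀ C, C₀ ≤ C → ∀ ε : ℝ, 0 < ε → ε ≤ 1 / 2 →
      ∃ (L T n : ℕ) (τ : ℝ), 0 < T ∧ 0 < n ∧ 0 < τ ∧
        (L : ℝ) ≤ C * Real.log (1 / ε ^ 2) ∧
        (T : ℝ) ≤ C * (1 / ε) ^ 4 * Real.log (1 / ε) ^ 2 ∧
        (n : ℝ) ≤ C ∧ τ ≤ C * ε ^ 2 * Real.log (1 / ε) ^ 2 ∧ S * (4 * τ) ≤ 1 ∧
        8 / τ * B / T + (4 * (K * (1 / 2) ^ L) + 8 * (S * τ) * (24 * K * (L + 1))) ≤ ε ^ 2 ∧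
        (T : ℝ) * (n * (L + 2)) ≤ C * (1 / ε) ^ 4 * Real.log (1 / ε) ^ 2 ∧
        (n : ℝ) * (L + 2) ≤ C * Real.log (1 / ε) ^ 2 := by
  obtain ⟨A, hA, hlev⟩ := exists_level K
  have hA0 : 0 ≤ A := by linarith
  -- The three terms serve, in turn, the second-moment bound `192 S K A τ l ≤ ε²/4`, the step size
  -- condition `4 S τ ≤ 1`, and `1 ≤ D`.
  set D := 768 * S * K * A + 8 * S + 1 with hD
  have hD1 : 1 ≤ D := by
    have : 0 ≤ 768 * S * K * A := by positivity
    linarith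
  set e := 32 * B * D + 4 with he
  have he0 : 0 ≤ e := by positivity
  refine ⟨8 + 2 * A + 2 * e + e * A, fun C hC ε hε hε2 => ?_⟩
  have heA : 0 ≤ e * A := by positivity
  obtain ⟨L, hL1, hL2⟩ := hlev ε hε hε2
  have hl := half_le_log_inv hε hε2
  have hx : 1 ≤ 1 / ε := by rw [le_div_iff₀ hε]; linarith
  have hlog : Real.log (1 / ε ^ 2) = 2 * Real.log (1 / ε) := by
    rw [← one_div_pow, Real.log_pow]; norm_num
  have hεx : ε * (1 / ε) = 1 := by field_simp
  rw [hlog]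
  set l := Real.log (1 / ε)
  set x := 1 / ε
  have hl0 : 0 < l := by linarith
  have hx4 : 1 ≤ x ^ 4 := one_le_pow₀ hx
  have hεx4 : ε ^ 4 * x ^ 4 = 1 := by rw [← mul_pow, hεx, one_pow]
  have hε1 : ε ^ 2 ≤ 1 := pow_le_one₀ hε.le (by linarith)
  set T := ⌈32 * B * D * l * x ^ 4⌉₊ + 1 with hT
  have hT1 : 32 * B * D * l * x ^ 4 ≤ T := by
    rw [hT]; push_cast
    linarith [Nat.le_ceil (32 * B * D * l * x ^ 4)]
  have hT2 : (T : ℝ) ≤ e * (l * x ^ 4) := by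
    have h4 : 2 ≤ 4 * (l * x ^ 4) := by nlinarith
    rw [hT]; push_cast
    linarith [Nat.ceil_lt_add_one (show 0 ≤ 32 * B * D * l * x ^ 4 by positivity)]
  have hTp : (0 : ℝ) < T := by rw [hT]; positivity
  have hDl : 0 < D * l := by positivity
  set τ := ε ^ 2 / (D * l) with hτ
  have hτp : 0 < τ := by positivity
  have hτDl : τ * (D * l) = ε ^ 2 := by rw [hτ]; field_simp
  refine ⟨L, T, 1, τ, Nat.succ_pos _, Nat.one_pos, hτp, ?_, ?_, ?_, ?_, ?_, ?_, ?_, ?_⟩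
  · have : A * l ≤ C * l := mul_le_mul_of_nonneg_right (by linarith) hl0.le
    nlinarith
  · calc (T : ℝ) ≤ e * (l * x ^ 4) * 1 := by linarith
      _ ≤ e * (l * x ^ 4) * (2 * l) := mul_le_mul_of_nonneg_left (by linarith) (by positivity)
      _ = 2 * e * (x ^ 4 * l ^ 2) := by ring
      _ ≤ C * (x ^ 4 * l ^ 2) := mul_le_mul_of_nonneg_right (by linarith) (by positivity)
      _ = _ := by ring
  · push_cast; linarith
  · have h3 : 1 ≤ 8 * l ^ 2 * (D * l) := by
      have h5 : 1 ≤ 8 * l ^ 3 := by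
        have := pow_le_pow_left₀ (by norm_num) hl 3
        linarith
      calc (1 : ℝ) ≤ 8 * l ^ 3 * 1 := by linarith
        _ ≤ 8 * l ^ 3 * D := mul_le_mul_of_nonneg_left hD1 (by positivity)
        _ = _ := by ring
    calc τ ≤ 8 * (ε ^ 2 * l ^ 2) := by
          rw [hτ, div_le_iff₀ hDl]
          have := mul_le_mul_of_nonneg_left h3 (sq_nonneg ε)
          linarith
      _ ≤ C * (ε ^ 2 * l ^ 2) := mul_le_mul_of_nonneg_right (by linarith) (by positivity)
      _ = _ := by ring
  · have h3 : 8 * S * (1 / 2) ≤ D * l := by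
      refine mul_le_mul ?_ hl (by norm_num) (by linarith)
      have : 0 ≤ 768 * S * K * A := by positivity
      linarith
    have h4 : τ * (8 * S * (1 / 2)) ≤ τ * (D * l) := mul_le_mul_of_nonneg_left h3 hτp.le
    linarith
  · have t1 : 8 / τ * B / T ≤ ε ^ 2 / 4 := by
      rw [div_le_iff₀ hTp, div_mul_eq_mul_div, div_le_iff₀ hτp]
      have h3 := mul_le_mul_of_nonneg_left hT1 (show 0 ≤ ε ^ 2 / 4 * τ by positivity)
      have e1 : ε ^ 2 / 4 * τ * (32 * B * D * l * x ^ 4)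
          = 8 * B * (ε ^ 2 * x ^ 4 * (τ * (D * l))) := by ring
      have e2 : ε ^ 2 * x ^ 4 * ε ^ 2 = 1 := by rw [← hεx4]; ring
      rw [e1, hτDl, e2] at h3
      linarith
    have t2 : 8 * (S * τ) * (24 * K * (L + 1)) ≤ ε ^ 2 / 4 := by
      have h3 : 768 * S * K * A ≤ D := by linarith
      have h4 : 8 * (S * τ) * (24 * K * (L + 1)) ≤ 8 * (S * τ) * (24 * K * (A * l)) :=
        mul_le_mul_of_nonneg_left (mul_le_mul_of_nonneg_left (by linarith) (by positivity))
          (by positivity)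
      have h5 : τ * l * (768 * S * K * A) ≤ τ * l * D := mul_le_mul_of_nonneg_left h3 (by positivity)
      linarith
    linarith [sq_nonneg ε]
  · calc (T : ℝ) * ((1 : ℕ) * (L + 2)) ≤ e * (l * x ^ 4) * (A * l) := by
          rw [Nat.cast_one, one_mul]
          exact mul_le_mul hT2 hL2 (by positivity) (by positivity)
      _ = e * A * (x ^ 4 * l ^ 2) := by ring
      _ ≤ C * (x ^ 4 * l ^ 2) := mul_le_mul_of_nonneg_right (by linarith) (by positivity)
      _ = _ := by ring
  · calc ((1 : ℕ) : ℝ) * (L + 2) ≤ A * l * 1 := by rw [Nat.cast_one]; linarith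
      _ ≤ A * l * (2 * l) := mul_le_mul_of_nonneg_left (by linarith) (by positivity)
      _ = 2 * A * l ^ 2 := by ring
      _ ≤ C * l ^ 2 := mul_le_mul_of_nonneg_right (by linarith) (by positivity)

theorem smoothConst_nonneg {Lf Sf B η : ℝ} (hSf : 0 ≤ Sf) (hη : 0 < η) :
    0 ≤ smoothConst Lf Sf B η := by unfold smoothConst; positivity

end Parameters

end EntropicSGD

open EntropicSGD
theorem mainTheorem3 :
    ∃ k : ℕ, ∀ Lf Sf B η : ℝ, 0 ≤ Lf → 0 ≤ Sf → 0 ≤ B → 0 < η →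
      ∃ C : ℝ, 0 < C ∧ ∀ ε : ℝ, 0 < ε → ε ≤ 1 / 2 →
        -- smooth nonconvex optimization over a constraint set
        (∃ (L T n : ℕ) (τ : ℝ), 0 < T ∧ 0 < n ∧ 0 < τ ∧
          (L : ℝ) ≤ C * Real.log (1 / ε ^ 2) ∧
          (T : ℝ) ≤ C * (1 / ε) ^ 2 * Real.log (1 / ε) ^ k ∧
          (n : ℝ) ≤ C * (1 / ε) ^ 2 * Real.log (1 / ε) ^ k ∧
          τ ≤ C ∧
          ∀ (d : ℕ) (E : Type*) [NormedAddCommGroup E] [NormedSpace ℝ E]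
            [FiniteDimensional ℝ E] [MeasurableSpace E] [BorelSpace E]
            (𝒵 : Set E) (P : Measure E) [IsProbabilityMeasure P] (ρ : ℝ)
            (Θ : Set (Param d)) (f : Param d → E → ℝ) (θ₁ : Param d),
            MeasurableSet 𝒵 → 0 < ρ → (∀ᵐ z ∂P, Metric.closedBall z ρ ⊆ 𝒵) →
            IsClosed Θ → Convex ℝ Θ → θ₁ ∈ Θ → SmoothBoundedLoss Θ 𝒵 f Lf Sf B →
              DifferentiableOn ℝ (objective P ρ η f) Θ ∧
              IsStationary (outputLaw P ρ L n T) (output Θ η f τ θ₁) Θ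
                (objective P ρ η f) τ ε ∧
              computationalCost P ρ L n T ≤
                ENNReal.ofReal (C * (1 / ε) ^ 4 * Real.log (1 / ε) ^ k) ∧
              memoryCost P ρ L n ≤
                ENNReal.ofReal (C * (1 / ε) ^ 2 * Real.log (1 / ε) ^ k)) ∧
        -- unconstrained smooth nonconvex optimization
        (∃ (L T n : ℕ) (τ : ℝ), 0 < T ∧ 0 < n ∧ 0 < τ ∧
          (L : ℝ) ≤ C * Real.log (1 / ε ^ 2) ∧
          (T : ℝ) ≤ C * (1 / ε) ^ 4 * Real.log (1 / ε) ^ k ∧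
          (n : ℝ) ≤ C ∧
          τ ≤ C * ε ^ 2 * Real.log (1 / ε) ^ k ∧
          ∀ (d : ℕ) (E : Type*) [NormedAddCommGroup E] [NormedSpace ℝ E]
            [FiniteDimensional ℝ E] [MeasurableSpace E] [BorelSpace E]
            (𝒵 : Set E) (P : Measure E) [IsProbabilityMeasure P] (ρ : ℝ)
            (f : Param d → E → ℝ) (θ₁ : Param d),
            MeasurableSet 𝒵 → 0 < ρ → (∀ᵐ z ∂P, Metric.closedBall z ρ ⊆ 𝒵) →
            SmoothBoundedLoss Set.univ 𝒵 f Lf Sf B →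
              Differentiable ℝ (objective P ρ η f) ∧
              IsStationary (outputLaw P ρ L n T) (output Set.univ η f τ θ₁) Set.univ
                (objective P ρ η f) τ ε ∧
              computationalCost P ρ L n T ≤
                ENNReal.ofReal (C * (1 / ε) ^ 4 * Real.log (1 / ε) ^ k) ∧
              memoryCost P ρ L n ≤ ENNReal.ofReal (C * Real.log (1 / ε) ^ k)) := by
  -- One logarithm comes from the expected cost `L + 2` of a draw. The other comes from the second
  -- moment, which enlarges `n` in the first part and `T` in the second.
  refine ⟨2, fun Lf Sf B η hLf hSf hB hη => ?_⟩
  have hS := smoothConst_nonneg (Lf := Lf) (B := B) hSf hη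
  have hK := varConst_nonneg Lf B η
  obtain ⟨C₁, h₁⟩ := exists_params_constrained hS hK hB
  obtain ⟨C₂, h₂⟩ := exists_params_unconstrained hS hK hB
  refine ⟨max 1 (max C₁ C₂), by positivity, fun ε hε hε2 => ⟨?_, ?_⟩⟩
  · obtain ⟨L, T, n, τ, hT, hn, hτ, b₁, b₂, b₃, b₄, hSτ, herr, hcomp, hmem⟩ :=
      h₁ _ ((le_max_left C₁ C₂).trans (le_max_right 1 _)) ε hε hε2
    refine ⟨L, T, n, τ, hT, hn, hτ, b₁, b₂, b₃, b₄, ?_⟩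
    intro d E _ _ _ _ _ 𝒵 P _ ρ Θ f θ₁ h𝒵 hρ hball hcl hΘ hθ₁ H
    have H' := H.extendLoss h𝒵 hLf hSf hB
    rw [← objective_extendLoss P (f := f) (η := η) hball]
    exact ⟨differentiableOn_objective P hρ hη hΘ hLf hSf H',
      isStationary_of_extendLoss P hρ h𝒵 hball
        (isStationary_constrained P hρ hη hcl hΘ hLf hSf hB H' hτ hSτ hT hn herr hθ₁),
      (computationalCost_le P hρ L n T).trans (ENNReal.ofReal_le_ofReal hcomp),
      (memoryCost_le P hρ L n).trans (ENNReal.ofReal_le_ofReal hmem)⟩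
  · obtain ⟨L, T, n, τ, hT, hn, hτ, b₁, b₂, b₃, b₄, hSτ, herr, hcomp, hmem⟩ :=
      h₂ _ ((le_max_right C₁ C₂).trans (le_max_right 1 _)) ε hε hε2
    refine ⟨L, T, n, τ, hT, hn, hτ, b₁, b₂, b₃, b₄, ?_⟩
    intro d E _ _ _ _ _ 𝒵 P _ ρ f θ₁ h𝒵 hρ hball H
    have H' := H.extendLoss h𝒵 hLf hSf hB
    rw [← objective_extendLoss P (f := f) (η := η) hball]
    exact ⟨differentiableOn_univ.1 (differentiableOn_objective P hρ hη convex_univ hLf hSf H'),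
      isStationary_of_extendLoss P hρ h𝒵 hball
        (isStationary_unconstrained P hρ hη hLf hSf hB H' hτ hS hSτ hT hn herr θ₁),
      (computationalCost_le P hρ L n T).trans (ENNReal.ofReal_le_ofReal hcomp),
      (memoryCost_le P hρ L n).trans (ENNReal.ofReal_le_ofReal hmem)⟩
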